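/- Let $p>2$ be a prime and $k=\mathbb F_p$. Let $U(\mathcal G)=\mathrm{Dist}(SL_2)$ be Kostant's $\mathbb Z$-form of the enveloping algebra of $sl_2$ reduced mod $p$, with elements $E^{[n]},F^{[n]},\binom Hn$; it is filtered by the order, the elements of order $\le n$ being spanned by the $E^{[a]}\binom Hb F^{[c]}$ with $a+b+c\le n$. For a $k$-algebra $R=\bigcup_n R_n$ filtered by order and $m\ge 0$, let $R^{(m)}$ be the quotient of the tensor algebra of $R_{2p^m-1}$ by the relations $\lambda=\lambda 1_R$ ($\lambda\in k$), $x\otimes y-y\otimes x=[x,y]$ ($x,y\in R_{p^m}$) and $x\otimes y=xy$ ($x\in R_{p^m}$, $y\in R_{p^m-1}$). Let $U^{(m)}(\mathcal G)$ be obtained in this way from $U(\mathcal G)$, and, on $X=\mathbb P^1_k=\mathrm{Spec}\,k[T]\cup\mathrm{Spec}\,k[S]$ with $S=T^{-1}$, let $\mathcal D_X^{(m)}$ be obtained in this way, over each of the two charts and over their intersection, from the differential operators filtered by order; $H^0(X,\mathcal D^{(m)}_X)$ is the algebra of pairs of sections over the two charts agreeing on the intersection. Put $\Delta_T=\sum_{i=0}^{p-1}(-1)^i\binom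 Hi$ and $\mathcal H=\sum_{r=0}^{p-1}(-T)^r\partial_T^{[r]}$. As $k=\mathbb F_p$, we identify $X'=X$, and the Frobenius pullback of a function is $F'^*(f)=f^p$. Proposition 3.2.2. Let $m\ge 0$. (1) There are a unique non-unital algebra morphism $\varphi_m:U^{(m)}(\mathcal G)\to U^{(m+1)}(\mathcal G)$ induced on generators by the algebra endomorphism $E^{[i]}\mapsto E^{[ip]}\Delta_T$, $F^{[i]}\mapsto F^{[ip]}\Delta_T$, $\binom Hi\mapsto\binom H{ip}\Delta_T$ of $U(\mathcal G)$; for $n=m$ and $n=m+1$, a unique algebra morphism $\rho_n:U^{(n)}(\mathcal G)\to H^0(X,\mathcal D_X^{(n)})$ induced on generators by the infinitesimal action $E^{[i]}\mapsto\partial_T^{[i]}$, $F^{[i]}\mapsto\partial_S^{[i]}$, $\binom Hi\mapsto\binom{2S\partial_S}i$; and a unique morphism $P\mapsto P'$ of sheaves of non-unital algebras (on the above cover) from $\mathcal D_X^{(m)}$ to $\mathcal D_X^{(m+1)}$, semilinear over functions with respect to $F'^*$, which sends each generator $P$ (an operator of order $\le 2p^m-1$) to the class of the operator $P'$ of order $\le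 2p^{m+1}-1$ such that $P'(F'^*f)=F'^*(P f)$ for all $f$ and $P'\mathcal H=P'$. (2) The square formed by $\varphi_m$, $\rho_m$, $\rho_{m+1}$ and the map $H^0(X,\mathcal D^{(m)}_X)\to H^0(X,\mathcal D^{(m+1)}_X)$, $P\mapsto P'$, commutes: $\rho_{m+1}(\varphi_m(u))=\rho_m(u)'$ for all $u\in U^{(m)}(\mathcal G)$. (3) For every section $P$ of $\mathcal D_X^{(m)}$ over a chart (or the intersection) and every function $f$, $F'^*(P\cdot f)=P'\cdot F'^*(f)$. (4) For $t=T$ or $t=S$ and all $n\ge 0$, the usual differential operators satisfy $$(\partial_t^{[n]})'=\sum_{r=0}^{p-1}(-t)^r\binom{np+r}{np}\partial_t^{[np+r]}=\partial_t^{[np]}\,\mathcal H,$$ and for $n\le 2p^m-1$ the same equalities hold in $\mathcal D_X^{(m+1)}$, for the image of $\partial_t^{[n]}\in\mathcal D_X^{(m)}$, over each chart where $t$ is a coordinate. -/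

import Mathlib

noncomputable section

namespace SL2Frobenius

/-! ### Level `m` algebras attached to a filtered algebra

Both the enveloping algebra of level `m` and the differential operators of level `m` are given by
the same recipe applied to a filtered `k`-algebra `R = ⋃ Fil n`: the quotient of the tensor algebra
of `Fil (2 p ^ m - 1)` by the relations `c = c • 1` for scalars `c`,
`x ⊗ y - y ⊗ x = [x, y]` for `x, y ∈ Fil (p ^ m)`, and
`x ⊗ y = x y` for `x ∈ Fil (p ^ m)`, `y ∈ Fil (p ^ m - 1)`. -/

section Level

variable (k : Type*) {R : Type*} [CommRing k] [Ring R] [Algebra k R]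
  (Fil : ℕ → Submodule k R) (p m : ℕ)

/-- The order `2 p ^ m - 1` of the generators at level `m`. -/
def genOrder (p m : ℕ) : ℕ := 2 * p ^ m - 1

/-- The defining relations of the level `m` algebra. -/
inductive LevelRel :
    TensorAlgebra k (Fil (genOrder p m)) → TensorAlgebra k (Fil (genOrder p m)) → Prop
  | scalar (c : k) (x : Fil (genOrder p m)) (hx : (x : R) = algebraMap k R c) :
      LevelRel (TensorAlgebra.ι k x) (algebraMap k _ c)
  | comm (x y z : Fil (genOrder p m)) (hx : (x : R) ∈ Fil (p ^ m)) (hy : (y : R) ∈ Fil (p ^ m))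
      (hz : (z : R) = (x : R) * y - (y : R) * x) :
      LevelRel (TensorAlgebra.ι k x * TensorAlgebra.ι k y
        - TensorAlgebra.ι k y * TensorAlgebra.ι k x) (TensorAlgebra.ι k z)
  | mul (x y z : Fil (genOrder p m)) (hx : (x : R) ∈ Fil (p ^ m))
      (hy : (y : R) ∈ Fil (p ^ m - 1)) (hz : (z : R) = (x : R) * y) :
      LevelRel (TensorAlgebra.ι k x * TensorAlgebra.ι k y) (TensorAlgebra.ι k z)

/-- The level `m` algebra of the filtered algebra `(R, Fil)`. -/
abbrev Level : Type _ := RingQuot (LevelRel k Fil p m)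

/-- The generators of the level `m` algebra: the elements of `R` of order `≤ 2 p ^ m - 1`. -/
def lev : Fil (genOrder p m) →ₗ[k] Level k Fil p m :=
  (RingQuot.mkAlgHom k (LevelRel k Fil p m)).toLinearMap ∘ₗ TensorAlgebra.ι k

/-- The canonical map from the level `m` algebra to `R`, the identity on generators. -/
def act : Level k Fil p m →ₐ[k] R :=
  RingQuot.liftAlgHom k ⟨TensorAlgebra.lift k (Fil (genOrder p m)).subtype, by
    intro a b h
    induction h with
    | scalar c x hx => simpa using hx
    | comm x y z hx hy hz => simpa using hz.symm
    | mul x y z hx hy hz => simpa using hz.symm⟩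

/-- Functoriality of the level `m` algebra for an inclusion of filtrations of `R`. -/
def levelMap {Fil Fil' : ℕ → Submodule k R} (h : ∀ n, Fil n ≤ Fil' n) :
    Level k Fil p m →ₐ[k] Level k Fil' p m :=
  RingQuot.liftAlgHom k ⟨TensorAlgebra.lift k
      (lev k Fil' p m ∘ₗ Submodule.inclusion (h (genOrder p m))), by
    intro a b hab
    induction hab with
    | scalar c x hx =>
      have := RingQuot.mkAlgHom_rel k (LevelRel.scalar (Fil := Fil') (p := p) (m := m) c
        (Submodule.inclusion (h _) x) hx)
      simpa [lev] using this
    | comm x y z hx hy hz =>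
      have := RingQuot.mkAlgHom_rel k (LevelRel.comm (Fil := Fil') (p := p) (m := m)
        (Submodule.inclusion (h _) x) (Submodule.inclusion (h _) y)
        (Submodule.inclusion (h _) z) (h _ hx) (h _ hy) hz)
      simpa [lev] using this
    | mul x y z hx hy hz =>
      have := RingQuot.mkAlgHom_rel k (LevelRel.mul (Fil := Fil') (p := p) (m := m)
        (Submodule.inclusion (h _) x) (Submodule.inclusion (h _) y)
        (Submodule.inclusion (h _) z) (h _ hx) (h _ hy) hz)
      simpa [lev] using this⟩

end Level

/-! ### The distribution algebra of `SL₂` and its level `m` versions -/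

/-- The universal enveloping algebra of `sl₂(ℚ)`. -/
abbrev Env : Type := UniversalEnvelopingAlgebra ℚ (LieAlgebra.SpecialLinear.sl (Fin 2) ℚ)

/-- The standard element `E` of `sl₂`. -/
def envE : Env := UniversalEnvelopingAlgebra.ι ℚ
  (⟨!![0, 1; 0, 0], by simp [LieAlgebra.SpecialLinear.sl]⟩ :
    LieAlgebra.SpecialLinear.sl (Fin 2) ℚ)

/-- The standard element `F` of `sl₂`. -/
def envF : Env := UniversalEnvelopingAlgebra.ι ℚ
  (⟨!![0, 0; 1, 0], by simp [LieAlgebra.SpecialLinear.sl]⟩ :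
    LieAlgebra.SpecialLinear.sl (Fin 2) ℚ)

/-- The standard element `H` of `sl₂`. -/
def envH : Env := UniversalEnvelopingAlgebra.ι ℚ
  (⟨!![1, 0; 0, -1], by simp [LieAlgebra.SpecialLinear.sl]⟩ :
    LieAlgebra.SpecialLinear.sl (Fin 2) ℚ)

/-- The divided power `x ^ n / n!`. -/
def divPow (x : Env) (n : ℕ) : Env := ((n.factorial : ℚ)⁻¹) • x ^ n

/-- The binomial `x (x - 1) ⋯ (x - n + 1) / n!`. -/
def binom (x : Env) (n : ℕ) : Env :=
  ((n.factorial : ℚ)⁻¹) • Polynomial.aeval x (descPochhammer ℚ n)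

/-- Kostant's `ℤ`-form of the enveloping algebra of `sl₂`. -/
def kostant : Subalgebra ℤ Env :=
  Algebra.adjoin ℤ (Set.range (divPow envE) ∪ Set.range (divPow envF) ∪ Set.range (binom envH))

/-- The distribution algebra of `SL₂` over `𝔽_p`: Kostant's form reduced modulo `p`. -/
abbrev Dist (p : ℕ) : Type := TensorProduct ℤ (ZMod p) kostant

/-- `E^[n]`. -/
def distE (p n : ℕ) : Dist p :=
  1 ⊗ₜ[ℤ] ⟨divPow envE n, Algebra.subset_adjoin (.inl (.inl ⟨n, rfl⟩))⟩

/-- `F^[n]`. -/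
def distF (p n : ℕ) : Dist p :=
  1 ⊗ₜ[ℤ] ⟨divPow envF n, Algebra.subset_adjoin (.inl (.inr ⟨n, rfl⟩))⟩

/-- The binomial of `H` over `n`. -/
def distH (p n : ℕ) : Dist p :=
  1 ⊗ₜ[ℤ] ⟨binom envH n, Algebra.subset_adjoin (.inr ⟨n, rfl⟩)⟩

/-- The distributions of order `≤ n`. -/
def distFil (p n : ℕ) : Submodule (ZMod p) (Dist p) :=
  Submodule.span (ZMod p)
    {x | ∃ a b c : ℕ, a + b + c ≤ n ∧ x = distE p a * distH p b * distF p c}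

/-- The enveloping algebra of level `m` of `sl₂`. -/
abbrev U (p m : ℕ) : Type := Level (ZMod p) (distFil p) p m

/-- The norm `Δ_T` of the diagonal torus. -/
def normT (p : ℕ) : Dist p := ∑ i ∈ Finset.range p, (-1) ^ i * distH p i

/-- `φ` is the (non-unital) endomorphism of the distribution algebra given by
`E^[i] ↦ E^[ip] Δ_T`, `F^[i] ↦ F^[ip] Δ_T` and likewise for the binomials of `H`. -/
structure IsSplitting (p : ℕ) (φ : Dist p →ₙₐ[ZMod p] Dist p) : Prop where
  map_E : ∀ i, φ (distE p i) = distE p (i * p) * normT p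
  map_F : ∀ i, φ (distF p i) = distF p (i * p) * normT p
  map_H : ∀ i, φ (distH p i) = distH p (i * p) * normT p

/-- `φm` is the map of level `m` algebras induced by the above `φ`. -/
def IsPhi (p m : ℕ) (φm : U p m →ₙₐ[ZMod p] U p (m + 1)) : Prop :=
  ∃ φ : Dist p →ₙₐ[ZMod p] Dist p, IsSplitting p φ ∧
    ∀ x : distFil p (genOrder p m), ∃ h : φ x ∈ distFil p (genOrder p (m + 1)),
      φm (lev (ZMod p) (distFil p) p m x) = lev (ZMod p) (distFil p) p (m + 1) ⟨φ x, h⟩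

/-! ### Differential operators -/

section Diff

variable (k : Type*) {A : Type*} [CommRing k] [CommRing A] [Algebra k A]

/-- Commutator `P ↦ P a - a P` with the multiplication by `a`. -/
def adFun (a : A) : Module.End k A →ₗ[k] Module.End k A :=
  LinearMap.mulRight k (LinearMap.mulLeft k a) - LinearMap.mulLeft k (LinearMap.mulLeft k a)

variable (A) in
/-- Grothendieck's `k`-linear differential operators of order `≤ n` on `A`. -/
def diffOp : ℕ → Submodule k (Module.End k A)
  | 0 => ⨅ a : A, LinearMap.ker (adFun k a)
  | n + 1 => ⨅ a : A, (diffOp n).comap (adFun k a)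

/-- Functions are differential operators of order `≤ n` for every `n`. -/
theorem mulLeft_mem_diffOp (a : A) (n : ℕ) : LinearMap.mulLeft k a ∈ diffOp k A n := by
  have h : ∀ b : A, adFun k b (LinearMap.mulLeft k a) = 0 := by
    intro b
    ext x
    simp [adFun, mul_left_comm]
  cases n with
  | zero => simpa [diffOp] using h
  | succ n => simp [diffOp, h]

end Diff

/-! ### The projective line

`X = ℙ¹` over `k = 𝔽_p` is covered by `Spec k[T]` and `Spec k[S]`, glued along
`Spec k[T, T⁻¹]` by `S = T⁻¹`. All rings of functions are seen inside the ring of functions of the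
overlap. -/

/-- Functions on the overlap. -/
abbrev L (p : ℕ) : Type := LaurentPolynomial (ZMod p)

/-- The charts of `ℙ¹`. -/
inductive Chart
  | zero
  | infty
  | overlap

/-- The ring of functions of a chart. -/
def Chart.fn (p : ℕ) : Chart → Subalgebra (ZMod p) (L p)
  | .zero => Algebra.adjoin (ZMod p) {LaurentPolynomial.T 1}
  | .infty => Algebra.adjoin (ZMod p) {LaurentPolynomial.T (-1)}
  | .overlap => ⊤

/-- Differential operators of order `≤ n` of the sheaf of functions over a chart: such an operator
is determined by its component on the overlap, and an operator on the overlap comes from the chart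
exactly when it preserves the functions on the chart. -/
def sheafDiff (p : ℕ) (V : Chart) (n : ℕ) : Submodule (ZMod p) (Module.End (ZMod p) (L p)) where
  carrier := {P | P ∈ diffOp (ZMod p) (L p) n ∧ ∀ f ∈ V.fn p, P f ∈ V.fn p}
  add_mem' hP hQ := ⟨add_mem hP.1 hQ.1, fun f hf => add_mem (hP.2 f hf) (hQ.2 f hf)⟩
  zero_mem' := ⟨zero_mem _, fun _ _ => zero_mem _⟩
  smul_mem' c _ hP := ⟨Submodule.smul_mem _ c hP.1, fun f hf => Subalgebra.smul_mem _ (hP.2 f hf) c⟩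

/-- Restriction of operators to the overlap. -/
theorem sheafDiff_le_overlap (p : ℕ) (V : Chart) (n : ℕ) :
    sheafDiff p V n ≤ sheafDiff p .overlap n :=
  fun _ hP => ⟨hP.1, fun _ _ => Algebra.mem_top⟩

/-- Differential operators of level `m` over a chart. -/
abbrev D (p m : ℕ) (V : Chart) : Type := Level (ZMod p) (sheafDiff p V) p m

/-- The section of level `m` defined by an operator of order `≤ 2 p ^ m - 1`. -/
abbrev dlev (p m : ℕ) (V : Chart) : sheafDiff p V (genOrder p m) →ₗ[ZMod p] D p m V :=
  lev (ZMod p) (sheafDiff p V) p m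

/-- Action of the level `m` operators over a chart on functions. -/
abbrev dact (p m : ℕ) (V : Chart) : D p m V →ₐ[ZMod p] Module.End (ZMod p) (L p) :=
  act (ZMod p) (sheafDiff p V) p m

/-- Functions on a chart as differential operators of level `m`. -/
def ofFun (p m : ℕ) (V : Chart) (a : V.fn p) : D p m V :=
  dlev p m V ⟨LinearMap.mulLeft (ZMod p) (a : L p),
    mulLeft_mem_diffOp _ _ _, fun _ hf => mul_mem a.2 hf⟩

/-- Restriction of level `m` operators to the overlap. -/
def res (p m : ℕ) (V : Chart) : D p m V →ₐ[ZMod p] D p m .overlap :=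
  levelMap (ZMod p) p m (sheafDiff_le_overlap p V)

/-- `H⁰(ℙ¹, 𝒟^(m))`: pairs of sections over the two affine lines agreeing on the overlap. -/
def H0 (p m : ℕ) : Subalgebra (ZMod p) (D p m .zero × D p m .infty) :=
  AlgHom.equalizer ((res p m .zero).comp (AlgHom.fst _ _ _))
    ((res p m .infty).comp (AlgHom.snd _ _ _))

/-! ### Explicit operators -/

/-- The linear operator with `T ^ j ↦ g j`. -/
def onMonomials {p : ℕ} (g : ℤ → L p) : Module.End (ZMod p) (L p) :=
  Finsupp.linearCombination (ZMod p) g ∘ₗ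
    (AddMonoidAlgebra.coeffLinearEquiv (ZMod p)).toLinearMap

/-- The divided power `∂_t^[n]` for the coordinate `t = T ^ ε`, `ε = ± 1`, that is
`t ^ j ↦ binom(j, n) t ^ (j - n)` for all integers `j`. -/
def hasse (p : ℕ) (ε : ℤˣ) (n : ℕ) : Module.End (ZMod p) (L p) :=
  onMonomials fun j =>
    ((Ring.choose (ε * j : ℤ) n : ℤ) : ZMod p) • LaurentPolynomial.T (j - ε * n)

/-- The binomial of `2 S ∂_S` over `n`, that is `S ^ j ↦ binom(2 j, n) S ^ j`. -/
def binomEuler (p n : ℕ) : Module.End (ZMod p) (L p) :=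
  onMonomials fun j => ((Ring.choose (-2 * j : ℤ) n : ℤ) : ZMod p) • LaurentPolynomial.T j

/-- The operator `∑_{r < p} (-t) ^ r binom(n p + r, n p) ∂_t^[n p + r]`, `t = T ^ ε`. -/
def garnierSum (p : ℕ) (ε : ℤˣ) (n : ℕ) : Module.End (ZMod p) (L p) :=
  ∑ r ∈ Finset.range p, ((-1) ^ r * ((n * p + r).choose (n * p) : ZMod p)) •
    (LinearMap.mulLeft (ZMod p) (LaurentPolynomial.T (ε * r : ℤ) : L p) * hasse p ε (n * p + r))

/-- The Dwork operator `ℋ = ∑_{r < p} (-T) ^ r ∂_T^[r]`. -/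
def dwork (p : ℕ) : Module.End (ZMod p) (L p) :=
  ∑ r ∈ Finset.range p, (-1 : ZMod p) ^ r •
    (LinearMap.mulLeft (ZMod p) (LaurentPolynomial.T (r : ℤ) : L p) * hasse p 1 r)

/-! ### The map `ρ_m` -/

/-- `ρ` is the infinitesimal action of `SL₂` on functions:
`E^[n] ↦ ∂_T^[n]`, `F^[n] ↦ ∂_S^[n]`, and hence `H ↦ 2 S ∂_S`. -/
structure IsCanonicalAction (p : ℕ) (ρ : Dist p →ₐ[ZMod p] Module.End (ZMod p) (L p)) : Prop where
  map_E : ∀ n, ρ (distE p n) = hasse p 1 n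
  map_F : ∀ n, ρ (distF p n) = hasse p (-1) n
  map_H : ∀ n, ρ (distH p n) = binomEuler p n

/-- `ρm` is the map of level `m` induced by the above `ρ`. -/
def IsRho (p m : ℕ) (ρm : U p m →ₐ[ZMod p] H0 p m) : Prop :=
  ∃ ρ : Dist p →ₐ[ZMod p] Module.End (ZMod p) (L p), IsCanonicalAction p ρ ∧
    ∀ x : distFil p (genOrder p m),
      ∃ (h : ρ x ∈ sheafDiff p .zero (genOrder p m)) (h' : ρ x ∈ sheafDiff p .infty (genOrder p m)),
        (ρm (lev (ZMod p) (distFil p) p m x) : D p m .zero × D p m .infty) =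
          (dlev p m .zero ⟨ρ x, h⟩, dlev p m .infty ⟨ρ x, h'⟩)

/-! ### Garnier's map

As `k = 𝔽_p`, the Frobenius twist of `X` is `X`, and the Frobenius pullback of a function `f` is
`f ^ p`. -/

/-- `P'` is the transform of the operator `P`: it satisfies `P' (F^* f) = F^* (P f)` and factors
through the projector `ℋ` onto the `p`-th powers. -/
structure IsGarnierTransform (p : ℕ) (P P' : Module.End (ZMod p) (L p)) : Prop where
  frob : ∀ f : L p, P' (f ^ p) = (P f) ^ p
  dwork : P' * dwork p = P'

/-- `γ` is the canonical morphism `P ↦ P'` of sheaves of (non-unital) algebras from operators of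
level `m` to operators of level `m + 1`: it is `P ↦ P'` on the generators, it commutes with
restrictions, and it is linear over functions, which act on the target via Frobenius. -/
structure IsGarnier (p m : ℕ) (γ : ∀ V : Chart, D p m V →ₙₐ[ZMod p] D p (m + 1) V) : Prop where
  gen : ∀ (V : Chart) (P : sheafDiff p V (genOrder p m)),
    ∃ P' : sheafDiff p V (genOrder p (m + 1)), IsGarnierTransform p P P' ∧
      γ V (dlev p m V P) = dlev p (m + 1) V P'
  res : ∀ (V : Chart) (P : D p m V), res p (m + 1) V (γ V P) = γ .overlap (res p m V P)
  linear : ∀ (V : Chart) (a : V.fn p) (P : D p m V),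
    γ V (ofFun p m V a * P) = ofFun p (m + 1) V (a ^ p) * γ V P

/-- The map induced by `γ` on global sections. -/
def globalMap {p m : ℕ} (γ : ∀ V : Chart, D p m V →ₙₐ[ZMod p] D p (m + 1) V)
    (hγ : IsGarnier p m γ) (s : H0 p m) : H0 p (m + 1) :=
  ⟨(γ .zero s.1.1, γ .infty s.1.2), by
    have h : res p m .zero s.1.1 = res p m .infty s.1.2 := s.2
    change res p (m + 1) .zero (γ .zero s.1.1) = res p (m + 1) .infty (γ .infty s.1.2)
    rw [hγ.res, hγ.res, h]⟩

end SL2Frobenius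

end

open SL2Frobenius

namespace SL2Frobenius

/-! ### Level `m` algebras of well-behaved filtrations -/

section Level

variable {k R : Type*} [CommRing k] [Ring R] [Algebra k R]

/-! Each map is prescribed on a generating set and the prescription leaves no freedom there, so
uniqueness is formal. The content is existence: the prescribed images must satisfy the defining
relations of the level algebras.

This is settled for an abstract filtered algebra with commutative graded ring. If elements of order
n, p^m ≤ n < 2p^m, are sums of products of orders p^m and n - p^m (`SplitsAt`), the few product
relations imposed at level m force lev x · lev y = lev (xy) whenever the orders add up to at most
2p^m - 1 (`lev_mul`). A non-unital endomorphism φ such that φ x is a lift of order np times the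
idempotent φ 1 of order p - 1 then passes from level m to level m + 1
(`IsFrobeniusSplitting.exists_level`). The product relation fits the bound exactly. The commutator
relation does not, and needs a description of the elements annihilated by φ 1 on the right.

For differential operators, the p-th power map F on functions has the linear left inverse `contr`,
which kills T^j for j prime to p. The conditions on P' force P' = F ∘ P ∘ `contr`
(`isGarnierTransform_iff`), and 1' = F ∘ `contr` = ℋ. Computations take place on monomials and rest
on Lucas' theorem and on the fact that ∑ (-1)^r C(x, r) over r < p is 1 if p ∣ x and 0 otherwise
(`sum_binomMod`).

For distributions, the E^[a] F^[c] C(H, b) form a basis (`distBasis`), by Kostant's commutation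
formula and an action on induced modules. Integer valued polynomials in H with the same values mod p
agree (`distP_congr`), so Frobenius can be defined on this basis. It is compatible with F because
Δ_T removes the terms of Kostant's formula whose index is prime to p.

Finally, H acts on T^j by -2j, so for odd p the infinitesimal action sends Δ_T to ℋ
(`IsCanonicalAction.map_normT`). Hence the square commutes on generators, and therefore everywhere.
-/

/-- A filtration by submodules, compatible with products, whose associated graded ring is
commutative. -/
structure IsAlmostCommFiltration (Fil : ℕ → Submodule k R) : Prop where
  mono : Monotone Fil
  one_mem : 1 ∈ Fil 0
  mul_mem : ∀ {i j : ℕ} {x y : R}, x ∈ Fil i → y ∈ Fil j → x * y ∈ Fil (i + j)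
  comm_mem : ∀ {i j n : ℕ} {x y : R}, x ∈ Fil i → y ∈ Fil j → i + j ≤ n + 1 →
    x * y - y * x ∈ Fil n

/-- Elements of order `n`, `q ≤ n < 2 q`, are sums of products of elements of orders `q`
and `n - q`. -/
def SplitsAt (Fil : ℕ → Submodule k R) (q : ℕ) : Prop :=
  ∀ n, q ≤ n → n < 2 * q → Fil n ≤ Fil q * Fil (n - q)

variable {Fil : ℕ → Submodule k R} {p m : ℕ}

theorem lev_scalar (c : k) (x : Fil (genOrder p m)) (hx : (x : R) = algebraMap k R c) :
    lev k Fil p m x = algebraMap k _ c := by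
  have := RingQuot.mkAlgHom_rel k (LevelRel.scalar (Fil := Fil) c x hx)
  simpa [lev] using this

theorem lev_comm (x y z : Fil (genOrder p m)) (hx : (x : R) ∈ Fil (p ^ m))
    (hy : (y : R) ∈ Fil (p ^ m)) (hz : (z : R) = (x : R) * y - (y : R) * x) :
    lev k Fil p m x * lev k Fil p m y - lev k Fil p m y * lev k Fil p m x = lev k Fil p m z := by
  have := RingQuot.mkAlgHom_rel k (LevelRel.comm (Fil := Fil) x y z hx hy hz)
  simpa [lev] using this

theorem lev_mul_of_le (x y z : Fil (genOrder p m)) (hx : (x : R) ∈ Fil (p ^ m))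
    (hy : (y : R) ∈ Fil (p ^ m - 1)) (hz : (z : R) = (x : R) * y) :
    lev k Fil p m x * lev k Fil p m y = lev k Fil p m z := by
  have := RingQuot.mkAlgHom_rel k (LevelRel.mul (Fil := Fil) x y z hx hy hz)
  simpa [lev] using this

theorem act_lev (x : Fil (genOrder p m)) : act k Fil p m (lev k Fil p m x) = x := by
  simp [act, lev]

theorem levelMap_lev {Fil' : ℕ → Submodule k R} (h : ∀ n, Fil n ≤ Fil' n)
    (x : Fil (genOrder p m)) : levelMap k p m h (lev k Fil p m x) =
      lev k Fil' p m ⟨x, h _ x.2⟩ := by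
  simp [levelMap, lev, Submodule.inclusion_apply]

/-- Induction principle for the level `m` algebra. -/
theorem Level.induction (h1 : (1 : R) ∈ Fil (genOrder p m)) {P : Level k Fil p m → Prop}
    (lev_mem : ∀ x, P (lev k Fil p m x)) (add : ∀ a b, P a → P b → P (a + b))
    (mul : ∀ a b, P a → P b → P (a * b)) (u : Level k Fil p m) : P u := by
  obtain ⟨t, rfl⟩ := RingQuot.mkAlgHom_surjective k (LevelRel k Fil p m) u
  induction t using TensorAlgebra.induction with
  | algebraMap r =>
    have := lev_mem (r • ⟨1, h1⟩)
    rwa [lev_scalar r _ (by simp [Algebra.algebraMap_eq_smul_one]),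
      ← AlgHom.commutes (RingQuot.mkAlgHom k (LevelRel k Fil p m))] at this
  | ι x => exact lev_mem x
  | mul a b ha hb => rw [map_mul]; exact mul _ _ ha hb
  | add a b ha hb => rw [map_add]; exact add _ _ ha hb

/-- A non-unital morphism out of the level `m` algebra, given on generators. -/
theorem Level.exists_nonUnitalLift {B : Type*} [Ring B] [Algebra k B]
    (f : Fil (genOrder p m) →ₗ[k] B) (e : B) (he : e * e = e) (hle : ∀ x, e * f x = f x)
    (hre : ∀ x, f x * e = f x)
    (hs : ∀ (c : k) (x : Fil (genOrder p m)), (x : R) = algebraMap k R c → f x = c • e)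
    (hc : ∀ x y z : Fil (genOrder p m), (x : R) ∈ Fil (p ^ m) → (y : R) ∈ Fil (p ^ m) →
      (z : R) = (x : R) * y - (y : R) * x → f x * f y - f y * f x = f z)
    (hm : ∀ x y z : Fil (genOrder p m), (x : R) ∈ Fil (p ^ m) → (y : R) ∈ Fil (p ^ m - 1) →
      (z : R) = (x : R) * y → f x * f y = f z) :
    ∃ g : Level k Fil p m →ₙₐ[k] B, ∀ x, g (lev k Fil p m x) = f x := by
  -- A non-unital morphism sending 1 to e is a unital morphism into the corner ring e B e, where the
  -- universal property of the quotient applies.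
  have hid : IsIdempotentElem e := he
  have memc : ∀ {b : B}, e * b = b → b * e = b → b ∈ Subsemigroup.corner e := fun h h' =>
    (Subsemigroup.mem_corner_iff hid).2 ⟨h, h'⟩
  let _ : Algebra k hid.Corner := RingHom.toAlgebra'
    { toFun := fun c => ⟨c • e, memc (by simp [he]) (by simp [he])⟩
      map_one' := Subtype.ext (by simp; rfl)
      map_zero' := Subtype.ext (by simp; rfl)
      map_mul' := fun a b => Subtype.ext (by
        change (a * b) • e = (a • e) * (b • e)
        simp [he, mul_smul, smul_comm a b])
      map_add' := fun a b => Subtype.ext (by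
        change (a + b) • e = (a • e) + (b • e)
        simp [add_smul]) }
    (by
      rintro c ⟨x, hx⟩
      obtain ⟨h1, h2⟩ := (Subsemigroup.mem_corner_iff hid).1 hx
      refine Subtype.ext ?_
      change (c • e) * x = x * (c • e)
      simp [h1, h2])
  have smul_val : ∀ (c : k) (x : hid.Corner), (c • x : hid.Corner).1 = c • x.1 := by
    rintro c ⟨x, hx⟩
    obtain ⟨h1, h2⟩ := (Subsemigroup.mem_corner_iff hid).1 hx
    change (c • e) * x = c • x
    simp [h1]
  let f' : Fil (genOrder p m) →ₗ[k] hid.Corner :=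
    { toFun := fun x => ⟨f x, memc (hle x) (hre x)⟩
      map_add' := fun x y => Subtype.ext (by simp; rfl)
      map_smul' := fun c x => Subtype.ext ((map_smul f c x).trans
        (smul_val c ⟨f x, memc (hle x) (hre x)⟩).symm) }
  let θ : Level k Fil p m →ₐ[k] hid.Corner := RingQuot.liftAlgHom k ⟨TensorAlgebra.lift k f', by
    intro a b hab
    induction hab with
    | scalar c x hx =>
      rw [AlgHom.commutes, TensorAlgebra.lift_ι_apply]
      exact Subtype.ext (hs c x hx)
    | comm x y z hx hy hz =>
      simp only [map_sub, map_mul, TensorAlgebra.lift_ι_apply]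
      exact Subtype.ext (hc x y z hx hy hz)
    | mul x y z hx hy hz =>
      simp only [map_mul, TensorAlgebra.lift_ι_apply]
      exact Subtype.ext (hm x y z hx hy hz)⟩
  refine ⟨{ toFun := fun u => (θ u : hid.Corner).1
            map_smul' := fun c u => ?_
            map_zero' := ?_
            map_add' := fun u v => ?_
            map_mul' := fun u v => ?_ }, fun x => ?_⟩
  · rw [map_smul]; exact smul_val _ _
  · rw [map_zero]; rfl
  · rw [map_add]; rfl
  · rw [map_mul]; rfl
  · change (θ (lev k Fil p m x) : hid.Corner).1 = f x
    have : θ (lev k Fil p m x) = f' x := by simp [θ, lev]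
    rw [this]; rfl

/-- Functoriality of the level `m` algebra for filtered algebra morphisms. -/
theorem Level.exists_map {R' : Type*} [Ring R'] [Algebra k R'] {Fil' : ℕ → Submodule k R'}
    (ρ : R →ₐ[k] R') (hρ : ∀ n, ∀ x ∈ Fil n, ρ x ∈ Fil' n) :
    ∃ g : Level k Fil p m →ₐ[k] Level k Fil' p m,
      ∀ x, g (lev k Fil p m x) = lev k Fil' p m ⟨ρ x, hρ _ x x.2⟩ := by
  let f : Fil (genOrder p m) →ₗ[k] Level k Fil' p m :=
    lev k Fil' p m ∘ₗ (ρ.toLinearMap.restrict (hρ (genOrder p m)))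
  have hf : ∀ x, f x = lev k Fil' p m ⟨ρ x, hρ _ x x.2⟩ := fun x => rfl
  refine ⟨RingQuot.liftAlgHom k ⟨TensorAlgebra.lift k f, ?_⟩, fun x => ?_⟩
  · intro a b hab
    induction hab with
    | scalar c x hx =>
      rw [AlgHom.commutes, TensorAlgebra.lift_ι_apply, hf]
      exact lev_scalar c _ (by simp [hx])
    | comm x y z hx hy hz =>
      simp only [map_sub, map_mul, TensorAlgebra.lift_ι_apply, hf]
      exact lev_comm _ _ _ (hρ _ _ hx) (hρ _ _ hy) (by simp [hz])
    | mul x y z hx hy hz =>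
      simp only [map_mul, TensorAlgebra.lift_ι_apply, hf]
      exact lev_mul_of_le _ _ _ (hρ _ _ hx) (hρ _ _ hy) (by simp [hz])
  · simp [lev, hf]

section

variable (hF : IsAlmostCommFiltration Fil) (hS : SplitsAt Fil (p ^ m)) (hp : 0 < p)
include hF hS hp

/-- The relations only give products of orders p^m and p^m - 1. A longer factor is cut by `SplitsAt`
into a piece of order p^m and a remainder, and associativity moves the pieces across. -/
theorem lev_mul {i j : ℕ} (hij : i + j ≤ genOrder p m) (x y z : Fil (genOrder p m))
    (hx : (x : R) ∈ Fil i) (hy : (y : R) ∈ Fil j) (hz : (z : R) = (x : R) * y) :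
    lev k Fil p m x * lev k Fil p m y = lev k Fil p m z := by
  have hq : 0 < p ^ m := pow_pos hp m
  have hN : genOrder p m = 2 * p ^ m - 1 := rfl
  have split_le : ∀ n, p ^ m ≤ n → Fil (p ^ m) * Fil (n - p ^ m) ≤ Fil n := fun n hn =>
    Submodule.mul_le.2 fun a ha b hb => hF.mono (by omega) (hF.mul_mem ha hb)
  have small : ∀ i j, i ≤ p ^ m → j ≤ p ^ m → i + j ≤ genOrder p m →
      ∀ x y z : Fil (genOrder p m), (x : R) ∈ Fil i → (y : R) ∈ Fil j →
      (z : R) = (x : R) * y → lev k Fil p m x * lev k Fil p m y = lev k Fil p m z := by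
    intro i j hi hj hij x y z hx hy hz
    rcases hj.lt_or_eq with h | h
    · exact lev_mul_of_le _ _ _ (hF.mono hi hx) (hF.mono (by omega) hy) hz
    -- If y has order exactly p^m, then x has smaller order, so yx is covered by a product relation
    -- and the commutator relation turns it around.
    · have hi' : i ≤ p ^ m - 1 := by omega
      have hyx : (y : R) * x ∈ Fil (genOrder p m) :=
        hF.mono (by omega : j + i ≤ genOrder p m) (hF.mul_mem hy hx)
      have hxy : (x : R) * y - y * x ∈ Fil (genOrder p m) := sub_mem (hz ▸ z.2) hyx
      have e1 := lev_mul_of_le y x ⟨_, hyx⟩ (hF.mono hj hy) (hF.mono hi' hx) rfl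
      have e2 := lev_comm x y ⟨_, hxy⟩ (hF.mono hi hx) (hF.mono hj hy) rfl
      rw [sub_eq_iff_eq_add.1 e2, e1, ← map_add]
      congr 1
      exact Subtype.ext (by simp [hz])
  -- For i > p^m, x is a sum of products ab with a of order p^m. Then by has order i + j - p^m <
  -- p^m, so ab, by and a(by) are all covered by `small`.
  have left : ∀ i j, j ≤ p ^ m → i + j ≤ genOrder p m →
      ∀ x y z : Fil (genOrder p m), (x : R) ∈ Fil i → (y : R) ∈ Fil j →
      (z : R) = (x : R) * y → lev k Fil p m x * lev k Fil p m y = lev k Fil p m z := by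
    intro i j hj hij x y z hx hy hz
    rcases le_or_gt i (p ^ m) with h | h
    · exact small i j h hj hij x y z hx hy hz
    have hmem : ∀ w ∈ Fil i, w * y ∈ Fil (genOrder p m) := fun w hw =>
      hF.mono hij (hF.mul_mem hw hy)
    have hle := (split_le i h.le).trans (hF.mono (by omega : i ≤ genOrder p m))
    suffices ∀ w (hw : w ∈ Fil (p ^ m) * Fil (i - p ^ m)), ∀ x z : Fil (genOrder p m),
        (x : R) = w → (z : R) = w * y → lev k Fil p m x * lev k Fil p m y = lev k Fil p m z from
      this x (hS i h.le (by omega) hx) x z rfl hz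
    intro w hw
    induction hw using Submodule.mul_induction_on' with
    | mem_mul_mem a ha b hb =>
      rintro x z hx hz
      have hby := hF.mul_mem hb hy
      rw [← small (p ^ m) (i - p ^ m) le_rfl (by omega) (by omega) ⟨a, hF.mono (by omega) ha⟩
        ⟨b, hF.mono (by omega) hb⟩ x ha hb hx, mul_assoc,
        small (i - p ^ m) j (by omega) hj (by omega) ⟨b, hF.mono (by omega) hb⟩ y
          ⟨_, hF.mono (by omega) hby⟩ hb hy rfl]
      exact small (p ^ m) (i - p ^ m + j) le_rfl (by omega) (by omega) _ _ _ ha hby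
        (by simp [hz, mul_assoc])
    | add a ha b hb iha ihb =>
      rintro x z hx hz
      have ha' := hmem a (split_le i h.le ha)
      have hb' := hmem b (split_le i h.le hb)
      have e1 : x = ⟨a, hle ha⟩ + ⟨b, hle hb⟩ := Subtype.ext hx
      have e2 : z = ⟨a * y, ha'⟩ + ⟨b * y, hb'⟩ := Subtype.ext (by simp [hz, add_mul])
      rw [e1, e2, map_add, map_add, add_mul, iha ⟨a, _⟩ ⟨_, _⟩ rfl rfl, ihb ⟨b, _⟩ ⟨_, _⟩ rfl rfl]
  rcases le_or_gt j (p ^ m) with h | h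
  · exact left i j h hij x y z hx hy hz
  -- Now j > p^m forces i < p^m. Splitting y into products ab with a of order p^m turns x(ab) into
  -- (xa)b, where every right factor is short enough for `left`.
  have hmem : ∀ w ∈ Fil j, x * w ∈ Fil (genOrder p m) := fun w hw =>
    hF.mono hij (hF.mul_mem hx hw)
  have hle := (split_le j h.le).trans (hF.mono (by omega : j ≤ genOrder p m))
  suffices ∀ w (hw : w ∈ Fil (p ^ m) * Fil (j - p ^ m)), ∀ y z : Fil (genOrder p m),
      (y : R) = w → (z : R) = x * w → lev k Fil p m x * lev k Fil p m y = lev k Fil p m z from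
    this y (hS j h.le (by omega) hy) y z rfl hz
  intro w hw
  induction hw using Submodule.mul_induction_on' with
  | mem_mul_mem a ha b hb =>
    rintro y z hy hz
    have hxa := hF.mul_mem hx ha
    rw [← left (p ^ m) (j - p ^ m) (by omega) (by omega) ⟨a, hF.mono (by omega) ha⟩
      ⟨b, hF.mono (by omega) hb⟩ y ha hb hy, ← mul_assoc,
      left i (p ^ m) le_rfl (by omega) x ⟨a, hF.mono (by omega) ha⟩
        ⟨_, hF.mono (by omega) hxa⟩ hx ha rfl]
    exact left (i + p ^ m) (j - p ^ m) (by omega) (by omega) _ _ _ hxa hb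
      (by simp [hz, mul_assoc])
  | add a ha b hb iha ihb =>
    rintro y z hy hz
    have ha' := hmem a (split_le j h.le ha)
    have hb' := hmem b (split_le j h.le hb)
    have e1 : y = ⟨a, hle ha⟩ + ⟨b, hle hb⟩ := Subtype.ext hy
    have e2 : z = ⟨x * a, ha'⟩ + ⟨x * b, hb'⟩ := Subtype.ext (by simp [hz, mul_add])
    rw [e1, e2, map_add, map_add, mul_add, iha ⟨a, _⟩ ⟨_, _⟩ rfl rfl, ihb ⟨b, _⟩ ⟨_, _⟩ rfl rfl]

end

/-! ### Frobenius splittings and the morphisms they induce between levels -/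

/-- A non-unital endomorphism `φ` of `R`, multiplying the order by `p`, whose image of `1` is
central enough and generates a left ideal with a filtered complement. -/
structure IsFrobeniusSplitting (Fil : ℕ → Submodule k R) (p m : ℕ) (φ : R →ₙₐ[k] R) : Prop where
  one_mem : φ 1 ∈ Fil (p - 1)
  exists_lift : ∀ n, ∀ x ∈ Fil n, ∃ y ∈ Fil (n * p), y * φ 1 = φ x ∧ φ 1 * y = φ x
  mem_of_mul_eq_zero : ∀ n ≤ genOrder p m, ∀ w ∈ Fil n, w * φ 1 = 0 →
    w ∈ Submodule.span k {x | ∃ d ≤ n, d ≤ p - 1 ∧ ∃ y ∈ Fil (n - d), ∃ s ∈ Fil d,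
      s * φ 1 = 0 ∧ x = y * s}

/-- The image has order at most np + (p - 1), and n + 1 ≤ 2p^m turns this into 2p^(m+1) - 1. -/
theorem IsFrobeniusSplitting.map_mem {φ : R →ₙₐ[k] R} (hF : IsAlmostCommFiltration Fil)
    (hφ : IsFrobeniusSplitting Fil p (m + 1) φ) (hp : 0 < p) (n : ℕ) (hn : n ≤ genOrder p m)
    (x : R) (hx : x ∈ Fil n) : φ x ∈ Fil (genOrder p (m + 1)) := by
  obtain ⟨y, hy, h, -⟩ := hφ.exists_lift _ x hx
  rw [← h]
  refine hF.mono ?_ (hF.mul_mem hy hφ.one_mem)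
  have h1 : n * p ≤ genOrder p m * p := Nat.mul_le_mul_right _ hn
  have h2 : genOrder p m * p + p = 2 * p ^ (m + 1) := by
    have : genOrder p m + 1 = 2 * p ^ m := by
      have := pow_pos hp m
      rw [genOrder]; omega
    rw [← Nat.succ_mul, Nat.succ_eq_add_one, this]; ring
  rw [genOrder]; omega

/-- A Frobenius splitting induces a morphism from the level `m` to the level `m + 1` algebra. -/
theorem IsFrobeniusSplitting.exists_level {φ : R →ₙₐ[k] R} (hF : IsAlmostCommFiltration Fil)
    (hS : SplitsAt Fil (p ^ (m + 1))) (hφ : IsFrobeniusSplitting Fil p (m + 1) φ) (hp : 0 < p) :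
    ∃ g : Level k Fil p m →ₙₐ[k] Level k Fil p (m + 1), ∀ x, g (lev k Fil p m x) =
      lev k Fil p (m + 1) ⟨φ x, hφ.map_mem hF hp _ le_rfl x x.2⟩ := by
  have hq : 0 < p ^ m := pow_pos hp m
  have hqp : p ^ (m + 1) = p ^ m * p := pow_succ _ _
  have hN : genOrder p m = 2 * p ^ m - 1 := rfl
  have hN' : genOrder p (m + 1) = 2 * (p ^ m * p) - 1 := by rw [← hqp]; rfl
  have hqp' : p ≤ p ^ m * p := Nat.le_mul_of_pos_left _ hq
  have hNp : genOrder p m * p = 2 * (p ^ m * p) - p := by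
    rw [hN, Nat.sub_mul, mul_assoc, one_mul]
  have hmul := fun i j hij => lev_mul hF hS hp (i := i) (j := j) hij
  have he : φ 1 * φ 1 = φ 1 := by rw [← map_mul, mul_one]
  set e : Fil (genOrder p (m + 1)) := ⟨φ 1, hF.mono (by omega) hφ.one_mem⟩ with he_def
  have hee : lev k Fil p (m + 1) e * lev k Fil p (m + 1) e = lev k Fil p (m + 1) e :=
    hmul (p - 1) (p - 1) (by omega) _ _ _ hφ.one_mem hφ.one_mem he.symm
  let f : Fil (genOrder p m) →ₗ[k] Level k Fil p (m + 1) := lev k Fil p (m + 1) ∘ₗ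
    LinearMap.restrict (φ : R →ₗ[k] R)
      (fun x hx => hφ.map_mem hF hp _ le_rfl x hx)
  have hf : ∀ x, f x = lev k Fil p (m + 1) ⟨φ x, hφ.map_mem hF hp _ le_rfl x x.2⟩ :=
    fun x => rfl
  have lift : ∀ n ≤ genOrder p m, ∀ x : Fil (genOrder p m), (x : R) ∈ Fil n →
      ∃ y : Fil (genOrder p (m + 1)), (y : R) ∈ Fil (n * p) ∧ y * φ 1 = φ x ∧
        f x = lev k Fil p (m + 1) y * lev k Fil p (m + 1) e ∧
        f x = lev k Fil p (m + 1) e * lev k Fil p (m + 1) y := by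
    intro n hn x hx
    obtain ⟨y, hy, h1, h2⟩ := hφ.exists_lift n x hx
    have hnp : n * p ≤ genOrder p m * p := Nat.mul_le_mul_right _ hn
    refine ⟨⟨y, hF.mono (by omega) hy⟩, hy, h1, ?_, ?_⟩
    · exact (hmul (n * p) (p - 1) (by omega) _ _ _ hy hφ.one_mem h1.symm).symm
    · exact (hmul (p - 1) (n * p) (by omega) _ _ _ hφ.one_mem hy h2.symm).symm
  -- The orders of w and φ 1 may add up to more than `lev_mul` allows, so w φ 1 = 0 in R is not
  -- enough by itself. Writing w as a sum of terms ys with s φ 1 = 0 and s of order at most p - 1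
  -- leaves only the short product s φ 1 to be computed in R.
  have kill : ∀ w : Fil (genOrder p (m + 1)), (w : R) * φ 1 = 0 →
      lev k Fil p (m + 1) w * lev k Fil p (m + 1) e = 0 := by
    intro w hw
    have hspan := hφ.mem_of_mul_eq_zero _ le_rfl w w.2 hw
    suffices ∀ v ∈ Submodule.span k {x | ∃ d ≤ genOrder p (m + 1),
        d ≤ p - 1 ∧ ∃ y ∈ Fil (genOrder p (m + 1) - d), ∃ s ∈ Fil d, s * φ 1 = 0 ∧ x = y * s},
        ∃ h : v ∈ Fil (genOrder p (m + 1)),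
          lev k Fil p (m + 1) ⟨v, h⟩ * lev k Fil p (m + 1) e = 0 from (this w hspan).2
    intro v hv
    induction hv using Submodule.span_induction with
    | mem v hv =>
      obtain ⟨d, hd, hdp, y, hy, s, hs, hse, rfl⟩ := hv
      have hys := hF.mono (by omega : _ ≤ genOrder p (m + 1)) (hF.mul_mem hy hs)
      refine ⟨hys, ?_⟩
      rw [← hmul _ d (by omega) ⟨y, hF.mono (by omega) hy⟩ ⟨s, hF.mono hd hs⟩ ⟨_, hys⟩ hy hs rfl,
        mul_assoc]
      suffices lev k Fil p (m + 1) ⟨s, hF.mono hd hs⟩ * lev k Fil p (m + 1) e = 0 by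
        rw [this, mul_zero]
      rw [hmul d (p - 1) (by omega) ⟨s, hF.mono hd hs⟩ e 0 hs hφ.one_mem (by simp [e, hse]),
        map_zero]
    | zero => exact ⟨zero_mem _, by rw [show (⟨0, _⟩ : Fil (genOrder p (m + 1))) = 0 from rfl,
        map_zero, zero_mul]⟩
    | add a b _ _ ha hb =>
      obtain ⟨ha, ha'⟩ := ha
      obtain ⟨hb, hb'⟩ := hb
      refine ⟨add_mem ha hb, ?_⟩
      rw [show (⟨a + b, _⟩ : Fil (genOrder p (m + 1))) = ⟨a, ha⟩ + ⟨b, hb⟩ from rfl,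
        map_add, add_mul, ha', hb', add_zero]
    | smul c a _ ha =>
      obtain ⟨ha, ha'⟩ := ha
      refine ⟨Submodule.smul_mem _ c ha, ?_⟩
      rw [show (⟨c • a, _⟩ : Fil (genOrder p (m + 1))) = c • ⟨a, ha⟩ from rfl,
        map_smul, smul_mul_assoc, ha', smul_zero]
  refine Level.exists_nonUnitalLift f (lev k Fil p (m + 1) e) hee ?_ ?_ ?_ ?_ ?_
  · intro x
    obtain ⟨y, -, -, -, h⟩ := lift _ le_rfl x x.2
    rw [h, ← mul_assoc, hee]
  · intro x
    obtain ⟨y, -, -, h, -⟩ := lift _ le_rfl x x.2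
    rw [h, mul_assoc, hee]
  · intro c x hx
    rw [hf, ← map_smul]
    congr 1
    exact Subtype.ext (by simp [hx, Algebra.algebraMap_eq_smul_one, e])
  -- Commutator relation: the lifts x', y' have order p^(m+1), so their commutator is a generator at
  -- level m + 1. It agrees with the lift z' only after multiplication by φ 1, and `kill` carries
  -- this over to the level algebra.
  · intro x y z hx hy hz
    have hq2 : p ^ m ≤ genOrder p m := by omega
    obtain ⟨x', hx', hx1, hx2, hx3⟩ := lift _ hq2 x hx
    obtain ⟨y', hy', hy1, hy2, hy3⟩ := lift _ hq2 y hy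
    obtain ⟨z', hz', hz1, hz2, hz3⟩ := lift _ le_rfl z z.2
    have hxy : (x' : R) * y' - y' * x' ∈ Fil (genOrder p (m + 1)) :=
      hF.comm_mem hx' hy' (by omega)
    have hc := lev_comm x' y' ⟨_, hxy⟩ (hqp ▸ hx') (hqp ▸ hy') rfl
    have e1 : f x * f y = lev k Fil p (m + 1) x' * lev k Fil p (m + 1) y' *
        lev k Fil p (m + 1) e := by
      rw [hx2, hy3, mul_assoc, ← mul_assoc _ _ (lev k Fil p (m + 1) y'), hee, ← hy3, hy2,
        mul_assoc]
    have e2 : f y * f x = lev k Fil p (m + 1) y' * lev k Fil p (m + 1) x' *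
        lev k Fil p (m + 1) e := by
      rw [hy2, hx3, mul_assoc, ← mul_assoc _ _ (lev k Fil p (m + 1) x'), hee, ← hx3, hx2,
        mul_assoc]
    rw [e1, e2, ← sub_mul, hc, hz2, ← sub_eq_zero, ← sub_mul, ← map_sub]
    apply kill
    have hcomm : ∀ u v : R, ∀ u' v' : R, u' * φ 1 = φ u → v' * φ 1 = φ v → φ 1 * φ v = φ v →
        u' * v' * φ 1 = φ (u * v) := by
      intro u v u' v' hu hv hv'
      rw [mul_assoc, hv, ← hv', ← mul_assoc, hu, map_mul]
    have h1 : ∀ u, φ 1 * φ u = φ u := fun u => by rw [← map_mul, one_mul]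
    simp only [AddSubgroupClass.coe_sub, sub_mul, hz1, hcomm _ _ _ _ hx1 hy1 (h1 _),
      hcomm _ _ _ _ hy1 hx1 (h1 _)]
    rw [hz, map_sub, sub_self]
  -- Product relation: the orders p^(m+1), p^(m+1) - p and p - 1 of x', y' and φ 1 add up to exactly
  -- 2p^(m+1) - 1, the limit of `lev_mul`.
  · intro x y z hx hy hz
    obtain ⟨x', hx', hx1, hx2, hx3⟩ := lift (p ^ m) (by omega) x hx
    obtain ⟨y', hy', hy1, hy2, hy3⟩ := lift (p ^ m - 1) (by omega) y hy
    have hle : (p ^ m - 1) * p = p ^ m * p - p := by rw [Nat.sub_mul, one_mul]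
    have hxy := hF.mul_mem hx' hy'
    have e1 : f x * f y = lev k Fil p (m + 1) x' * lev k Fil p (m + 1) y' *
        lev k Fil p (m + 1) e := by
      rw [hx2, hy3, mul_assoc, ← mul_assoc _ _ (lev k Fil p (m + 1) y'), hee, ← hy3, hy2,
        mul_assoc]
    rw [e1, hf, hmul (p ^ m * p) ((p ^ m - 1) * p) (by omega) x' y' ⟨_, hF.mono (by omega) hxy⟩
      hx' hy' rfl]
    refine hmul _ (p - 1) (by omega) _ _ _ hxy hφ.one_mem ?_
    change φ z = x' * y' * φ 1
    rw [mul_assoc, hy1, hz, ← one_mul (y : R), map_mul, map_mul, ← mul_assoc, ← mul_assoc, hx1,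
      ← map_mul, mul_one]

end Level
end SL2Frobenius

namespace SL2Frobenius

/-! ### Binomial coefficients modulo `p` -/

section Binomial

variable {p : ℕ} [Fact p.Prime]

/-- The binomial coefficient of an integer, modulo `p`. -/
def binomMod (p : ℕ) (x : ℤ) (n : ℕ) : ZMod p := ((Ring.choose x n : ℤ) : ZMod p)

theorem binomMod_natCast (x n : ℕ) : binomMod p (x : ℤ) n = (x.choose n : ZMod p) := by
  simp [binomMod, Ring.choose_natCast]

@[simp] theorem binomMod_zero (x : ℤ) : binomMod p x 0 = 1 := by simp [binomMod]

theorem choose_intCast_add (x y : ℤ) (n : ℕ) : Ring.choose (x + y) n =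
    ∑ s ∈ Finset.range (n + 1), Ring.choose x s * Ring.choose y (n - s) := by
  rw [Ring.add_choose_eq n (Commute.all x y), Finset.Nat.sum_antidiagonal_eq_sum_range_succ_mk]

theorem binomMod_add (x y : ℤ) (n : ℕ) : binomMod p (x + y) n =
    ∑ s ∈ Finset.range (n + 1), binomMod p x s * binomMod p y (n - s) := by
  simp [binomMod, choose_intCast_add]

theorem binomMod_mul_binomMod (x : ℤ) (a b : ℕ) :
    binomMod p (x - b) a * binomMod p x b = ((a + b).choose a : ZMod p) * binomMod p x (a + b) := by
  have h := Ring.choose_smul_choose x (Nat.le_add_left b a)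
  rw [Nat.add_sub_cancel, nsmul_eq_mul] at h
  have h2 := congrArg (Int.cast : ℤ → ZMod p) h
  push_cast at h2
  rw [binomMod, binomMod, binomMod, mul_comm, Nat.choose_symm_add, ← h2]

/-- In Vandermonde's identity the coefficients C(p^N, s) with 0 < s < p^N vanish mod p, so a shift
by p^N is invisible in degrees below p^N. -/
theorem binomMod_add_pow (x : ℤ) {N n : ℕ} (hn : n < p ^ N) (y : ℤ) :
    binomMod p (x + y * p ^ N) n = binomMod p x n := by
  have step : ∀ x : ℤ, binomMod p (x + p ^ N) n = binomMod p x n := by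
    intro x
    rw [add_comm, binomMod_add, Finset.sum_range_succ', Finset.sum_eq_zero]
    · simp
    · intro s hs
      rw [Finset.mem_range] at hs
      have h : (p : ℕ) ∣ (p ^ N).choose (s + 1) :=
        Nat.Prime.dvd_choose_pow Fact.out (by omega) (by omega)
      have h2 := binomMod_natCast (p := p) (p ^ N) (s + 1)
      rw [(ZMod.natCast_eq_zero_iff _ _).2 h] at h2
      push_cast at h2
      rw [h2, zero_mul]
  induction y using Int.induction_on with
  | zero => simp
  | succ i ih => rw [add_mul, one_mul, ← add_assoc, step, ih]
  | pred i ih => rw [← ih, ← step, sub_mul, one_mul, ← add_sub_assoc, sub_add_cancel]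

/-- Modulo `p` the binomial coefficients of small order of an integer are those of a natural
number with the same residue modulo a large power of `p`. -/
theorem exists_natCast_binomMod (x : ℤ) (n : ℕ) : ∃ y : ℕ, ((y : ZMod p) = x) ∧
    (∀ i ≤ n, binomMod p x i = (y.choose i : ZMod p)) ∧
    ∀ i ≤ n * p, binomMod p (x * p) i = ((y * p).choose i : ZMod p) := by
  have hp : 1 < p := Nat.Prime.one_lt Fact.out
  -- The residue y of x modulo p^(n+1) serves both families: p^(n+1) exceeds n, and p^(n+2), the
  -- modulus for xp, exceeds np.
  have hn : n < p ^ (n + 1) := (Nat.lt_pow_self hp).trans (Nat.pow_lt_pow_right hp (by omega))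
  have h0 : (0 : ℤ) < (p : ℤ) ^ (n + 1) := by positivity
  obtain ⟨y, hy⟩ := Int.eq_ofNat_of_zero_le (Int.emod_nonneg x h0.ne')
  have hx : x = y + x / (p : ℤ) ^ (n + 1) * (p : ℤ) ^ (n + 1) := by
    rw [← hy, mul_comm]; exact (Int.emod_add_mul_ediv _ _).symm
  set z := x / (p : ℤ) ^ (n + 1)
  refine ⟨y, ?_, fun i hi => ?_, fun i hi => ?_⟩
  · rw [hx]; simp
  · rw [hx, binomMod_add_pow _ (by omega), binomMod_natCast]
  · have : i < p ^ (n + 2) := by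
      rw [pow_succ]
      exact hi.trans_lt (Nat.mul_lt_mul_of_pos_right hn (by omega))
    rw [hx, show ((y : ℤ) + z * (p : ℤ) ^ (n + 1)) * p = ((y * p : ℕ) : ℤ) + z * p ^ (n + 2) by
      push_cast; ring, binomMod_add_pow _ this, binomMod_natCast]

theorem lucas (a b : ℕ) : (a.choose b : ZMod p) =
    ((a % p).choose (b % p) : ZMod p) * ((a / p).choose (b / p) : ZMod p) := by
  have := (Choose.choose_modEq_choose_mod_mul_choose_div_nat (n := a) (k := b) (p := p))
  rw [← ZMod.natCast_eq_natCast_iff] at this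
  push_cast at this
  exact this

theorem lucas_digits (a b : ℕ) {r s : ℕ} (hr : r < p) (hs : s < p) :
    ((a * p + r).choose (b * p + s) : ZMod p) = (r.choose s : ZMod p) * (a.choose b : ZMod p) := by
  have hp : 0 < p := by omega
  rw [lucas, Nat.mul_add_mod', Nat.mul_add_mod', Nat.mod_eq_of_lt hr, Nat.mod_eq_of_lt hs,
    mul_comm a p, mul_comm b p, Nat.mul_add_div hp, Nat.mul_add_div hp,
    Nat.div_eq_of_lt hr, Nat.div_eq_of_lt hs, add_zero, add_zero]

theorem binomMod_mul_prime (x : ℤ) (n : ℕ) :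
    binomMod p (x * p) (n * p) = binomMod p x n := by
  have hp : 0 < p := Nat.Prime.pos Fact.out
  obtain ⟨y, -, h1, h2⟩ := exists_natCast_binomMod (p := p) x n
  rw [h1 n le_rfl, h2 _ le_rfl]
  simpa using lucas_digits (p := p) y n hp hp

theorem binomMod_mul_prime_eq_zero (x : ℤ) {n : ℕ} (hn : ¬ p ∣ n) :
    binomMod p (x * p) n = 0 := by
  have hp : 0 < p := Nat.Prime.pos Fact.out
  obtain ⟨y, -, -, h2⟩ := exists_natCast_binomMod (p := p) x n
  rw [h2 n (Nat.le_mul_of_pos_right _ hp), lucas, Nat.mul_mod_left,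
    Nat.choose_eq_zero_of_lt (Nat.pos_of_ne_zero fun h => hn (Nat.dvd_of_mod_eq_zero h))]
  simp

/-- In Lucas' formula r only sees the last digit of x and np only the higher digits. -/
theorem binomMod_mul_add (x : ℤ) (n : ℕ) {r : ℕ} (hr : r < p) :
    binomMod p x (n * p + r) = binomMod p x (n * p) * binomMod p x r := by
  have hp : 0 < p := by omega
  obtain ⟨y, -, h, -⟩ := exists_natCast_binomMod (p := p) x (n * p + r)
  rw [h _ le_rfl, h _ (by omega), h r (by omega)]
  have e := Nat.div_add_mod' y p
  have hy := Nat.mod_lt y hp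
  rw [← e, lucas_digits _ _ hy hr]
  have h1 := lucas_digits (p := p) (y / p) n hy hp
  have h2 := lucas_digits (p := p) (y / p) 0 hy hr
  simp only [add_zero, zero_mul, zero_add, Nat.choose_zero_right, Nat.cast_one, one_mul,
    mul_one] at h1 h2
  rw [h1, h2, mul_comm]

/-- Lucas replaces x by its last digit d, and the sum becomes (1 - 1)^d. This is what makes both Δ_T
and ℋ projectors. -/
theorem sum_binomMod (x : ℤ) : ∑ r ∈ Finset.range p, (-1) ^ r * binomMod p x r =
    if (p : ℤ) ∣ x then 1 else 0 := by
  have hp : 0 < p := Nat.Prime.pos Fact.out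
  obtain ⟨y, hy, h, -⟩ := exists_natCast_binomMod (p := p) x p
  have hdvd : (p : ℤ) ∣ x ↔ y % p = 0 := by
    rw [← ZMod.intCast_zmod_eq_zero_iff_dvd, ← hy, ZMod.natCast_eq_zero_iff,
      Nat.dvd_iff_mod_eq_zero]
  have hlt := Nat.mod_lt y hp
  have h1 : ∀ r ∈ Finset.range p, (-1) ^ r * binomMod p x r =
      (((-1) ^ r * ((y % p).choose r : ℤ) : ℤ) : ZMod p) := by
    intro r hr
    rw [Finset.mem_range] at hr
    rw [h r hr.le, lucas, Nat.mod_eq_of_lt hr, Nat.div_eq_of_lt hr]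
    simp
  rw [Finset.sum_congr rfl h1, ← Int.cast_sum,
    ← Finset.sum_subset (Finset.range_subset_range.2 (Nat.succ_le_of_lt hlt)),
    Int.alternating_sum_range_choose]
  · simp [hdvd]
  · intro r _ hr
    rw [Finset.mem_range, not_lt] at hr
    rw [Nat.choose_eq_zero_of_lt (by omega)]; simp

theorem choose_ne_zero_of_lt {a b : ℕ} (ha : a < p) (hb : b ≤ a) : (a.choose b : ZMod p) ≠ 0 := by
  rw [Ne, ZMod.natCast_eq_zero_iff]
  intro h
  have h2 := Nat.choose_mul_factorial_mul_factorial hb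
  have h3 : p ∣ a.factorial := by rw [← h2, mul_assoc]; exact h.mul_right _
  exact absurd ((Nat.Prime.dvd_factorial Fact.out).1 h3) (by omega)

/-- Three natural numbers of large enough sum contain parts of sum a given multiple of `p ^ m`,
with binomial coefficients prime to `p`. -/
theorem exists_parts (m : ℕ) : ∀ a b c t : ℕ, a < p ^ (m + 1) → b < p ^ (m + 1) →
    c < p ^ (m + 1) → t ≤ a + b + c → p ^ m ∣ t → ∃ a' ≤ a, ∃ b' ≤ b, ∃ c' ≤ c,
      a' + b' + c' = t ∧ (a.choose a' : ZMod p) ≠ 0 ∧ (b.choose b' : ZMod p) ≠ 0 ∧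
        (c.choose c' : ZMod p) ≠ 0 := by
  have hp : 0 < p := Nat.Prime.pos Fact.out
  -- For single digits no binomial C(a, a') with a' ≤ a is divisible by p, so a greedy choice works.
  have low : ∀ a b c t : ℕ, a < p → b < p → c < p → t ≤ a + b + c → ∃ a' ≤ a, ∃ b' ≤ b, ∃ c' ≤ c,
      a' + b' + c' = t ∧ (a.choose a' : ZMod p) ≠ 0 ∧ (b.choose b' : ZMod p) ≠ 0 ∧
        (c.choose c' : ZMod p) ≠ 0 := by
    intro a b c t ha hb hc ht
    exact ⟨min a t, by omega, min b (t - min a t), by omega, t - min a t - min b (t - min a t),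
      by omega, by omega, choose_ne_zero_of_lt ha (by omega), choose_ne_zero_of_lt hb (by omega),
      choose_ne_zero_of_lt hc (by omega)⟩
  induction m with
  | zero => simpa using fun a b c t ha hb hc ht => low a b c t ha hb hc ht
  | succ m ih =>
    intro a b c t ha hb hc ht hd
    rw [pow_succ] at ha hb hc
    obtain ⟨t, rfl⟩ : p ∣ t := (dvd_pow_self p (by omega)).trans hd
    have hd' : p ^ m ∣ t := by rw [pow_succ'] at hd; exact Nat.dvd_of_mul_dvd_mul_left hp hd
    rw [mul_comm p t] at *
    have ea := Nat.div_add_mod' a p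
    have eb := Nat.div_add_mod' b p
    have ec := Nat.div_add_mod' c p
    have la := Nat.mod_lt a hp
    have lb := Nat.mod_lt b hp
    have lc := Nat.mod_lt c hp
    replace ha := Nat.div_lt_of_lt_mul (mul_comm _ p ▸ ha)
    replace hb := Nat.div_lt_of_lt_mul (mul_comm _ p ▸ hb)
    replace hc := Nat.div_lt_of_lt_mul (mul_comm _ p ▸ hc)
    generalize a / p = A at *
    generalize b / p = B at *
    generalize c / p = C at *
    generalize a % p = a₀ at *
    generalize b % p = b₀ at *
    generalize c % p = c₀ at *
    subst ea eb ec
    -- If the higher digits suffice, they are treated by induction and the last digits of the parts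
    -- are 0. Otherwise all higher digits are taken and the last digits make up the rest. Lucas
    -- factors the binomials accordingly.
    rcases le_or_gt t (A + B + C) with h | h
    · obtain ⟨a', ha', b', hb', c', hc', hs, h1, h2, h3⟩ := ih A B C t ha hb hc h hd'
      have key : ∀ A a₀ a' : ℕ, a₀ < p → a' ≤ A → (A.choose a' : ZMod p) ≠ 0 →
          a' * p ≤ A * p + a₀ ∧ ((A * p + a₀).choose (a' * p) : ZMod p) ≠ 0 := by
        intro A a₀ a' h0 h1 h2
        have := lucas_digits (p := p) A a' h0 hp
        have h3 := Nat.mul_le_mul_right p h1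
        exact ⟨by omega, by simp_all⟩
      exact ⟨a' * p, (key _ _ _ la ha' h1).1, b' * p, (key _ _ _ lb hb' h2).1, c' * p,
        (key _ _ _ lc hc' h3).1, by rw [← hs]; ring, (key _ _ _ la ha' h1).2,
        (key _ _ _ lb hb' h2).2, (key _ _ _ lc hc' h3).2⟩
    · have h' := Nat.mul_le_mul_right p h.le
      rw [add_mul, add_mul] at h'
      obtain ⟨a', ha', b', hb', c', hc', hs, h1, h2, h3⟩ := low a₀ b₀ c₀
        (t * p - (A * p + B * p + C * p)) la lb lc (by omega)
      have key : ∀ A a₀ a' : ℕ, a₀ < p → a' ≤ a₀ → (a₀.choose a' : ZMod p) ≠ 0 →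
          ((A * p + a₀).choose (A * p + a') : ZMod p) ≠ 0 := by
        intro A a₀ a' h0 h1 h2
        rw [lucas_digits A A h0 (by omega)]
        simpa using h2
      exact ⟨A * p + a', by omega, B * p + b', by omega, C * p + c', by omega, by omega,
        key _ _ _ la ha' h1, key _ _ _ lb hb' h2, key _ _ _ lc hc' h3⟩

/-- As 2p^m ≤ p^(m+1), all three numbers are in the range of `exists_parts`. The parts supply the
factor of order p^m demanded by `SplitsAt`. -/
theorem exists_parts_of_lt {m a b c : ℕ} (h : p ^ m ≤ a + b + c) (h' : a + b + c < 2 * p ^ m) :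
    ∃ a' ≤ a, ∃ b' ≤ b, ∃ c' ≤ c,
      a' + b' + c' = p ^ m ∧ (a.choose a' : ZMod p) ≠ 0 ∧ (b.choose b' : ZMod p) ≠ 0 ∧
        (c.choose c' : ZMod p) ≠ 0 := by
  have : 2 * p ^ m ≤ p ^ (m + 1) := by
    rw [pow_succ']; exact Nat.mul_le_mul_right _ (Nat.Prime.two_le Fact.out)
  exact exists_parts m a b c _ (by omega) (by omega) (by omega) h dvd_rfl

end Binomial

end SL2Frobenius

namespace SL2Frobenius

open LaurentPolynomial (T)

/-! ### Operators on Laurent polynomials -/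

section Operators

variable {p : ℕ} [Fact p.Prime]

omit [Fact p.Prime] in
theorem onMonomials_T (g : ℤ → L p) (j : ℤ) : onMonomials g (T j) = g j := by
  change Finsupp.linearCombination (ZMod p) g (Finsupp.single j 1) = g j
  simp

theorem linearMap_ext_T {M : Type*} [AddCommGroup M] [Module (ZMod p) M]
    {P Q : L p →ₗ[ZMod p] M} (h : ∀ j, P (T j) = Q (T j)) : P = Q := by
  refine LinearMap.ext fun f => ?_
  induction f using LaurentPolynomial.induction_on' with
  | add f g hf hg => rw [map_add, map_add, hf, hg]
  | C_mul_T n a => rw [← LaurentPolynomial.smul_eq_C_mul, map_smul, map_smul, h]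

theorem hasse_T (ε : ℤˣ) (n : ℕ) (j : ℤ) :
    hasse p ε n (T j) = binomMod p (ε * j) n • T (j - ε * n) :=
  onMonomials_T _ _

theorem binomEuler_T (n : ℕ) (j : ℤ) :
    binomEuler p n (T j) = binomMod p (-2 * j) n • T j :=
  onMonomials_T _ _

theorem units_mul_self (ε : ℤˣ) (j : ℤ) : (ε : ℤ) * (ε * j) = j := by
  rw [← mul_assoc, ← Units.val_mul, Int.units_mul_self]; simp

theorem hasse_T_units (ε : ℤˣ) (n : ℕ) (j : ℤ) :
    hasse p ε n (T (ε * j)) = binomMod p j n • T (ε * (j - n)) := by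
  rw [hasse_T, units_mul_self, mul_sub]

@[simp] theorem hasse_zero (ε : ℤˣ) : hasse p ε 0 = 1 := by
  apply linearMap_ext_T
  intro j
  simp [hasse_T]

/-- Composition of divided powers of a derivation. -/
theorem hasse_mul (ε : ℤˣ) (a b : ℕ) :
    hasse p ε a * hasse p ε b = ((a + b).choose a : ZMod p) • hasse p ε (a + b) := by
  apply linearMap_ext_T
  intro j
  rw [Module.End.mul_apply, hasse_T, map_smul, hasse_T, LinearMap.smul_apply, hasse_T, smul_smul,
    smul_smul, mul_sub, units_mul_self, mul_comm, binomMod_mul_binomMod]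
  congr 2
  push_cast; ring

theorem adFun_apply (a : L p) (P : Module.End (ZMod p) (L p)) :
    adFun (ZMod p) a P =
      P * LinearMap.mulLeft (ZMod p) a - LinearMap.mulLeft (ZMod p) a * P := rfl

/-- Leibniz' rule, which on monomials is Vandermonde's identity; the commutator removes the term
where no derivative falls on T^i. -/
theorem adFun_T_hasse (ε : ℤˣ) (i : ℤ) (n : ℕ) :
    adFun (ZMod p) (T i) (hasse p ε n) = ∑ s ∈ Finset.range n, binomMod p (ε * i) (s + 1) •
      (LinearMap.mulLeft (ZMod p) (T (i - ε * (s + 1))) * hasse p ε (n - (s + 1))) := by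
  apply linearMap_ext_T
  intro j
  rw [adFun_apply, LinearMap.sub_apply, Module.End.mul_apply, Module.End.mul_apply,
    LinearMap.mulLeft_apply, LinearMap.mulLeft_apply, ← LaurentPolynomial.T_add, hasse_T, mul_add,
    binomMod_add, Finset.sum_range_succ', hasse_T, mul_smul_comm, ← LaurentPolynomial.T_add,
    add_smul, binomMod_zero, one_mul, Nat.sub_zero, add_sub_assoc i j, add_sub_cancel_right,
    Finset.sum_smul, LinearMap.sum_apply]
  refine Finset.sum_congr rfl fun s hs => ?_
  rw [Finset.mem_range] at hs
  rw [LinearMap.smul_apply, Module.End.mul_apply, hasse_T, LinearMap.mulLeft_apply, mul_smul_comm,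
    smul_smul, ← LaurentPolynomial.T_add]
  congr 2
  rw [Nat.cast_sub (by omega)]
  push_cast; ring

end Operators

/-! ### Differential operators -/

section DiffOp

variable {k A : Type*} [CommRing k] [CommRing A] [Algebra k A]

theorem adFun_mul (a : A) (P Q : Module.End k A) :
    adFun k a (P * Q) = P * adFun k a Q + adFun k a P * Q := by
  simp only [adFun, LinearMap.sub_apply, LinearMap.mulRight_apply, LinearMap.mulLeft_apply,
    mul_sub, sub_mul, mul_assoc]
  abel

theorem mem_diffOp_zero {P : Module.End k A} :
    P ∈ diffOp k A 0 ↔ ∀ a, adFun k a P = 0 := by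
  simp [diffOp]

theorem mem_diffOp_succ {P : Module.End k A} {n : ℕ} :
    P ∈ diffOp k A (n + 1) ↔ ∀ a, adFun k a P ∈ diffOp k A n := by
  simp [diffOp]

theorem diffOp_mono : Monotone (diffOp k A) := by
  refine monotone_nat_of_le_succ fun n => ?_
  induction n with
  | zero =>
    intro P hP
    rw [mem_diffOp_zero] at hP
    exact mem_diffOp_succ.2 fun a => by rw [hP a]; exact zero_mem _
  | succ n ih =>
    intro P hP
    exact mem_diffOp_succ.2 fun a => ih (mem_diffOp_succ.1 hP a)

theorem diffOp_mul_mem {i j : ℕ} {P Q : Module.End k A} (hP : P ∈ diffOp k A i)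
    (hQ : Q ∈ diffOp k A j) : P * Q ∈ diffOp k A (i + j) := by
  generalize hn : i + j = n
  induction n generalizing i j P Q with
  | zero =>
    obtain ⟨rfl, rfl⟩ : i = 0 ∧ j = 0 := by omega
    rw [mem_diffOp_zero] at *
    intro a
    rw [adFun_mul, hP, hQ, mul_zero, zero_mul, add_zero]
  | succ n ih =>
    refine mem_diffOp_succ.2 fun a => ?_
    rw [adFun_mul]
    refine add_mem ?_ ?_
    · cases j with
      | zero => rw [mem_diffOp_zero.1 hQ, mul_zero]; exact zero_mem _
      | succ j => exact ih hP (mem_diffOp_succ.1 hQ a) (by omega)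
    · cases i with
      | zero => rw [mem_diffOp_zero.1 hP, zero_mul]; exact zero_mem _
      | succ i => exact ih (mem_diffOp_succ.1 hP a) hQ (by omega)

theorem mem_diffOp_zero_iff_mulLeft {P : Module.End k A} :
    P ∈ diffOp k A 0 ↔ P = LinearMap.mulLeft k (P 1) := by
  refine ⟨fun h => ?_, fun h => h ▸ mulLeft_mem_diffOp k _ 0⟩
  rw [mem_diffOp_zero] at h
  ext a
  have := LinearMap.congr_fun (h a) 1
  simp only [adFun, LinearMap.sub_apply, LinearMap.mulRight_apply, LinearMap.mulLeft_apply,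
    Module.End.mul_apply, mul_one, LinearMap.zero_apply] at this
  rw [sub_eq_zero.1 this, LinearMap.mulLeft_apply, mul_comm]

/-- The commutator with a function is a derivation, so induction lowers the order of one operator at
a time until it is a function. Writing the bound as i + j ≤ n + 1 avoids truncated subtraction and
includes i = j = 0. -/
theorem diffOp_comm_mem {i j n : ℕ} {P Q : Module.End k A} (hP : P ∈ diffOp k A i)
    (hQ : Q ∈ diffOp k A j) (hij : i + j ≤ n + 1) : P * Q - Q * P ∈ diffOp k A n := by
  have zero_left : ∀ {j} (P Q : Module.End k A), P ∈ diffOp k A 0 → Q ∈ diffOp k A (j + 1) →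
      P * Q - Q * P ∈ diffOp k A j := by
    intro j P Q hP hQ
    have := mem_diffOp_succ.1 hQ (P 1)
    rw [mem_diffOp_zero_iff_mulLeft.1 hP, ← neg_sub]
    exact neg_mem this
  have zero_zero : ∀ P Q : Module.End k A, P ∈ diffOp k A 0 → Q ∈ diffOp k A 0 →
      P * Q - Q * P = 0 := by
    intro P Q hP hQ
    rw [mem_diffOp_zero_iff_mulLeft.1 hP, mem_diffOp_zero_iff_mulLeft.1 hQ]
    ext a
    simp [mul_left_comm]
  induction n generalizing i j P Q with
  | zero =>
    rcases i with _ | i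
    · rcases j with _ | j
      · rw [zero_zero P Q hP hQ]; exact zero_mem _
      · exact diffOp_mono (by omega) (zero_left P Q hP hQ)
    · obtain ⟨rfl, rfl⟩ : i = 0 ∧ j = 0 := by omega
      rw [← neg_sub]
      exact neg_mem (zero_left Q P hQ hP)
  | succ n ih =>
    refine mem_diffOp_succ.2 fun a => ?_
    have e : adFun k a (P * Q - Q * P) =
        (P * adFun k a Q - adFun k a Q * P) + (adFun k a P * Q - Q * adFun k a P) := by
      rw [map_sub, adFun_mul, adFun_mul]; abel
    rw [e]
    refine add_mem ?_ ?_
    · cases j with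
      | zero => rw [mem_diffOp_zero.1 hQ, mul_zero, zero_mul, sub_self]; exact zero_mem _
      | succ j => exact ih hP (mem_diffOp_succ.1 hQ a) (by omega)
    · cases i with
      | zero => rw [mem_diffOp_zero.1 hP, mul_zero, zero_mul, sub_self]; exact zero_mem _
      | succ i => exact ih (mem_diffOp_succ.1 hP a) hQ (by omega)

end DiffOp

/-! ### Differential operators over the charts of the projective line -/

section Sheaf

variable {p : ℕ} [Fact p.Prime]

theorem isAlmostCommFiltration_sheafDiff (V : Chart) :
    IsAlmostCommFiltration (sheafDiff p V) where
  mono _ _ h _ hP := ⟨diffOp_mono h hP.1, hP.2⟩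
  one_mem := ⟨mem_diffOp_zero_iff_mulLeft.2 (by simp; rfl), fun _ hf => hf⟩
  mul_mem hP hQ := ⟨diffOp_mul_mem hP.1 hQ.1, fun f hf => hP.2 _ (hQ.2 f hf)⟩
  comm_mem hP hQ h := ⟨diffOp_comm_mem hP.1 hQ.1 h, fun f hf =>
    sub_mem (hP.2 _ (hQ.2 f hf)) (hQ.2 _ (hP.2 f hf))⟩

theorem mulLeft_mem_sheafDiff {V : Chart} {a : L p} (ha : a ∈ V.fn p) (n : ℕ) :
    LinearMap.mulLeft (ZMod p) a ∈ sheafDiff p V n :=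
  ⟨mulLeft_mem_diffOp _ _ _, fun _ hf => mul_mem ha hf⟩

theorem hasse_mem_diffOp (ε : ℤˣ) (n : ℕ) :
    hasse p ε n ∈ diffOp (ZMod p) (L p) n := by
  induction n using Nat.strong_induction_on with
  | _ n ih =>
    cases n with
    | zero => rw [hasse_zero]; exact mem_diffOp_zero_iff_mulLeft.2 (by simp; rfl)
    | succ n =>
      refine mem_diffOp_succ.2 fun a => ?_
      -- The commutator is linear in the function a, so monomials suffice.
      let ad : L p →ₗ[ZMod p] Module.End (ZMod p) (L p) :=
        { toFun := fun a => adFun (ZMod p) a (hasse p ε (n + 1))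
          map_add' := fun a b => by
            refine LinearMap.ext fun f => ?_; simp [adFun_apply, add_mul]; abel
          map_smul' := fun c a => by
            refine LinearMap.ext fun f => ?_; simp [adFun_apply, smul_sub] }
      suffices ∀ a, ad a ∈ diffOp (ZMod p) (L p) n from this a
      intro a
      induction a using LaurentPolynomial.induction_on' with
      | add f g hf hg => rw [map_add]; exact add_mem hf hg
      | C_mul_T i c =>
        rw [← LaurentPolynomial.smul_eq_C_mul, map_smul]
        refine Submodule.smul_mem _ _ ?_
        change adFun _ _ _ ∈ _
        rw [adFun_T_hasse]
        refine Submodule.sum_mem _ fun s hs => Submodule.smul_mem _ _ ?_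
        rw [Finset.mem_range] at hs
        exact diffOp_mono (by omega) (diffOp_mul_mem (mulLeft_mem_diffOp _ _ 0)
          (ih (n + 1 - (s + 1)) (by omega)))

theorem adjoin_T_induction {ε : ℤˣ} {W : Submodule (ZMod p) (L p)}
    {P : Module.End (ZMod p) (L p)} (h : ∀ n : ℕ, P (T (ε * n)) ∈ W) :
    ∀ f ∈ Algebra.adjoin (ZMod p) {(T (ε : ℤ) : L p)}, P f ∈ W := by
  intro f hf
  rw [← Subalgebra.mem_toSubmodule, Algebra.adjoin_eq_span] at hf
  induction hf using Submodule.span_induction with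
  | mem x hx =>
    obtain ⟨n, rfl⟩ := Submonoid.mem_closure_singleton.1 hx
    rw [LaurentPolynomial.T_pow, mul_comm]
    exact h n
  | zero => simp
  | add x y _ _ hx hy => rw [map_add]; exact add_mem hx hy
  | smul c x _ hx => rw [map_smul]; exact W.smul_mem c hx

theorem T_mem_adjoin (ε : ℤˣ) {i : ℤ} (n : ℕ) (hi : i = ε * n) :
    (T i : L p) ∈ Algebra.adjoin (ZMod p) {(T (ε : ℤ) : L p)} := by
  rw [hi, mul_comm, ← LaurentPolynomial.T_pow]
  exact pow_mem (Algebra.self_mem_adjoin_singleton _ _) n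

theorem Chart.fn_cases (V : Chart) :
    V.fn p = ⊤ ∨ ∃ ε : ℤˣ, V.fn p = Algebra.adjoin (ZMod p) {(T (ε : ℤ) : L p)} := by
  cases V with
  | zero => exact .inr ⟨1, rfl⟩
  | infty => exact .inr ⟨-1, rfl⟩
  | overlap => exact .inl rfl

theorem hasse_mem_fn (V : Chart) (ε : ℤˣ) (n : ℕ) {f : L p} (hf : f ∈ V.fn p) :
    hasse p ε n f ∈ V.fn p := by
  rcases V.fn_cases (p := p) with h | ⟨ε', h⟩
  · rw [h]; exact Algebra.mem_top
  rw [h] at hf ⊢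
  refine (Subalgebra.mem_toSubmodule _).1 (adjoin_T_induction (fun i => ?_) f hf)
  rw [Subalgebra.mem_toSubmodule, hasse_T]
  -- For the coordinate of the chart, the binomial vanishes before the exponent turns negative; for
  -- the inverse coordinate, the operator raises the exponent.
  obtain rfl | rfl : ε = ε' ∨ ε = -ε' := by
    rcases Int.units_eq_one_or ε with rfl | rfl <;>
    rcases Int.units_eq_one_or ε' with rfl | rfl <;> simp
  · rw [units_mul_self]
    rcases lt_or_ge i n with hi | hi
    · rw [binomMod_natCast, Nat.choose_eq_zero_of_lt hi]; simp
    · exact Subalgebra.smul_mem _ (T_mem_adjoin ε (i - n) (by rw [Nat.cast_sub hi]; ring)) _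
  · exact Subalgebra.smul_mem _ (T_mem_adjoin ε' (i + n) (by push_cast; ring)) _

theorem hasse_mem_sheafDiff (V : Chart) (ε : ℤˣ) (n : ℕ) :
    hasse p ε n ∈ sheafDiff p V n :=
  ⟨hasse_mem_diffOp ε n, fun _ hf => hasse_mem_fn V ε n hf⟩

end Sheaf

end SL2Frobenius

namespace SL2Frobenius

open LaurentPolynomial (T)

noncomputable section

/-! ### Expansion of operators in a local coordinate -/

section Sheaf

variable {p : ℕ} [Fact p.Prime]

/-- The chart `V` has the coordinate `T ^ ε`. -/
def Chart.HasCoord (V : Chart) (ε : ℤˣ) : Prop := (V = .zero → ε = 1) ∧ (V = .infty → ε = -1)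

theorem Chart.exists_hasCoord (V : Chart) : ∃ ε, V.HasCoord ε := by
  cases V with
  | zero => exact ⟨1, by simp [HasCoord]⟩
  | infty => exact ⟨-1, by simp [HasCoord]⟩
  | overlap => exact ⟨1, by simp [HasCoord]⟩

theorem Chart.HasCoord.T_mem {V : Chart} {ε : ℤˣ} (h : V.HasCoord ε) (n : ℕ) :
    (T (ε * n) : L p) ∈ V.fn p := by
  cases V with
  | zero => rw [h.1 rfl]; exact T_mem_adjoin 1 n rfl
  | infty => rw [h.2 rfl]; exact T_mem_adjoin (-1) n rfl
  | overlap => exact Algebra.mem_top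

/-- By induction the commutator of P with the coordinate t vanishes, so P commutes with t and t⁻¹;
as it kills 1, it kills every monomial. -/
theorem diffOp_eq_zero (ε : ℤˣ) {n : ℕ} {P : Module.End (ZMod p) (L p)}
    (hP : P ∈ diffOp (ZMod p) (L p) n) (h : ∀ j ≤ n, P (T (ε * j)) = 0) : P = 0 := by
  induction n generalizing P with
  | zero =>
    rw [mem_diffOp_zero_iff_mulLeft.1 hP]
    have := h 0 le_rfl
    simp only [Nat.cast_zero, mul_zero, LaurentPolynomial.T_zero] at this
    rw [this, LinearMap.mulLeft_zero_eq_zero]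
  | succ n ih =>
    have h1 : adFun (ZMod p) (T ε) P = 0 := by
      refine ih (mem_diffOp_succ.1 hP _) fun j hj => ?_
      rw [adFun_apply, LinearMap.sub_apply, Module.End.mul_apply, Module.End.mul_apply,
        LinearMap.mulLeft_apply, LinearMap.mulLeft_apply, ← LaurentPolynomial.T_add,
        h j (by omega), mul_zero, sub_zero]
      have := h (j + 1) (by omega)
      rw [← this]
      congr 2
      push_cast; ring
    rw [adFun_apply, sub_eq_zero] at h1
    have h2 : ∀ f, P (T ε * f) = T ε * P f := fun f => LinearMap.congr_fun h1 f
    have h3 : ∀ f, P (T (-ε) * f) = T (-ε) * P f := by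
      intro f
      have := h2 (T (-ε) * f)
      rw [← mul_assoc, ← LaurentPolynomial.T_add, add_neg_cancel, LaurentPolynomial.T_zero,
        one_mul] at this
      rw [this, ← mul_assoc, ← LaurentPolynomial.T_add, neg_add_cancel, LaurentPolynomial.T_zero,
        one_mul]
    have h4 : ∀ i : ℤ, P (T (ε * i)) = 0 := by
      intro i
      induction i using Int.induction_on with
      | zero => simpa using h 0 (by omega)
      | succ i ih =>
        rw [mul_add, mul_one, add_comm, LaurentPolynomial.T_add, h2, ih, mul_zero]
      | pred i ih =>
        rw [mul_sub, mul_one, sub_eq_add_neg, add_comm, LaurentPolynomial.T_add, h3, ih, mul_zero]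
    refine linearMap_ext_T fun j => ?_
    rw [← units_mul_self ε j, h4, LinearMap.zero_apply]

/-- Differential operators over a chart are combinations of the divided powers of the derivation
attached to a coordinate. -/
theorem exists_eq_sum_hasse {V : Chart} {ε : ℤˣ} (hV : V.HasCoord ε) {n : ℕ}
    {P : Module.End (ZMod p) (L p)} (hP : P ∈ sheafDiff p V n) :
    ∃ a : ℕ → L p, (∀ i, a i ∈ V.fn p) ∧
      P = ∑ i ∈ Finset.range (n + 1), LinearMap.mulLeft (ZMod p) (a i) * hasse p ε i := by
  -- Triangular interpolation: ∂^[N] kills t^j for j < N and sends t^N to 1, so the coefficients are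
  -- found one by one. They are functions on the chart because P preserves these. By
  -- `diffOp_eq_zero`, agreement on 1, …, t^n is enough.
  have approx : ∀ N ≤ n + 1, ∃ a : ℕ → L p, (∀ i, a i ∈ V.fn p) ∧ ∀ j < N,
      P (T (ε * j)) = (∑ i ∈ Finset.range N,
        LinearMap.mulLeft (ZMod p) (a i) * hasse p ε i) (T (ε * j)) := by
    intro N hN
    induction N with
    | zero => exact ⟨0, fun _ => zero_mem _, by simp⟩
    | succ N ih =>
      obtain ⟨a, ha, h⟩ := ih (by omega)
      set Q := ∑ i ∈ Finset.range N, LinearMap.mulLeft (ZMod p) (a i) * hasse p ε i with hQ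
      have hTN := hV.T_mem (p := p) N
      have hb : (P - Q) (T (ε * N)) ∈ V.fn p := by
        rw [LinearMap.sub_apply, hQ, LinearMap.sum_apply]
        exact sub_mem (hP.2 _ hTN) (sum_mem fun i _ => mul_mem (ha i) (hasse_mem_fn V ε i hTN))
      set b := (P - Q) (T (ε * N)) with hbdef
      refine ⟨Function.update a N b, fun i => ?_, fun j hj => ?_⟩
      · rcases eq_or_ne i N with rfl | hi
        · rwa [Function.update_self]
        · rw [Function.update_of_ne hi]; exact ha i
      · have hsum : ∑ i ∈ Finset.range N, LinearMap.mulLeft (ZMod p) (Function.update a N b i) *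
            hasse p ε i = Q := Finset.sum_congr rfl fun i hi => by
          rw [Function.update_of_ne (Finset.mem_range.1 hi).ne]
        rw [Finset.sum_range_succ, hsum, Function.update_self, LinearMap.add_apply,
          Module.End.mul_apply, hasse_T_units, binomMod_natCast, LinearMap.mulLeft_apply]
        rcases (Nat.lt_succ_iff.1 hj).lt_or_eq with hj | rfl
        · rw [h j hj, Nat.choose_eq_zero_of_lt hj]; simp
        · rw [hbdef, LinearMap.sub_apply]; simp
  obtain ⟨a, ha, h⟩ := approx (n + 1) le_rfl
  refine ⟨a, ha, sub_eq_zero.1 (diffOp_eq_zero ε (n := n) (sub_mem hP.1 ?_) fun j hj => ?_)⟩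
  · refine Submodule.sum_mem _ fun i hi => ?_
    rw [Finset.mem_range] at hi
    exact diffOp_mono (by omega) (diffOp_mul_mem (mulLeft_mem_diffOp _ _ 0) (hasse_mem_diffOp ε i))
  · rw [LinearMap.sub_apply, h j (by omega), sub_self]

theorem mulLeft_mul_hasse_mem {V : Chart} {a : L p} (ha : a ∈ V.fn p) (ε : ℤˣ) (n : ℕ) :
    LinearMap.mulLeft (ZMod p) a * hasse p ε n ∈ sheafDiff p V n := by
  simpa using (isAlmostCommFiltration_sheafDiff V).mul_mem (mulLeft_mem_sheafDiff ha 0)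
    (hasse_mem_sheafDiff V ε n)

/-- For p^m ≤ i < 2p^m the binomial C(i, p^m) is a unit mod p, so ∂^[i] is a multiple of ∂^[p^m]
∂^[i - p^m]. -/
theorem splitsAt_sheafDiff (V : Chart) (m : ℕ) : SplitsAt (sheafDiff p V) (p ^ m) := by
  intro n hn hn' P hP
  have hF := isAlmostCommFiltration_sheafDiff (p := p) V
  obtain ⟨ε, hV⟩ := V.exists_hasCoord
  obtain ⟨a, ha, rfl⟩ := exists_eq_sum_hasse hV hP
  refine sum_mem fun i hi => ?_
  rw [Finset.mem_range] at hi
  rcases le_or_gt (p ^ m) i with h | h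
  · obtain ⟨i', hi', b, hb, c, hc, hs, h1, -, -⟩ :=
      exists_parts_of_lt (p := p) (m := m) (a := i) (b := 0) (c := 0) (by omega) (by omega)
    obtain rfl : i' = p ^ m := by omega
    have e := hasse_mul (p := p) ε (p ^ m) (i - p ^ m)
    rw [Nat.add_sub_cancel' h] at e
    rw [← inv_smul_smul₀ h1 (hasse p ε i), ← e, mul_smul_comm, ← mul_assoc]
    exact Submodule.smul_mem _ _ (Submodule.mul_mem_mul (mulLeft_mul_hasse_mem (ha i) _ _)
      (hF.mono (by omega) (hasse_mem_sheafDiff V ε _)))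
  · rw [← mul_one (LinearMap.mulLeft (ZMod p) (a i) * hasse p ε i)]
    exact Submodule.mul_mem_mul (hF.mono h.le (mulLeft_mul_hasse_mem (ha i) _ _))
      (hF.mono (Nat.zero_le _) hF.one_mem)

/-! ### Frobenius on functions and Garnier's transform -/

instance : CharP (L p) p :=
  charP_of_injective_algebraMap (algebraMap (ZMod p) (L p)).injective p

/-- The `p`-th power map on functions. -/
def frobMap (p : ℕ) [Fact p.Prime] : L p →ₗ[ZMod p] L p :=
  AddMonoidHom.toZModLinearMap p (frobenius (L p) p).toAddMonoidHom

theorem frobMap_apply (f : L p) : frobMap p f = f ^ p := rfl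

theorem frobMap_T (j : ℤ) : frobMap p (T j) = T (j * p) := by
  rw [frobMap_apply, LaurentPolynomial.T_pow, mul_comm]

theorem frobMap_mul (f g : L p) : frobMap p (f * g) = frobMap p f * frobMap p g :=
  mul_pow f g p

/-- The linear left inverse of the `p`-th power map with `T ^ j ↦ 0` for `j` prime to `p`. -/
def contr (p : ℕ) : Module.End (ZMod p) (L p) :=
  onMonomials fun j => if (p : ℤ) ∣ j then T (j / p) else 0

omit [Fact p.Prime] in
theorem contr_T (j : ℤ) : contr p (T j) = if (p : ℤ) ∣ j then T (j / p) else 0 :=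
  onMonomials_T _ _

theorem contr_T_mul (j : ℤ) : contr p (T (j * p)) = T j := by
  have hp : (p : ℤ) ≠ 0 := by exact_mod_cast (Nat.Prime.pos (Fact.out : p.Prime)).ne'
  rw [contr_T, if_pos (Dvd.intro_left _ rfl), Int.mul_ediv_cancel _ hp]

theorem contr_frobMap (f : L p) : contr p (frobMap p f) = f := by
  suffices contr p ∘ₗ frobMap p = LinearMap.id from LinearMap.congr_fun this f
  refine linearMap_ext_T fun j => ?_
  rw [LinearMap.comp_apply, frobMap_T, contr_T_mul, LinearMap.id_apply]

theorem dwork_T (j : ℤ) : dwork p (T j) = if (p : ℤ) ∣ j then T j else 0 := by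
  have : ∀ r ∈ Finset.range p, ((-1 : ZMod p) ^ r •
      (LinearMap.mulLeft (ZMod p) (T (r : ℤ) : L p) * hasse p 1 r)) (T j) =
      ((-1) ^ r * binomMod p j r) • T j := by
    intro r _
    rw [LinearMap.smul_apply, Module.End.mul_apply, hasse_T, LinearMap.mulLeft_apply,
      mul_smul_comm, ← LaurentPolynomial.T_add, smul_smul]
    simp
  rw [dwork, LinearMap.sum_apply, Finset.sum_congr rfl this, ← Finset.sum_smul, sum_binomMod]
  split_ifs <;> simp

/-- Both sides are the projector onto the monomials with exponent divisible by p, whose span is the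
set of p-th powers. -/
theorem dwork_eq : dwork p = frobMap p ∘ₗ contr p := by
  refine linearMap_ext_T fun j => ?_
  rw [dwork_T, LinearMap.comp_apply, contr_T]
  split_ifs with h
  · rw [frobMap_T, Int.ediv_mul_cancel h]
  · rw [map_zero]

/-- Garnier's transform `P ↦ P'` of linear operators on functions. -/
def garnier (p : ℕ) [Fact p.Prime] :
    Module.End (ZMod p) (L p) →ₙₐ[ZMod p] Module.End (ZMod p) (L p) where
  toFun P := frobMap p ∘ₗ P ∘ₗ contr p
  map_smul' c P := by rw [LinearMap.smul_comp, LinearMap.comp_smul]; rfl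
  map_zero' := by simp
  map_add' P Q := by rw [LinearMap.add_comp, LinearMap.comp_add]
  map_mul' P Q := LinearMap.ext fun f => by simp [contr_frobMap]

theorem garnier_apply (P : Module.End (ZMod p) (L p)) (f : L p) :
    garnier p P f = frobMap p (P (contr p f)) := rfl

theorem garnier_one : garnier p 1 = dwork p := by
  rw [dwork_eq]; rfl

/-- As ℋ = F ∘ `contr`, the second condition gives P' = P' ∘ F ∘ `contr`, and the first replaces P'
∘ F by F ∘ P. -/
theorem isGarnierTransform_iff {P P' : Module.End (ZMod p) (L p)} :
    IsGarnierTransform p P P' ↔ P' = garnier p P := by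
  constructor
  · intro h
    rw [← h.dwork, dwork_eq]
    refine LinearMap.ext fun f => ?_
    exact (h.frob (contr p f)).trans rfl
  · rintro rfl
    refine ⟨fun f => ?_, ?_⟩
    · rw [garnier_apply, ← frobMap_apply, contr_frobMap, frobMap_apply]
    · rw [← garnier_one, ← map_mul, mul_one]

theorem hasse_mul_dwork_T (ε : ℤˣ) (n : ℕ) (j : ℤ) :
    (hasse p ε (n * p) * dwork p) (T (ε * (j * p))) =
      binomMod p j n • T (ε * ((j - n) * p)) := by
  have h : (p : ℤ) ∣ ε * (j * p) := Dvd.intro_left (ε * j) (by ring)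
  rw [Module.End.mul_apply, dwork_T, if_pos h, hasse_T_units, binomMod_mul_prime]
  congr 3
  push_cast; ring

theorem garnier_hasse (ε : ℤˣ) (n : ℕ) :
    garnier p (hasse p ε n) = hasse p ε (n * p) * dwork p := by
  refine linearMap_ext_T fun j => ?_
  by_cases h : (p : ℤ) ∣ j
  · obtain ⟨i, rfl⟩ := h
    have e : (p : ℤ) * i = ε * ((ε * i) * p) := by
      rw [mul_assoc, units_mul_self, mul_comm]
    rw [e, hasse_mul_dwork_T, garnier_apply, ← mul_assoc, contr_T_mul, hasse_T_units,
      map_smul, frobMap_T, mul_assoc]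
  · rw [garnier_apply, Module.End.mul_apply, contr_T, dwork_T, if_neg h, if_neg h]
    simp

theorem hasse_mul_dwork_comm (ε : ℤˣ) (n : ℕ) :
    dwork p * hasse p ε (n * p) = hasse p ε (n * p) * dwork p := by
  refine linearMap_ext_T fun j => ?_
  rw [Module.End.mul_apply, Module.End.mul_apply, hasse_T, map_smul, dwork_T, dwork_T]
  have : (p : ℤ) ∣ j - ε * ((n * p : ℕ) : ℤ) ↔ (p : ℤ) ∣ j :=
    (Int.dvd_iff_dvd_of_dvd_sub ⟨ε * n, by push_cast; ring⟩).symm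
  simp only [this]
  split_ifs
  · rw [hasse_T]
  · simp

/-- The projection formula for Frobenius; both sides are bilinear, which reduces it to monomials. -/
theorem contr_frobMap_mul (a f : L p) : contr p (frobMap p a * f) = a * contr p f := by
  suffices ∀ i j : ℤ, contr p (frobMap p (T i) * T j) = T i * contr p (T j) by
    have h1 : ∀ j : ℤ, contr p ∘ₗ LinearMap.mulRight (ZMod p) (T j) ∘ₗ frobMap p =
        LinearMap.mulRight (ZMod p) (contr p (T j)) :=
      fun j => linearMap_ext_T fun i => this i j
    have h2 : contr p ∘ₗ LinearMap.mulLeft (ZMod p) (frobMap p a) =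
        LinearMap.mulLeft (ZMod p) a ∘ₗ contr p :=
      linearMap_ext_T fun j => LinearMap.congr_fun (h1 j) a
    exact LinearMap.congr_fun h2 f
  intro i j
  have hp : (p : ℤ) ≠ 0 := by exact_mod_cast (Nat.Prime.pos (Fact.out : p.Prime)).ne'
  rw [frobMap_T, ← LaurentPolynomial.T_add, contr_T, contr_T]
  have : (p : ℤ) ∣ i * p + j ↔ (p : ℤ) ∣ j := Int.dvd_add_right (Dvd.intro_left _ rfl)
  simp only [this]
  split_ifs with h
  · rw [← LaurentPolynomial.T_add, Int.add_ediv_of_dvd_right h, Int.mul_ediv_cancel _ hp]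
  · rw [mul_zero]

theorem dwork_mulLeft_comm (a : L p) : dwork p * LinearMap.mulLeft (ZMod p) (frobMap p a) =
    LinearMap.mulLeft (ZMod p) (frobMap p a) * dwork p := by
  refine LinearMap.ext fun f => ?_
  simp [dwork_eq, contr_frobMap_mul, frobMap_mul]

theorem garnier_mulLeft (a : L p) : garnier p (LinearMap.mulLeft (ZMod p) a) =
    LinearMap.mulLeft (ZMod p) (frobMap p a) * dwork p := by
  refine LinearMap.ext fun f => ?_
  simp [dwork_eq, garnier_apply, frobMap_mul]

/-- By Lucas C(np + r, np) = 1 and C(x, np + r) = C(x, np) C(x, r), so on each monomial the sum over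
r is the alternating sum of `sum_binomMod`. -/
theorem garnierSum_eq (ε : ℤˣ) (n : ℕ) : garnierSum p ε n = hasse p ε (n * p) * dwork p := by
  refine linearMap_ext_T fun j => ?_
  have : ∀ r ∈ Finset.range p, (((-1) ^ r * ((n * p + r).choose (n * p) : ZMod p)) •
      (LinearMap.mulLeft (ZMod p) (T (ε * r : ℤ) : L p) * hasse p ε (n * p + r))) (T j) =
      ((-1) ^ r * binomMod p (ε * j) r) •
        (binomMod p (ε * j) (n * p) • T (j - ε * (n * p : ℕ))) := by
    intro r hr
    rw [Finset.mem_range] at hr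
    have hc : ((n * p + r).choose (n * p) : ZMod p) = 1 := by
      simpa using lucas_digits (p := p) n n hr (by omega : 0 < p)
    rw [LinearMap.smul_apply, Module.End.mul_apply, hasse_T, LinearMap.mulLeft_apply,
      mul_smul_comm, ← LaurentPolynomial.T_add, smul_smul, smul_smul, hc, mul_one,
      binomMod_mul_add _ _ hr]
    congr 1
    · ring
    · congr 1; push_cast; ring
  rw [garnierSum, LinearMap.sum_apply, Finset.sum_congr rfl this, ← Finset.sum_smul, sum_binomMod,
    Module.End.mul_apply, dwork_T]
  have hd : (p : ℤ) ∣ ε * j ↔ (p : ℤ) ∣ j := by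
    rcases Int.units_eq_one_or ε with rfl | rfl <;> simp
  simp only [hd]
  split_ifs
  · rw [one_smul, hasse_T]
  · rw [zero_smul, map_zero]

theorem dwork_mem_sheafDiff (V : Chart) : dwork p ∈ sheafDiff p V (p - 1) := by
  refine ⟨Submodule.sum_mem _ fun r hr => Submodule.smul_mem _ _ ?_, ?_⟩
  · rw [Finset.mem_range] at hr
    exact diffOp_mono (by omega) (diffOp_mul_mem (mulLeft_mem_diffOp _ _ 0) (hasse_mem_diffOp 1 r))
  · intro f hf
    rcases V.fn_cases (p := p) with h | ⟨ε, h⟩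
    · rw [h]; exact Algebra.mem_top
    rw [h] at hf ⊢
    refine (Subalgebra.mem_toSubmodule _).1 (adjoin_T_induction (fun i => ?_) f hf)
    rw [Subalgebra.mem_toSubmodule, dwork_T]
    split_ifs
    · exact T_mem_adjoin ε i rfl
    · exact zero_mem _

/-- On the monomials t^(jp) fixed by ℋ, every ∂^[s] with p ∤ s vanishes. Evaluation at t^(jp)
therefore isolates the coefficient of ∂^[jp]: smaller multiples of p are excluded by induction,
larger ones kill the monomial. -/
theorem sum_hasse_mul_dwork_eq_zero (ε : ℤˣ) (N : ℕ) (a : ℕ → L p)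
    (h : (∑ i ∈ Finset.range N, LinearMap.mulLeft (ZMod p) (a i) * hasse p ε i) * dwork p = 0)
    (i : ℕ) (hi : i * p < N) : a (i * p) = 0 := by
  have hp : 0 < p := Nat.Prime.pos Fact.out
  induction i using Nat.strong_induction_on with
  | _ j ih =>
    have h1 := LinearMap.congr_fun h (T (ε * ((j * p : ℕ) : ℤ)))
    have hd : (p : ℤ) ∣ ε * ((j * p : ℕ) : ℤ) := ⟨ε * j, by push_cast; ring⟩
    rw [Module.End.mul_apply, dwork_T, if_pos hd, LinearMap.sum_apply,
      Finset.sum_eq_single (j * p)] at h1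
    · rw [Module.End.mul_apply, hasse_T_units, binomMod_natCast, Nat.choose_self, Nat.cast_one,
        one_smul, sub_self, mul_zero, LaurentPolynomial.T_zero, LinearMap.mulLeft_apply,
        mul_one] at h1
      exact h1
    · intro s _ hs
      rw [Module.End.mul_apply, hasse_T_units, LinearMap.mulLeft_apply]
      by_cases hsp : p ∣ s
      · obtain ⟨s, rfl⟩ := hsp
        rw [mul_comm p s] at hs ⊢
        rcases lt_or_gt_of_ne hs with hs' | hs'
        · have hsj := Nat.lt_of_mul_lt_mul_right hs'
          rw [ih s hsj (by omega), zero_mul]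
        · rw [binomMod_natCast, Nat.choose_eq_zero_of_lt hs']; simp
      · push_cast
        rw [binomMod_mul_prime_eq_zero _ hsp, zero_smul, mul_zero]
    · intro hj
      exact absurd (Finset.mem_range.2 hi) hj

/-- A lift of ∑ a_i ∂^[i] is ∑ a_i^p ∂^[ip], since ℋ commutes with p-th powers and with ∂^[ip]. An
operator annihilated by ℋ on the right only involves ∂^[i] with p ∤ i; for i = qp + r this is ∂^[qp]
∂^[r], and ∂^[r] ℋ = 0 because 0 < r < p. -/
theorem isFrobeniusSplitting_garnier (V : Chart) (m : ℕ) :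
    IsFrobeniusSplitting (sheafDiff p V) p m (garnier p) := by
  have hp : 0 < p := Nat.Prime.pos Fact.out
  have hF := isAlmostCommFiltration_sheafDiff (p := p) V
  obtain ⟨ε, hV⟩ := V.exists_hasCoord
  refine ⟨?_, fun n P hP => ?_, fun n _ w hw h => ?_⟩
  · rw [garnier_one]; exact dwork_mem_sheafDiff V
  · obtain ⟨a, ha, rfl⟩ := exists_eq_sum_hasse hV hP
    refine ⟨∑ i ∈ Finset.range (n + 1), LinearMap.mulLeft (ZMod p) (frobMap p (a i)) *
      hasse p ε (i * p), sum_mem fun i hi => ?_, ?_, ?_⟩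
    · rw [Finset.mem_range] at hi
      exact hF.mono (Nat.mul_le_mul_right _ (by omega))
        (mulLeft_mul_hasse_mem (pow_mem (ha i) p) _ _)
    · rw [garnier_one, map_sum, Finset.sum_mul]
      refine Finset.sum_congr rfl fun i _ => ?_
      rw [map_mul, garnier_mulLeft, garnier_hasse, mul_assoc, mul_assoc, ← mul_assoc (dwork p),
        hasse_mul_dwork_comm, mul_assoc (hasse p ε _), ← garnier_one, ← map_mul, mul_one]
    · rw [garnier_one, map_sum, Finset.mul_sum]
      refine Finset.sum_congr rfl fun i _ => ?_
      rw [map_mul, garnier_mulLeft, garnier_hasse, ← mul_assoc (dwork p), dwork_mulLeft_comm,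
        mul_assoc, mul_assoc, hasse_mul_dwork_comm, ← mul_assoc (dwork p), hasse_mul_dwork_comm,
        mul_assoc (hasse p ε _), ← garnier_one, ← map_mul, mul_one]
  · obtain ⟨a, ha, rfl⟩ := exists_eq_sum_hasse hV hw
    rw [garnier_one] at h ⊢
    refine sum_mem fun i hi => ?_
    have hi' := Finset.mem_range.1 hi
    have ei := Nat.div_add_mod' i p
    have hr := Nat.mod_lt i hp
    by_cases h0 : i % p = 0
    · rw [h0, add_zero] at ei
      rw [← ei, sum_hasse_mul_dwork_eq_zero ε _ a h _ (by omega)]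
      simp
    · refine Submodule.subset_span ⟨i % p, by omega, by omega,
        LinearMap.mulLeft (ZMod p) (a i) * hasse p ε (i / p * p),
        hF.mono (by omega) (mulLeft_mul_hasse_mem (ha i) _ _), hasse p ε (i % p),
        hasse_mem_sheafDiff V ε _, ?_, ?_⟩
      · refine linearMap_ext_T fun j => ?_
        rw [Module.End.mul_apply, dwork_T]
        split_ifs with hj
        · obtain ⟨j, rfl⟩ := hj
          rw [hasse_T, show (ε : ℤ) * (p * j) = ε * j * p by ring, binomMod_mul_prime_eq_zero,
            zero_smul, LinearMap.zero_apply]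
          exact fun hd => h0 (by rw [← Nat.mod_mod]; exact Nat.mod_eq_zero_of_dvd hd)
        · rw [map_zero, LinearMap.zero_apply]
      · have hc : ((i / p * p + i % p).choose (i / p * p) : ZMod p) = 1 := by
          simpa using lucas_digits (p := p) (i / p) (i / p) hr hp
        rw [mul_assoc, hasse_mul, hc, one_smul, ei]

end Sheaf

end

end SL2Frobenius

namespace SL2Frobenius

/-! ### The enveloping algebra of `sl₂` over `ℚ` -/

noncomputable section

section Env

open Polynomial

attribute [local instance 100] LieRing.ofAssociativeRing

theorem envE_mul_envF : envE * envF = envF * envE + envH := by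
  rw [← sub_eq_iff_eq_add', ← LieRing.of_associative_ring_bracket, envE, envF, envH,
    ← LieHom.map_lie]
  congr 1
  apply Subtype.ext
  simp [LieRing.of_associative_ring_bracket]

theorem envH_mul_envE : envH * envE = envE * (envH + 2) := by
  rw [mul_add, ← sub_eq_iff_eq_add', ← LieRing.of_associative_ring_bracket, mul_two,
    envE, envH, ← LieHom.map_lie, ← map_add (UniversalEnvelopingAlgebra.ι ℚ)]
  congr 1
  apply Subtype.ext
  simp [LieRing.of_associative_ring_bracket]

theorem envH_mul_envF : envH * envF = envF * (envH - 2) := by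
  rw [mul_sub, sub_eq_add_neg, ← sub_eq_iff_eq_add', ← LieRing.of_associative_ring_bracket,
    mul_two, envF, envH, ← LieHom.map_lie, ← map_add (UniversalEnvelopingAlgebra.ι ℚ),
    ← map_neg (UniversalEnvelopingAlgebra.ι ℚ)]
  congr 1
  apply Subtype.ext
  simp [LieRing.of_associative_ring_bracket]
  norm_num
  funext i
  fin_cases i
  rfl

/-- An `sl₂`-triple in an algebra defines a morphism from the enveloping algebra. -/
theorem exists_envHom {B : Type*} [Ring B] [Algebra ℚ B] (e f h : B) (hef : e * f - f * e = h)
    (hhe : h * e - e * h = 2 • e) (hhf : h * f - f * h = -(2 • f)) :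
    ∃ Θ : Env →ₐ[ℚ] B, Θ envE = e ∧ Θ envF = f ∧ Θ envH = h := by
  let θ : LieAlgebra.SpecialLinear.sl (Fin 2) ℚ →ₗ⁅ℚ⁆ B :=
    { toFun := fun A => A.1 0 1 • e + A.1 1 0 • f + A.1 0 0 • h
      map_add' := fun A A' => by simp [add_smul]; abel
      map_smul' := fun c A => by simp [mul_smul]
      map_lie' := fun {A A'} => by
        have ht : ∀ A : LieAlgebra.SpecialLinear.sl (Fin 2) ℚ, A.1 1 1 = - A.1 0 0 := by
          intro A
          have := LinearMap.mem_ker.1 A.2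
          change Matrix.trace A.1 = 0 at this
          rw [Matrix.trace_fin_two] at this
          linarith
        simp only [LieSubalgebra.coe_bracket, LieRing.of_associative_ring_bracket,
          Matrix.sub_apply, Matrix.mul_apply, Fin.sum_univ_two, ht]
        have hhe' : h * e = e * h + 2 • e := by rw [← hhe]; abel
        have hhf' : h * f = f * h - 2 • f := by rw [sub_eq_add_neg, ← hhf]; abel
        have hef' : e * f = f * e + h := by rw [← hef]; abel
        simp only [mul_add, add_mul, smul_mul_assoc, mul_smul_comm, hhe', hhf', hef']
        module }
  refine ⟨UniversalEnvelopingAlgebra.lift ℚ θ, ?_, ?_, ?_⟩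
  · rw [envE, UniversalEnvelopingAlgebra.lift_ι_apply]; simp [θ]
  · rw [envF, UniversalEnvelopingAlgebra.lift_ι_apply]; simp [θ]
  · rw [envH, UniversalEnvelopingAlgebra.lift_ι_apply]; simp [θ]

/-! ### Integer valued polynomials -/

/-- The binomial polynomial `X (X - 1) ⋯ (X - n + 1) / n!`. -/
def binomPoly (n : ℕ) : ℚ[X] := ((n.factorial : ℚ)⁻¹) • descPochhammer ℚ n

theorem binom_eq_aeval (y : Env) (n : ℕ) : binom y n = aeval y (binomPoly n) := by
  rw [binomPoly, map_smul]; rfl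

theorem eval_binomPoly (n : ℕ) (x : ℤ) : (binomPoly n).eval (x : ℚ) = (Ring.choose x n : ℤ) := by
  have h := congrArg (Int.cast : ℤ → ℚ) (Ring.descPochhammer_eq_factorial_smul_choose x n)
  have h2 := descPochhammer_eval_cast (R := ℚ) n x
  rw [← Polynomial.eval_eq_smeval, nsmul_eq_mul, Int.cast_mul, Int.cast_natCast] at h
  rw [binomPoly, eval_smul, ← h2, h, smul_eq_mul, inv_mul_cancel_left₀ (by positivity)]

theorem poly_ext {q r : ℚ[X]} (h : ∀ x : ℤ, q.eval (x : ℚ) = r.eval (x : ℚ)) : q = r :=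
  eq_of_infinite_eval_eq q r ((Set.infinite_range_of_injective Int.cast_injective).mono
    (by rintro _ ⟨x, rfl⟩; exact h x))

theorem natDegree_binomPoly_le (n : ℕ) : (binomPoly n).natDegree ≤ n :=
  (natDegree_smul_le _ _).trans (descPochhammer_natDegree ℚ n).le

/-- Integer valued polynomials. -/
def intPoly : Subalgebra ℤ ℚ[X] where
  carrier := {q | ∀ x : ℤ, ∃ z : ℤ, q.eval (x : ℚ) = z}
  mul_mem' {q r} hq hr x := by
    obtain ⟨a, ha⟩ := hq x
    obtain ⟨b, hb⟩ := hr x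
    exact ⟨a * b, by simp [ha, hb]⟩
  add_mem' {q r} hq hr x := by
    obtain ⟨a, ha⟩ := hq x
    obtain ⟨b, hb⟩ := hr x
    exact ⟨a + b, by simp [ha, hb]⟩
  algebraMap_mem' c x := ⟨c, by simp⟩

theorem binomPoly_mem (n : ℕ) : binomPoly n ∈ intPoly := fun x => ⟨_, eval_binomPoly n x⟩

theorem comp_mem_intPoly {q : ℚ[X]} (hq : q ∈ intPoly) (u s : ℤ) :
    q.comp (C (u : ℚ) * X + C (s : ℚ)) ∈ intPoly := by
  intro x
  obtain ⟨z, hz⟩ := hq (u * x + s)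
  refine ⟨z, ?_⟩
  rw [← hz]; simp

/-- Newton's interpolation formula. -/
theorem mem_span_binomPoly {q : ℚ[X]} (hq : q ∈ intPoly) {d : ℕ} (hd : q.natDegree ≤ d) :
    q ∈ Submodule.span ℤ (binomPoly '' {b | b ≤ d}) := by
  -- The correction at N is an integral multiple of `binomPoly N`, which vanishes at 0, …, N - 1.
  -- Two polynomials of degree at most d that agree at 0, …, d coincide.
  have approx : ∀ N ≤ d + 1, ∃ r ∈ Submodule.span ℤ (binomPoly '' {b | b ≤ d}),
      ∀ j < N, r.eval (j : ℚ) = q.eval (j : ℚ) := by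
    intro N hN
    induction N with
    | zero => exact ⟨0, zero_mem _, by simp⟩
    | succ N ih =>
      obtain ⟨r, hr, h⟩ := ih (by omega)
      have hri : r ∈ intPoly := by
        have : Submodule.span ℤ (binomPoly '' {b | b ≤ d}) ≤ Subalgebra.toSubmodule intPoly :=
          Submodule.span_le.2 (by rintro _ ⟨b, -, rfl⟩; exact binomPoly_mem b)
        exact this hr
      obtain ⟨z, hz⟩ := (sub_mem hq hri) N
      rw [Int.cast_natCast] at hz
      refine ⟨r + z • binomPoly N, add_mem hr (Submodule.smul_mem _ _
        (Submodule.subset_span ⟨N, by simp; omega, rfl⟩)), fun j hj => ?_⟩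
      have hb := eval_binomPoly N j
      rw [Int.cast_natCast, Ring.choose_natCast] at hb
      rw [eval_add, eval_smul, hb]
      rcases (Nat.lt_succ_iff.1 hj).lt_or_eq with hj | rfl
      · rw [Nat.choose_eq_zero_of_lt hj, h j hj]; simp
      · rw [Nat.choose_self]
        have : q.eval (j : ℚ) - r.eval (j : ℚ) = z := by rw [← eval_sub, hz]
        simp only [Nat.cast_one, Int.cast_one, zsmul_eq_mul, mul_one, ← this]
        ring
  obtain ⟨r, hr, h⟩ := approx (d + 1) le_rfl
  suffices q - r = 0 by rwa [sub_eq_zero.1 this]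
  have hrd : r.natDegree ≤ d := by
    rw [natDegree_le_iff_degree_le, ← mem_degreeLE]
    have : Submodule.span ℤ (binomPoly '' {b | b ≤ d}) ≤ (degreeLE ℚ d).restrictScalars ℤ := by
      refine Submodule.span_le.2 ?_
      rintro _ ⟨b, hb, rfl⟩
      exact mem_degreeLE.2 (natDegree_le_iff_degree_le.1 ((natDegree_binomPoly_le b).trans hb))
    exact this hr
  refine eq_zero_of_natDegree_lt_card_of_eval_eq_zero (q - r)
    (f := fun i : Fin (d + 1) => ((i : ℕ) : ℚ)) (fun i j hij => Fin.ext (Nat.cast_injective hij))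
    (fun i => ?_) ?_
  · rw [eval_sub, h _ i.2, sub_self]
  · rw [Fintype.card_fin]
    exact Nat.lt_succ_of_le ((natDegree_sub_le _ _).trans (max_le hd hrd))

/-! ### Commutation formulas -/

section

variable {A : Type*} [Ring A] [Algebra ℚ A]

/-- With y = H and x a divided power of E or F, this carries any polynomial in H across x at the
price of a shift of the variable. -/
theorem aeval_mul_of_semiconj {x y y' : A} (h : y * x = x * y') (q : ℚ[X]) :
    aeval y q * x = x * aeval y' q := by
  induction q using Polynomial.induction_on' with
  | add q r hq hr => rw [map_add, map_add, add_mul, mul_add, hq, hr]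
  | monomial n c =>
    rw [aeval_monomial, aeval_monomial, mul_assoc, Algebra.algebraMap_eq_smul_one, smul_one_mul,
      smul_one_mul, mul_smul_comm]
    congr 1
    exact ((show SemiconjBy x y' y from h.symm).pow_right n).symm

end

theorem divPow_mul (x : Env) (a b : ℕ) :
    divPow x a * divPow x b = ((a + b).choose a : ℚ) • divPow x (a + b) := by
  rw [divPow, divPow, divPow, smul_mul_smul_comm, ← pow_add, smul_smul]
  congr 1
  rw [Nat.choose_symm_add, ← Nat.add_choose_mul_factorial_mul_factorial a b]
  have : ((a + b).choose b : ℚ) ≠ 0 := by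
    exact_mod_cast (Nat.choose_pos (Nat.le_add_left b a)).ne'
  push_cast
  field_simp

theorem divPow_one (x : Env) : divPow x 1 = x := by simp [divPow]

theorem mul_divPow (x : Env) (a : ℕ) : x * divPow x a = ((a : ℚ) + 1) • divPow x (a + 1) := by
  have := divPow_mul x 1 a
  rw [divPow_one] at this
  rw [this, add_comm 1 a, Nat.choose_one_right]
  push_cast
  rfl

theorem envH_mul_divPow_envE (a : ℕ) :
    envH * divPow envE a = divPow envE a * (envH + algebraMap ℚ _ (2 * a)) := by
  have : envH * envE ^ a = envE ^ a * (envH + algebraMap ℚ _ (2 * a)) := by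
    induction a with
    | zero => simp
    | succ a ih =>
      rw [pow_succ, ← mul_assoc, ih, mul_assoc, add_mul, envH_mul_envE, Algebra.commutes,
        ← mul_add, mul_assoc]
      congr 2
      rw [add_assoc, ← map_ofNat (algebraMap ℚ Env) 2, ← map_add]
      congr 2
      push_cast
      ring
  rw [divPow, mul_smul_comm, this, smul_mul_assoc]

theorem envH_mul_divPow_envF (a : ℕ) :
    envH * divPow envF a = divPow envF a * (envH + algebraMap ℚ _ (-2 * a)) := by
  have : envH * envF ^ a = envF ^ a * (envH + algebraMap ℚ _ (-2 * a)) := by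
    induction a with
    | zero => simp
    | succ a ih =>
      rw [pow_succ, ← mul_assoc, ih, mul_assoc, add_mul, envH_mul_envF, Algebra.commutes,
        ← mul_add, mul_assoc]
      congr 2
      rw [sub_add_eq_add_sub, add_sub_assoc, ← map_ofNat (algebraMap ℚ Env) 2, ← map_sub]
      congr 2
      push_cast
      ring
  rw [divPow, mul_smul_comm, this, smul_mul_assoc]

end Env
end
end SL2Frobenius

namespace SL2Frobenius

noncomputable section

/-! ### Polynomials in H and Kostant's commutation formula -/

section Env

open Polynomial

/-- The substitution `X ↦ u X + s`. -/
def affine (u s : ℤ) (q : ℚ[X]) : ℚ[X] := q.comp (C (u : ℚ) * X + C (s : ℚ))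

theorem eval_affine (u s x : ℤ) (q : ℚ[X]) :
    (affine u s q).eval (x : ℚ) = q.eval ((u * x + s : ℤ) : ℚ) := by
  simp [affine]

theorem natDegree_affine_le (u s : ℤ) (q : ℚ[X]) : (affine u s q).natDegree ≤ q.natDegree := by
  refine natDegree_comp_le.trans ?_
  have : (C (u : ℚ) * X + C (s : ℚ)).natDegree ≤ 1 := by compute_degree
  exact (Nat.mul_le_mul_left _ this).trans (mul_one _).le

/-- The value of a polynomial at `H`. -/
def atH : ℚ[X] →ₐ[ℚ] Env := aeval envH

theorem aeval_envH_add (q : ℚ[X]) (s : ℤ) :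
    aeval (envH + algebraMap ℚ _ (s : ℚ)) q = atH (affine 1 s q) := by
  rw [atH, affine, aeval_comp]
  simp

theorem atH_mul_divPow_envE (q : ℚ[X]) (a : ℕ) :
    atH q * divPow envE a = divPow envE a * atH (affine 1 (2 * a) q) := by
  rw [← aeval_envH_add]
  refine aeval_mul_of_semiconj ?_ q
  rw [envH_mul_divPow_envE]
  push_cast
  rfl

theorem atH_mul_divPow_envF (q : ℚ[X]) (a : ℕ) :
    atH q * divPow envF a = divPow envF a * atH (affine 1 (-2 * a) q) := by
  rw [← aeval_envH_add]
  refine aeval_mul_of_semiconj ?_ q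
  rw [envH_mul_divPow_envF]
  push_cast
  rfl

/-- F is carried across one factor E at a time; the index a + 1 avoids truncated subtraction. -/
theorem envF_mul_divPow_envE (a : ℕ) : envF * divPow envE (a + 1) =
    divPow envE (a + 1) * envF - divPow envE a * atH (X + C (a : ℚ)) := by
  have key : envF * envE ^ (a + 1) =
      envE ^ (a + 1) * envF - ((a : ℚ) + 1) • (envE ^ a * atH (X + C (a : ℚ))) := by
    have hH : atH X = envH := aeval_X _
    have hC : ∀ c : ℚ, atH (C c) = algebraMap ℚ _ c := fun c => aeval_C _ _
    induction a with
    | zero =>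
      simp only [Nat.cast_zero, map_zero, add_zero, pow_one, zero_add, pow_zero, one_mul, one_smul,
        hH, envE_mul_envF]
      abel
    | succ a ih =>
      have e1 : envF * envE = envE * envF - envH := by rw [envE_mul_envF]; abel
      have e3 : atH (X + C (a : ℚ)) * envE = envE * (envH + 2 + algebraMap ℚ _ (a : ℚ)) := by
        rw [map_add, hH, hC, add_mul, envH_mul_envE, Algebra.commutes, ← mul_add]
      rw [pow_succ envE (a + 1), ← mul_assoc, ih, sub_mul, smul_mul_assoc, mul_assoc _ envF,
        mul_assoc (envE ^ a), e3, ← mul_assoc (envE ^ a), ← pow_succ, e1, map_add, hH, hC]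
      have e2 : (2 : Env) = algebraMap ℚ _ 2 := (map_ofNat _ 2).symm
      simp only [e2, Algebra.algebraMap_eq_smul_one, mul_add, mul_sub, mul_assoc, mul_smul_comm,
        mul_one]
      push_cast
      module
  rw [divPow, divPow, mul_smul_comm, key, smul_sub, smul_smul, smul_mul_assoc, smul_mul_assoc,
    Nat.factorial_succ]
  congr 2
  push_cast
  field_simp

/-- The divided power `E^[a - k]`, zero for `k > a`. -/
def divPowSub (x : Env) (a k : ℕ) : Env := if k ≤ a then divPow x (a - k) else 0

theorem envF_mul_divPowSub (a k : ℕ) : envF * divPowSub envE a k =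
    divPowSub envE a k * envF - divPowSub envE a (k + 1) * atH (X + C ((a : ℚ) - k - 1)) := by
  rcases lt_or_ge k a with h | h
  · obtain ⟨b, rfl⟩ := Nat.exists_eq_add_of_lt h
    rw [divPowSub, divPowSub, if_pos (by omega), if_pos (by omega),
      show k + b + 1 - k = b + 1 by omega, show k + b + 1 - (k + 1) = b by omega,
      envF_mul_divPow_envE]
    congr 5
    push_cast; ring
  · rw [divPowSub, divPowSub, if_neg (by omega : ¬ k + 1 ≤ a), zero_mul, sub_zero]
    split_ifs with h'
    · obtain rfl : k = a := le_antisymm h' h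
      simp [divPow]
    · simp

/-- The coefficient identity for the induction on n in Kostant's formula: Pascal's rule combined
with (k + 1) C(y, k + 1) = (y - k) C(y, k). -/
theorem choose_succ_identity (n k : ℕ) (y : ℤ) :
    ((n : ℤ) + 1) * Ring.choose (y + 1) (k + 1) =
      ((n : ℤ) - k) * Ring.choose y (k + 1) + (y + n - k + 1) * Ring.choose y k := by
  have h := Ring.choose_smul_choose y (Nat.le_succ k)
  rw [Nat.succ_eq_add_one, Nat.choose_succ_self_right, nsmul_eq_mul, Nat.add_sub_cancel_left,
    Ring.choose_one_right] at h
  push_cast at h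
  rw [Ring.choose_succ_succ]
  linear_combination h

/-- Kostant's commutation formula. -/
theorem divPow_envF_mul_divPow_envE (n a : ℕ) : divPow envF n * divPow envE a =
    ∑ k ∈ Finset.range (n + 1), divPowSub envE a k * divPow envF (n - k) *
      atH (affine (-1) (n - a) (binomPoly k)) := by
  induction n with
  | zero => simp [divPowSub, divPow, binomPoly, affine]
  | succ n ih =>
    -- Multiplying by n + 1 turns (n + 1) F^[n+1] into F F^[n], to which the induction hypothesis
    -- applies.
    have hn : ((n : ℚ) + 1) ≠ 0 := by positivity
    refine smul_right_injective Env hn ?_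
    beta_reduce
    rw [← smul_mul_assoc, ← mul_divPow, mul_assoc, ih, Finset.mul_sum, Finset.smul_sum]
    have step : ∀ k ∈ Finset.range (n + 1), envF * (divPowSub envE a k * divPow envF (n - k) *
        atH (affine (-1) (n - a) (binomPoly k))) =
        divPowSub envE a k * divPow envF (n + 1 - k) *
          atH (((n : ℚ) + 1 - k) • affine (-1) (n - a) (binomPoly k)) -
        divPowSub envE a (k + 1) * divPow envF (n + 1 - (k + 1)) *
          atH ((X + C ((a : ℚ) - 2 * n + k - 1)) * affine (-1) (n - a) (binomPoly k)) := by
      intro k hk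
      have hk' : k ≤ n := Nat.lt_succ_iff.1 (Finset.mem_range.1 hk)
      rw [← mul_assoc, ← mul_assoc, envF_mul_divPowSub, sub_mul, sub_mul]
      congr 1
      · rw [mul_assoc _ envF, mul_divPow, mul_smul_comm, map_smul, mul_smul_comm, smul_mul_assoc,
          Nat.sub_add_comm hk', Nat.cast_sub hk']
        congr 1
        ring
      · rw [mul_assoc (divPowSub envE a (k + 1)), atH_mul_divPow_envF, map_mul,
          Nat.add_sub_add_right, mul_assoc, mul_assoc, mul_assoc]
        congr 4
        rw [affine]
        push_cast [Nat.cast_sub hk']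
        simp only [add_comp, X_comp, C_comp, map_one, one_mul, add_assoc, ← C_add]
        congr 2
        ring
    rw [Finset.sum_congr rfl step, Finset.sum_sub_distrib, Finset.sum_range_succ' _ (n + 1)]
    -- The added term k = n + 1 is zero because of its factor n + 1 - k; now the two families can be
    -- matched index by index.
    have top : ∑ k ∈ Finset.range (n + 1), divPowSub envE a k * divPow envF (n + 1 - k) *
          atH (((n : ℚ) + 1 - k) • affine (-1) (n - a) (binomPoly k)) =
        ∑ k ∈ Finset.range (n + 1 + 1), divPowSub envE a k * divPow envF (n + 1 - k) *
          atH (((n : ℚ) + 1 - k) • affine (-1) (n - a) (binomPoly k)) := by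
      rw [Finset.sum_range_succ _ (n + 1)]
      simp
    rw [top, Finset.sum_range_succ', add_sub_right_comm, ← Finset.sum_sub_distrib]
    congr 1
    · refine Finset.sum_congr rfl fun k _ => ?_
      rw [← mul_sub, ← map_sub, ← mul_smul_comm, ← map_smul]
      congr 2
      refine poly_ext fun x => ?_
      rw [eval_smul, eval_sub, eval_smul, eval_mul, eval_affine, eval_affine, eval_affine,
        eval_binomPoly, eval_binomPoly, eval_binomPoly]
      have h := congrArg (Int.cast : ℤ → ℚ) (choose_succ_identity n k (-1 * x + (n - a)))
      rw [show (-1 * x + (n - a) + 1 : ℤ) = -1 * x + (((n + 1 : ℕ) : ℤ) - a) by push_cast; ring]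
        at h
      push_cast at h
      simp only [smul_eq_mul, eval_add, eval_X, eval_C]
      push_cast
      linear_combination -h
    · simp [binomPoly, affine, map_smul]

end Env
end
end SL2Frobenius

namespace SL2Frobenius

noncomputable section

/-! ### The basis of Kostant's form -/

section Kostant

open Polynomial

theorem affine_affine (u s v t : ℤ) (q : ℚ[X]) :
    affine u s (affine v t q) = affine (v * u) (v * s + t) q := by
  refine poly_ext fun x => ?_
  rw [eval_affine, eval_affine, eval_affine]
  congr 2; ring

theorem affine_mem_intPoly {q : ℚ[X]} (hq : q ∈ intPoly) (u s : ℤ) : affine u s q ∈ intPoly :=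
  comp_mem_intPoly hq u s

/-- With the next two formulas, this shows that the integral span of the ordered monomials is stable
under left multiplication by the generators of Kostant's form. -/
theorem divPow_envF_mul_pbw (n a c : ℕ) (q : ℚ[X]) :
    divPow envF n * (divPow envE a * divPow envF c * atH q) =
      ∑ k ∈ Finset.range (n + 1), (n - k + c).choose (n - k) •
        (divPowSub envE a k * divPow envF (n - k + c) *
          atH (affine (-1) (n - a + 2 * c) (binomPoly k) * q)) := by
  rw [← mul_assoc, ← mul_assoc, divPow_envF_mul_divPow_envE, Finset.sum_mul, Finset.sum_mul]
  refine Finset.sum_congr rfl fun k _ => ?_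
  rw [mul_assoc _ (atH _) (divPow envF c), atH_mul_divPow_envF, ← mul_assoc,
    mul_assoc (divPowSub envE a k), divPow_mul, mul_assoc, ← map_mul, affine_affine,
    Nat.cast_smul_eq_nsmul, mul_smul_comm, smul_mul_assoc, mul_one,
    show (-1 : ℤ) * (-2 * c) + (n - a) = n - a + 2 * c by ring]

theorem atH_mul_pbw (a c : ℕ) (q r : ℚ[X]) :
    atH r * (divPow envE a * divPow envF c * atH q) =
      divPow envE a * divPow envF c * atH (affine 1 (2 * a - 2 * c) r * q) := by
  rw [← mul_assoc, ← mul_assoc, atH_mul_divPow_envE, mul_assoc (divPow envE a),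
    atH_mul_divPow_envF, affine_affine, ← mul_assoc, mul_assoc, ← map_mul]
  congr 4
  ring

theorem divPow_envE_mul_pbw (n a c : ℕ) (q : ℚ[X]) :
    divPow envE n * (divPow envE a * divPow envF c * atH q) =
      (n + a).choose n • (divPow envE (n + a) * divPow envF c * atH q) := by
  rw [← mul_assoc, ← mul_assoc, divPow_mul, Nat.cast_smul_eq_nsmul, smul_mul_assoc, smul_mul_assoc]

/-- The ordered monomials `E^[a] F^[c] binom(H, b)`, indexed by `(a, c, b)`. -/
def pbw (i : ℕ × ℕ × ℕ) : Env := divPow envE i.1 * divPow envF i.2.1 * atH (binomPoly i.2.2)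

theorem pbw_mem_span {q : ℚ[X]} (hq : q ∈ intPoly) (a c : ℕ) :
    divPow envE a * divPow envF c * atH q ∈ Submodule.span ℤ (Set.range pbw) := by
  have h := mem_span_binomPoly hq le_rfl
  clear hq
  generalize q.natDegree = d at h
  induction h using Submodule.span_induction with
  | mem x hx =>
    obtain ⟨b, -, rfl⟩ := hx
    exact Submodule.subset_span ⟨(a, c, b), rfl⟩
  | zero => simp
  | add x y _ _ hx hy => rw [map_add, mul_add]; exact add_mem hx hy
  | smul z x _ hx => rw [map_zsmul, mul_smul_comm]; exact Submodule.smul_mem _ z hx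

theorem divPow_envE_mem (n : ℕ) : divPow envE n ∈ kostant :=
  Algebra.subset_adjoin (.inl (.inl ⟨n, rfl⟩))

theorem divPow_envF_mem (n : ℕ) : divPow envF n ∈ kostant :=
  Algebra.subset_adjoin (.inl (.inr ⟨n, rfl⟩))

theorem atH_mem {q : ℚ[X]} (hq : q ∈ intPoly) : atH q ∈ kostant := by
  have h := mem_span_binomPoly hq le_rfl
  clear hq
  generalize q.natDegree = d at h
  induction h using Submodule.span_induction with
  | mem x hx =>
    obtain ⟨b, -, rfl⟩ := hx
    exact Algebra.subset_adjoin (.inr ⟨b, binom_eq_aeval _ _⟩)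
  | zero => simp
  | add x y _ _ hx hy => rw [map_add]; exact add_mem hx hy
  | smul z x _ hx => rw [map_zsmul]; exact Subalgebra.smul_mem _ hx z

theorem pbw_mem (i : ℕ × ℕ × ℕ) : pbw i ∈ kostant :=
  mul_mem (mul_mem (divPow_envE_mem _) (divPow_envF_mem _)) (atH_mem (binomPoly_mem _))

/-- The span contains 1 and is a left module over Kostant's form, as it is stable under the
generators. -/
theorem kostant_le_span : Subalgebra.toSubmodule kostant ≤ Submodule.span ℤ (Set.range pbw) := by
  intro u hu
  set S := Submodule.span ℤ (Set.range pbw) with hS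
  suffices ∀ y ∈ S, u * y ∈ S by
    rw [← mul_one u]
    refine this 1 ?_
    simpa [divPow] using pbw_mem_span (one_mem intPoly) 0 0
  have gen : ∀ g : Env, (∀ i, g * pbw i ∈ S) → ∀ y ∈ S, g * y ∈ S := by
    intro g hg y hy
    induction hy using Submodule.span_induction with
    | mem x hx => obtain ⟨i, rfl⟩ := hx; exact hg i
    | zero => simp
    | add x y _ _ hx hy => rw [mul_add]; exact add_mem hx hy
    | smul z x _ hx => rw [mul_smul_comm]; exact Submodule.smul_mem _ z hx
  induction hu using Algebra.adjoin_induction with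
  | mem x hx =>
    refine gen x fun i => ?_
    rcases hx with (⟨n, rfl⟩ | ⟨n, rfl⟩) | ⟨n, rfl⟩
    · rw [pbw, divPow_envE_mul_pbw]
      exact nsmul_mem (pbw_mem_span (binomPoly_mem _) _ _) _
    · rw [pbw, divPow_envF_mul_pbw]
      refine sum_mem fun k _ => nsmul_mem ?_ _
      rw [divPowSub]
      split_ifs
      · exact pbw_mem_span (mul_mem (affine_mem_intPoly (binomPoly_mem _) _ _)
          (binomPoly_mem _)) _ _
      · rw [zero_mul, zero_mul]; exact zero_mem _
    · rw [pbw, binom_eq_aeval, ← atH, atH_mul_pbw]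
      exact pbw_mem_span (mul_mem (affine_mem_intPoly (binomPoly_mem _) _ _)
          (binomPoly_mem _)) _ _
  | algebraMap r =>
    intro y hy
    rw [← Algebra.smul_def]
    exact Submodule.smul_mem _ r hy
  | add x y _ _ hx hy => intro z hz; rw [add_mul]; exact add_mem (hx z hz) (hy z hz)
  | mul x y _ _ hx hy => intro z hz; rw [mul_assoc]; exact hx _ (hy z hz)

/-- The module induced from the weight `l`, with basis the `E^a F^c`. -/
theorem exists_inducedModule (l : ℕ) : ∃ Θ : Env →ₐ[ℚ] Module.End ℚ (ℕ × ℕ →₀ ℚ),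
    ∀ i : ℕ × ℕ × ℕ, Θ (pbw i) (Finsupp.single (0, 0) 1) =
      ((i.1.factorial : ℚ)⁻¹ * (i.2.1.factorial : ℚ)⁻¹ * l.choose i.2.2) •
        Finsupp.single (i.1, i.2.1) 1 := by
  let s : ℕ × ℕ → (ℕ × ℕ →₀ ℚ) := fun i => Finsupp.single i 1
  let e : Module.End ℚ (ℕ × ℕ →₀ ℚ) := Finsupp.linearCombination ℚ fun i => s (i.1 + 1, i.2)
  let h : Module.End ℚ (ℕ × ℕ →₀ ℚ) := Finsupp.linearCombination ℚ fun i =>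
    ((l : ℚ) + 2 * i.1 - 2 * i.2) • s i
  -- The formula is forced by F E^a = E^a F - a E^(a-1) (H + a - 1), with H acting by l - 2c on F^c
  -- v.
  let f : Module.End ℚ (ℕ × ℕ →₀ ℚ) := Finsupp.linearCombination ℚ fun i =>
    s (i.1, i.2 + 1) - (i.1 * ((l : ℚ) - 2 * i.2 + i.1 - 1)) • s (i.1 - 1, i.2)
  have he : ∀ a c, e (s (a, c)) = s (a + 1, c) := by intro a c; simp [e, s]
  have hh : ∀ a c, h (s (a, c)) = ((l : ℚ) + 2 * a - 2 * c) • s (a, c) := by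
    intro a c; simp [h, s]
  have hf : ∀ a c, f (s (a, c)) =
      s (a, c + 1) - (a * ((l : ℚ) - 2 * c + a - 1)) • s (a - 1, c) := by
    intro a c; simp [f, s]
  have ext : ∀ P Q : Module.End ℚ (ℕ × ℕ →₀ ℚ), (∀ a c, P (s (a, c)) = Q (s (a, c))) → P = Q := by
    intro P Q h
    refine Finsupp.lhom_ext' fun i => LinearMap.ext_ring ?_
    exact h i.1 i.2
  have hex : ∃ Θ : Env →ₐ[ℚ] Module.End ℚ (ℕ × ℕ →₀ ℚ), Θ envE = e ∧ Θ envF = f ∧ Θ envH = h := by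
    refine exists_envHom e f h ?_ ?_ ?_
    · refine ext _ _ fun a c => ?_
      simp only [LinearMap.sub_apply, Module.End.mul_apply, he, hf, hh, map_sub, map_smul]
      rcases a with _ | a
      · simp
      · simp only [Nat.add_sub_cancel]
        push_cast
        module
    · refine ext _ _ fun a c => ?_
      simp only [LinearMap.sub_apply, Module.End.mul_apply, he, hh, map_smul, LinearMap.smul_apply]
      push_cast
      module
    · refine ext _ _ fun a c => ?_
      simp only [LinearMap.sub_apply, Module.End.mul_apply, hf, hh, map_smul, map_sub,
        LinearMap.smul_apply, LinearMap.neg_apply]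
      rcases a with _ | a
      · simp
        module
      · simp only [Nat.add_sub_cancel]
        push_cast
        module
  obtain ⟨Θ, hE, hF, hH⟩ := hex
  refine ⟨Θ, fun i => ?_⟩
  obtain ⟨a, c, b⟩ := i
  have h1 : Θ (atH (binomPoly b)) (s (0, 0)) = (l.choose b : ℚ) • s (0, 0) := by
    have : ∀ q : ℚ[X], Θ (atH q) (s (0, 0)) = q.eval (l : ℚ) • s (0, 0) := by
      intro q
      rw [atH, ← Polynomial.aeval_algHom_apply, hH]
      induction q using Polynomial.induction_on' with
      | add q r hq hr => rw [map_add, LinearMap.add_apply, hq, hr, eval_add, add_smul]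
      | monomial n x =>
        have hpow : ∀ n : ℕ, (h ^ n) (s (0, 0)) = ((l : ℚ) ^ n) • s (0, 0) := by
          intro n
          induction n with
          | zero => simp
          | succ n ih =>
            rw [pow_succ', Module.End.mul_apply, ih, map_smul, hh, smul_smul]
            congr 1
            push_cast; ring
        rw [aeval_monomial, eval_monomial, Algebra.algebraMap_eq_smul_one, smul_one_mul,
          LinearMap.smul_apply, hpow, smul_smul]
    have h2 := eval_binomPoly b l
    rw [Int.cast_natCast, Ring.choose_natCast] at h2
    rw [this, h2]
    norm_cast
  have h2 : ∀ c : ℕ, (f ^ c) (s (0, 0)) = s (0, c) := by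
    intro c
    induction c with
    | zero => simp
    | succ c ih => rw [pow_succ', Module.End.mul_apply, ih, hf]; simp
  have h3 : ∀ a : ℕ, (e ^ a) (s (0, c)) = s (a, c) := by
    intro a
    induction a with
    | zero => simp
    | succ c ih => rw [pow_succ', Module.End.mul_apply, ih, he]
  change Θ (pbw (a, c, b)) (s (0, 0)) = _ • s (a, c)
  simp only [pbw, divPow, map_mul, map_smul, map_pow, hE, hF, Module.End.mul_apply,
    LinearMap.smul_apply, h1, h2, h3, smul_smul]
  congr 1
  ring

/-- Acting on the generator of the induced module separates the pairs (a, c). For a fixed pair, the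
weights l = 0, 1, 2, … give the triangular system C(l, b), solved by induction on b. -/
theorem linearIndependent_pbw : LinearIndependent ℤ pbw := by
  rw [linearIndependent_iff']
  intro s g hg
  have key : ∀ (l a c : ℕ), ∑ i ∈ s, (if (i.1, i.2.1) = (a, c) then
      (g i * l.choose i.2.2 : ℚ) else 0) = 0 := by
    intro l a c
    obtain ⟨Θ, hΘ⟩ := exists_inducedModule l
    have h := congrArg (fun u => (Θ u (Finsupp.single (0, 0) 1)) (a, c)) hg
    simp only [map_sum, map_zsmul, map_zero, LinearMap.sum_apply, LinearMap.smul_apply, hΘ,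
      Finsupp.finsetSum_apply, Finsupp.smul_apply, LinearMap.zero_apply,
      Finsupp.coe_zero, Pi.zero_apply, Finsupp.single_apply] at h
    have h2 := congrArg (fun x : ℚ => a.factorial * c.factorial * x) h
    simp only [mul_zero, Finset.mul_sum] at h2
    refine Eq.trans (Finset.sum_congr rfl fun i _ => ?_) h2
    split_ifs with hi
    · obtain ⟨rfl, rfl⟩ := Prod.mk.inj hi
      simp only [smul_eq_mul, zsmul_eq_mul, mul_one]
      field_simp
    · simp
  suffices ∀ b a c, (a, c, b) ∈ s → g (a, c, b) = 0 from fun i hi => this _ _ _ hi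
  intro b
  induction b using Nat.strong_induction_on with
  | _ b ih =>
    intro a c hb
    have h := key b a c
    rw [Finset.sum_eq_single (a, c, b)] at h
    · simpa using h
    · rintro ⟨a', c', b'⟩ hi hne
      split_ifs with he
      · obtain ⟨h1, h2⟩ := Prod.mk.inj he
        simp only at h1 h2
        subst h1 h2
        have hbb : b' ≠ b := fun h => hne (by rw [h])
        rcases lt_or_gt_of_ne hbb with hlt | hlt
        · rw [ih b' hlt _ _ hi]; simp
        · rw [Nat.choose_eq_zero_of_lt hlt]; simp
      · rfl
    · exact fun h => absurd hb h

/-- The basis of Kostant's form given by the ordered monomials. -/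
def kostantBasis : Module.Basis (ℕ × ℕ × ℕ) ℤ kostant :=
  Module.Basis.mk (v := fun i => (⟨pbw i, pbw_mem i⟩ : kostant))
    (LinearIndependent.of_comp kostant.val.toLinearMap (by exact linearIndependent_pbw)) (by
      rintro ⟨u, hu⟩ -
      suffices ∀ u ∈ Submodule.span ℤ (Set.range pbw), ∃ hu : u ∈ kostant, (⟨u, hu⟩ : kostant) ∈
          Submodule.span ℤ (Set.range fun i => (⟨pbw i, pbw_mem i⟩ : kostant)) from
        (this u (kostant_le_span hu)).2
      intro u hu
      induction hu using Submodule.span_induction with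
      | mem x hx => obtain ⟨i, rfl⟩ := hx; exact ⟨pbw_mem i, Submodule.subset_span ⟨i, rfl⟩⟩
      | zero => exact ⟨zero_mem _, zero_mem _⟩
      | add x y _ _ hx hy => exact ⟨add_mem hx.1 hy.1, add_mem hx.2 hy.2⟩
      | smul z x _ hx => exact ⟨Subalgebra.smul_mem _ hx.1 z, Submodule.smul_mem _ z hx.2⟩)

theorem kostantBasis_apply (i : ℕ × ℕ × ℕ) : kostantBasis i = ⟨pbw i, pbw_mem i⟩ := by
  simp [kostantBasis]

end Kostant
end
end SL2Frobenius

namespace SL2Frobenius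

noncomputable section

/-! ### The distribution algebra modulo `p` -/

section Dist

open Polynomial

/-- The value of an integer valued polynomial at an integer. -/
def intVal (x : ℤ) : intPoly →+* ℤ where
  toFun q := (q.2 x).choose
  map_one' := by
    apply Int.cast_injective (α := ℚ)
    rw [← ((1 : intPoly).2 x).choose_spec]; simp
  map_zero' := by
    apply Int.cast_injective (α := ℚ)
    rw [← ((0 : intPoly).2 x).choose_spec]; simp
  map_mul' q r := by
    apply Int.cast_injective (α := ℚ)
    rw [← ((q * r).2 x).choose_spec, Int.cast_mul, ← (q.2 x).choose_spec, ← (r.2 x).choose_spec]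
    simp
  map_add' q r := by
    apply Int.cast_injective (α := ℚ)
    rw [← ((q + r).2 x).choose_spec, Int.cast_add, ← (q.2 x).choose_spec, ← (r.2 x).choose_spec]
    simp

theorem intVal_spec (x : ℤ) (q : intPoly) : (intVal x q : ℚ) = q.1.eval (x : ℚ) :=
  ((q.2 x).choose_spec).symm

/-- The value modulo `p` of an integer valued polynomial at an integer. -/
def modVal (p : ℕ) (x : ℤ) : intPoly →+* ZMod p := (Int.castRingHom (ZMod p)).comp (intVal x)

theorem modVal_apply (p : ℕ) (x : ℤ) (q : intPoly) : modVal p x q = (intVal x q : ZMod p) := rfl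

/-- The binomial polynomial as an integer valued polynomial. -/
def binomInt (n : ℕ) : intPoly := ⟨binomPoly n, binomPoly_mem n⟩

/-- The substitution `X ↦ u X + s` on integer valued polynomials. -/
def affineInt (u s : ℤ) (q : intPoly) : intPoly := ⟨affine u s q, affine_mem_intPoly q.2 u s⟩

theorem modVal_binomInt (p : ℕ) (x : ℤ) (n : ℕ) :
    modVal p x (binomInt n) = binomMod p x n := by
  rw [modVal_apply, binomMod]
  congr 1
  apply Int.cast_injective (α := ℚ)
  rw [intVal_spec, binomInt, eval_binomPoly]

theorem modVal_affineInt (p : ℕ) (x u s : ℤ) (q : intPoly) :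
    modVal p x (affineInt u s q) = modVal p (u * x + s) q := by
  rw [modVal_apply, modVal_apply]
  congr 1
  apply Int.cast_injective (α := ℚ)
  rw [intVal_spec, intVal_spec, affineInt, eval_affine]

variable (p : ℕ)

/-- The inclusion of Kostant's form in the distribution algebra. -/
def ofKostant : kostant →ₐ[ℤ] Dist p := Algebra.TensorProduct.includeRight

/-- Integer valued polynomials in `H` as distributions. -/
def distP : intPoly →+* Dist p :=
  (ofKostant p).toRingHom.comp
    (((atH : ℚ[X] →+* Env).comp intPoly.val.toRingHom).codRestrict kostant fun q => atH_mem q.2)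

theorem distP_apply (q : intPoly) : distP p q = ofKostant p ⟨atH q.1, atH_mem q.2⟩ := rfl

theorem distE_eq (n : ℕ) : distE p n = ofKostant p ⟨divPow envE n, divPow_envE_mem n⟩ := rfl

theorem distF_eq (n : ℕ) : distF p n = ofKostant p ⟨divPow envF n, divPow_envF_mem n⟩ := rfl

theorem distH_eq (n : ℕ) : distH p n = distP p (binomInt n) := by
  rw [distP_apply]
  change ofKostant p _ = _
  congr 1
  exact Subtype.ext (binom_eq_aeval _ _)

@[simp] theorem distE_zero : distE p 0 = 1 := by
  rw [distE_eq, ← map_one (ofKostant p)]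
  congr 1
  exact Subtype.ext (by simp [divPow])

@[simp] theorem distF_zero : distF p 0 = 1 := by
  rw [distF_eq, ← map_one (ofKostant p)]
  congr 1
  exact Subtype.ext (by simp [divPow])

variable {p}

theorem distE_mul (a b : ℕ) :
    distE p a * distE p b = ((a + b).choose a : ZMod p) • distE p (a + b) := by
  rw [distE_eq, distE_eq, distE_eq, ← map_mul, Nat.cast_smul_eq_nsmul, ← map_nsmul]
  congr 1
  exact Subtype.ext ((divPow_mul _ _ _).trans (Nat.cast_smul_eq_nsmul _ _ _))

theorem distF_mul (a b : ℕ) :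
    distF p a * distF p b = ((a + b).choose a : ZMod p) • distF p (a + b) := by
  rw [distF_eq, distF_eq, distF_eq, ← map_mul, Nat.cast_smul_eq_nsmul, ← map_nsmul]
  congr 1
  exact Subtype.ext ((divPow_mul _ _ _).trans (Nat.cast_smul_eq_nsmul _ _ _))

theorem distP_mul_distE (q : intPoly) (a : ℕ) :
    distP p q * distE p a = distE p a * distP p (affineInt 1 (2 * a) q) := by
  rw [distE_eq, distP_apply, distP_apply, ← map_mul, ← map_mul]
  congr 1
  exact Subtype.ext (atH_mul_divPow_envE _ _)

theorem distP_mul_distF (q : intPoly) (a : ℕ) :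
    distP p q * distF p a = distF p a * distP p (affineInt 1 (-2 * a) q) := by
  rw [distF_eq, distP_apply, distP_apply, ← map_mul, ← map_mul]
  congr 1
  exact Subtype.ext (atH_mul_divPow_envF _ _)

/-- Kostant's commutation formula modulo `p`. -/
theorem distF_mul_pbw (n a c : ℕ) (q : intPoly) :
    distF p n * (distE p a * distF p c * distP p q) =
      ∑ k ∈ Finset.range (n + 1), if k ≤ a then ((n - k + c).choose (n - k) : ZMod p) •
        (distE p (a - k) * distF p (n - k + c) *
          distP p (affineInt (-1) (n - a + 2 * c) (binomInt k) * q)) else 0 := by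
  have : (⟨divPow envF n, divPow_envF_mem n⟩ * (⟨divPow envE a, divPow_envE_mem a⟩ *
      ⟨divPow envF c, divPow_envF_mem c⟩ * ⟨atH q.1, atH_mem q.2⟩) : kostant) =
      ∑ k ∈ Finset.range (n + 1), if k ≤ a then (n - k + c).choose (n - k) •
        (⟨divPow envE (a - k), divPow_envE_mem _⟩ * ⟨divPow envF (n - k + c), divPow_envF_mem _⟩ *
          ⟨atH (affineInt (-1) (n - a + 2 * c) (binomInt k) * q : intPoly).1,
            atH_mem (Subtype.prop _)⟩) else 0 := by
    apply Subtype.ext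
    refine (divPow_envF_mul_pbw n a c q.1).trans ?_
    rw [AddSubmonoidClass.coe_finsetSum]
    refine Finset.sum_congr rfl fun k _ => ?_
    rw [divPowSub]
    split_ifs
    · rfl
    · simp
  rw [distF_eq, distE_eq, distF_eq, distP_apply, ← map_mul, ← map_mul, ← map_mul, this, map_sum]
  refine Finset.sum_congr rfl fun k _ => ?_
  split_ifs
  · rw [map_nsmul, map_mul, map_mul, Nat.cast_smul_eq_nsmul]
    rfl
  · rw [map_zero]

variable [Fact p.Prime]

/-- If p divides all values of q, then q / p is integer valued, so q(H) is p times an element of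
Kostant's form. Identities between polynomials in H thereby become congruences between values. -/
theorem distP_eq_zero {q : intPoly} (h : ∀ x, modVal p x q = 0) : distP p q = 0 := by
  have hp : (p : ℚ) ≠ 0 := by exact_mod_cast (Nat.Prime.pos (Fact.out : p.Prime)).ne'
  have hr : (p : ℚ)⁻¹ • q.1 ∈ intPoly := by
    intro x
    obtain ⟨z, hz⟩ := (ZMod.intCast_zmod_eq_zero_iff_dvd _ _).1 (h x)
    refine ⟨z, ?_⟩
    rw [eval_smul, ← intVal_spec, hz]
    push_cast
    rw [smul_eq_mul, inv_mul_cancel_left₀ hp]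
  have : q = p • (⟨_, hr⟩ : intPoly) := by
    apply Subtype.ext
    change q.1 = p • ((p : ℚ)⁻¹ • q.1)
    rw [← Nat.cast_smul_eq_nsmul ℚ, smul_inv_smul₀ hp]
  rw [this, map_nsmul, ← Nat.cast_smul_eq_nsmul (ZMod p), CharP.cast_eq_zero, zero_smul]

theorem distP_congr {q r : intPoly} (h : ∀ x, modVal p x q = modVal p x r) :
    distP p q = distP p r := by
  rw [← sub_eq_zero, ← map_sub]
  exact distP_eq_zero fun x => by rw [map_sub, h, sub_self]

/-- The basis of the distribution algebra given by the ordered monomials. -/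
def distBasis (p : ℕ) : Module.Basis (ℕ × ℕ × ℕ) (ZMod p) (Dist p) :=
  Algebra.TensorProduct.basis (ZMod p) kostantBasis

theorem distBasis_apply (i : ℕ × ℕ × ℕ) :
    distBasis p i = distE p i.1 * distF p i.2.1 * distP p (binomInt i.2.2) := by
  rw [distBasis, Algebra.TensorProduct.basis_apply, kostantBasis_apply, distE_eq, distF_eq,
    distP_apply, ← map_mul, ← map_mul]
  rfl

end Dist
end
end SL2Frobenius

namespace SL2Frobenius

noncomputable section

/-! ### The order filtration on distributions -/

section DistFil

open Polynomial

/-- Induction on integer valued polynomials of bounded degree. -/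
theorem intPoly_induction {d : ℕ} {C : intPoly → Prop} (zero : C 0)
    (binom : ∀ b ≤ d, C (binomInt b)) (add : ∀ q r, C q → C r → C (q + r))
    (zsmul : ∀ (z : ℤ) q, C q → C (z • q)) (q : intPoly) (hq : q.1.natDegree ≤ d) : C q := by
  suffices ∀ r ∈ Submodule.span ℤ (binomPoly '' {b | b ≤ d}), ∃ h : r ∈ intPoly, C ⟨r, h⟩ from
    (this _ (mem_span_binomPoly q.2 hq)).2
  intro r hr
  induction hr using Submodule.span_induction with
  | mem x hx => obtain ⟨b, hb, rfl⟩ := hx; exact ⟨_, binom b hb⟩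
  | zero => exact ⟨_, zero⟩
  | add x y _ _ hx hy => exact ⟨_, add _ _ hx.2 hy.2⟩
  | smul z x _ hx => exact ⟨Subalgebra.smul_mem _ hx.1 z, zsmul z _ hx.2⟩

variable {p : ℕ}

theorem distP_zsmul (z : ℤ) (q : intPoly) : distP p (z • q) = (z : ZMod p) • distP p q := by
  rw [map_zsmul, Int.cast_smul_eq_zsmul]

theorem natDegree_affineInt_binomInt_le (u s : ℤ) (n : ℕ) :
    (affineInt u s (binomInt n)).1.natDegree ≤ n :=
  (natDegree_affine_le _ _ _).trans (natDegree_binomPoly_le n)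

variable [Fact p.Prime]

theorem distP_shift (s : ℤ) (b : ℕ) : distP p (affineInt 1 s (binomInt b)) =
    ∑ t ∈ Finset.range (b + 1), binomMod p s (b - t) • distH p t := by
  have : distP p (affineInt 1 s (binomInt b)) =
      distP p (∑ t ∈ Finset.range (b + 1), (Ring.choose s (b - t) : ℤ) • binomInt t) := by
    refine distP_congr fun x => ?_
    rw [modVal_affineInt, modVal_binomInt, one_mul, binomMod_add, map_sum]
    refine Finset.sum_congr rfl fun t _ => ?_
    rw [map_zsmul, modVal_binomInt, zsmul_eq_mul, mul_comm]
    rfl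
  rw [this, map_sum]
  refine Finset.sum_congr rfl fun t _ => ?_
  rw [distP_zsmul, distH_eq]
  rfl

/-- Vandermonde's identity for x = (x - b') + b', followed by C(x - b', s) C(x, b') = C(s + b', s)
C(x, s + b'). The top term s = b has coefficient C(b + b', b). -/
theorem distH_mul (b b' : ℕ) : distH p b * distH p b' =
    ∑ s ∈ Finset.range (b + 1), (binomMod p b' (b - s) * ((s + b').choose s : ZMod p)) •
      distH p (s + b') := by
  have : distP p (binomInt b * binomInt b') =
      distP p (∑ s ∈ Finset.range (b + 1),
        (Ring.choose (b' : ℤ) (b - s) * ((s + b').choose s : ℤ) : ℤ) • binomInt (s + b')) := by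
    refine distP_congr fun x => ?_
    rw [map_mul, modVal_binomInt, modVal_binomInt, map_sum]
    have h := binomMod_add (p := p) (x - b') b' b
    rw [sub_add_cancel] at h
    rw [h, Finset.sum_mul]
    refine Finset.sum_congr rfl fun s _ => ?_
    rw [map_zsmul, modVal_binomInt, zsmul_eq_mul, mul_right_comm, binomMod_mul_binomMod]
    push_cast
    rw [← binomMod]
    ring
  rw [distH_eq, distH_eq, ← map_mul, this, map_sum]
  refine Finset.sum_congr rfl fun t _ => ?_
  rw [distP_zsmul, distH_eq]
  push_cast
  rfl

omit [Fact p.Prime] in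
theorem distFil_mono : Monotone (distFil p) := fun _ _ h =>
  Submodule.span_mono fun _ ⟨a, b, c, hn, hx⟩ => ⟨a, b, c, hn.trans h, hx⟩

theorem distH_mul_distF (b c : ℕ) : distH p b * distF p c =
    ∑ t ∈ Finset.range (b + 1), binomMod p (-2 * c) (b - t) • (distF p c * distH p t) := by
  rw [distH_eq, distP_mul_distF, distP_shift, Finset.mul_sum]
  exact Finset.sum_congr rfl fun t _ => by rw [mul_smul_comm]

theorem distH_mul_distE (b a : ℕ) : distH p b * distE p a =
    ∑ t ∈ Finset.range (b + 1), binomMod p (2 * a) (b - t) • (distE p a * distH p t) := by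
  rw [distH_eq, distP_mul_distE, distP_shift, Finset.mul_sum]
  exact Finset.sum_congr rfl fun t _ => by rw [mul_smul_comm]

/-- The filtration is defined by monomials in the order E, H, F and the basis uses E, F, H. Moving H
across F only adds terms of lower degree in H, so the spans coincide. -/
theorem distFil_eq (n : ℕ) : distFil p n =
    Submodule.span (ZMod p) (distBasis p '' {i | i.1 + i.2.1 + i.2.2 ≤ n}) := by
  apply le_antisymm
  · refine Submodule.span_le.2 ?_
    rintro _ ⟨a, b, c, h, rfl⟩
    rw [mul_assoc, distH_mul_distF, Finset.mul_sum]
    refine sum_mem fun t ht => ?_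
    rw [Finset.mem_range] at ht
    rw [mul_smul_comm]
    refine Submodule.smul_mem _ _ (Submodule.subset_span ⟨(a, c, t), ?_, ?_⟩)
    · simp only [Set.mem_ofPred_eq]; omega
    · rw [distBasis_apply, distH_eq, mul_assoc]
  · refine Submodule.span_le.2 ?_
    rintro _ ⟨⟨a, c, b⟩, h, rfl⟩
    simp only [Set.mem_ofPred_eq] at h
    have : distF p c * distP p (binomInt b) =
        distP p (affineInt 1 (2 * c) (binomInt b)) * distF p c := by
      rw [distP_mul_distF]
      congr 1
      refine distP_congr fun x => ?_
      rw [modVal_affineInt, modVal_affineInt]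
      congr 2
      ring
    rw [distBasis_apply, mul_assoc, this, distP_shift, Finset.sum_mul, Finset.mul_sum]
    refine sum_mem fun t ht => ?_
    rw [Finset.mem_range] at ht
    rw [smul_mul_assoc, mul_smul_comm, ← mul_assoc]
    exact Submodule.smul_mem _ _ (Submodule.subset_span ⟨a, t, c, by omega, rfl⟩)

theorem pbw_mem_distFil {a c d n : ℕ} (h : a + c + d ≤ n) (q : intPoly) (hq : q.1.natDegree ≤ d) :
    distE p a * distF p c * distP p q ∈ distFil p n := by
  rw [distFil_eq]
  refine intPoly_induction (C := fun q => distE p a * distF p c * distP p q ∈ _) ?_ ?_ ?_ ?_ q hq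
  · simp
  · intro b hb
    refine Submodule.subset_span ⟨(a, c, b), ?_, distBasis_apply _⟩
    simp only [Set.mem_ofPred_eq]; omega
  · intro q r hq hr
    rw [map_add, mul_add]; exact add_mem hq hr
  · intro z q hq
    rw [distP_zsmul, mul_smul_comm]; exact Submodule.smul_mem _ _ hq

theorem distE_mem (n : ℕ) : distE p n ∈ distFil p n := by
  simpa using pbw_mem_distFil (p := p) (a := n) (c := 0) (d := 0) le_rfl 1 (by simp)

theorem distF_mem (n : ℕ) : distF p n ∈ distFil p n := by
  simpa using pbw_mem_distFil (p := p) (a := 0) (c := n) (d := 0) (by omega) 1 (by simp)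

theorem distP_mem {q : intPoly} {d : ℕ} (hq : q.1.natDegree ≤ d) : distP p q ∈ distFil p d := by
  simpa using pbw_mem_distFil (p := p) (a := 0) (c := 0) (d := d) (by omega) q hq

theorem distH_mem (n : ℕ) : distH p n ∈ distFil p n := by
  rw [distH_eq]; exact distP_mem (natDegree_binomPoly_le n)

/-- It is enough to check linear statements about the filtration on ordered monomials. -/
theorem distFil_induction {n : ℕ} {C : Dist p → Prop}
    (basis : ∀ a c b, a + c + b ≤ n → C (distE p a * distF p c * distP p (binomInt b)))
    (zero : C 0) (add : ∀ x y, C x → C y → C (x + y))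
    (smul : ∀ (z : ZMod p) x, C x → C (z • x)) {x : Dist p} (hx : x ∈ distFil p n) : C x := by
  rw [distFil_eq] at hx
  induction hx using Submodule.span_induction with
  | mem x hx => obtain ⟨⟨a, c, b⟩, h, rfl⟩ := hx; rw [distBasis_apply]; exact basis _ _ _ h
  | zero => exact zero
  | add x y _ _ hx hy => exact add x y hx hy
  | smul z x _ hx => exact smul z x hx

theorem gen_mul_mem {g : Dist p} {i j : ℕ}
    (h : ∀ a c b, a + c + b ≤ j →
      g * (distE p a * distF p c * distP p (binomInt b)) ∈ distFil p (i + j)) {y : Dist p}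
    (hy : y ∈ distFil p j) : g * y ∈ distFil p (i + j) :=
  distFil_induction (C := fun y => g * y ∈ distFil p (i + j)) h (by simp)
    (fun x y hx hy => by rw [mul_add]; exact add_mem hx hy)
    (fun z x hx => by rw [mul_smul_comm]; exact Submodule.smul_mem _ _ hx) hy

theorem distP_mul_pbw (r : intPoly) (a c : ℕ) (q : intPoly) :
    distP p r * (distE p a * distF p c * distP p q) =
      distE p a * distF p c * distP p (affineInt 1 (2 * a - 2 * c) r * q) := by
  rw [← mul_assoc, ← mul_assoc, distP_mul_distE, mul_assoc (distE p a), distP_mul_distF, map_mul,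
    ← mul_assoc, ← mul_assoc]
  congr 2
  refine distP_congr fun x => ?_
  rw [modVal_affineInt, modVal_affineInt, modVal_affineInt]
  congr 2
  ring

theorem distE_mul_pbw (n a c : ℕ) (q : intPoly) :
    distE p n * (distE p a * distF p c * distP p q) =
      ((n + a).choose n : ZMod p) • (distE p (n + a) * distF p c * distP p q) := by
  rw [← mul_assoc, ← mul_assoc, distE_mul, smul_mul_assoc, smul_mul_assoc]

/-- The critical generator is F^[n]: in the k-th term of Kostant's formula the orders in E and F
drop by k each, while the degree in H grows by at most k. -/
theorem distFil_mul_mem {i j : ℕ} {x y : Dist p} (hx : x ∈ distFil p i) (hy : y ∈ distFil p j) :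
    x * y ∈ distFil p (i + j) := by
  have hE : ∀ n j (y : Dist p), y ∈ distFil p j → distE p n * y ∈ distFil p (n + j) := by
    intro n j y hy
    refine gen_mul_mem (fun a c b h => ?_) hy
    rw [distE_mul_pbw]
    exact Submodule.smul_mem _ _ (pbw_mem_distFil (d := b) (by omega) _ (natDegree_binomPoly_le b))
  have hH : ∀ n j (y : Dist p), y ∈ distFil p j → distP p (binomInt n) * y ∈
      distFil p (n + j) := by
    intro n j y hy
    refine gen_mul_mem (fun a c b h => ?_) hy
    rw [distP_mul_pbw]
    refine pbw_mem_distFil (d := n + b) (by omega) _ (natDegree_mul_le.trans ?_)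
    exact add_le_add (natDegree_affineInt_binomInt_le _ _ _) (natDegree_binomPoly_le b)
  have hF : ∀ n j (y : Dist p), y ∈ distFil p j → distF p n * y ∈ distFil p (n + j) := by
    intro n j y hy
    refine gen_mul_mem (fun a c b h => ?_) hy
    rw [distF_mul_pbw]
    refine sum_mem fun k hk => ?_
    rw [Finset.mem_range] at hk
    split_ifs
    · refine Submodule.smul_mem _ _ (pbw_mem_distFil (d := k + b) (by omega) _
        (natDegree_mul_le.trans ?_))
      exact add_le_add (natDegree_affineInt_binomInt_le _ _ _) (natDegree_binomPoly_le b)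
    · exact zero_mem _
  refine distFil_induction (C := fun x => x * y ∈ distFil p (i + j)) (fun a c b h => ?_) (by simp)
    (fun x y hx hy => by rw [add_mul]; exact add_mem hx hy)
    (fun z x hx => by rw [smul_mul_assoc]; exact Submodule.smul_mem _ _ hx) hx
  rw [mul_assoc, mul_assoc]
  exact distFil_mono (by omega) (hE a _ _ (hF c _ _ (hH b _ _ hy)))

/-- Distributions of order `< n`. -/
def distLow (p : ℕ) : ℕ → Submodule (ZMod p) (Dist p)
  | 0 => ⊥
  | n + 1 => distFil p n

omit [Fact p.Prime] in
theorem distLow_mono : Monotone (distLow p) := by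
  intro m n h
  cases m with
  | zero => exact bot_le
  | succ m =>
    obtain ⟨n, rfl⟩ : ∃ n', n = n' + 1 := ⟨n - 1, by omega⟩
    exact distFil_mono (by omega)

theorem mul_distLow_mem {i j : ℕ} {x y : Dist p} (hx : x ∈ distFil p i) (hy : y ∈ distLow p j) :
    x * y ∈ distLow p (i + j) := by
  cases j with
  | zero => rw [(Submodule.mem_bot _).1 hy, mul_zero]; exact zero_mem _
  | succ j => exact distFil_mul_mem hx hy

theorem distLow_mul_mem {i j : ℕ} {x y : Dist p} (hx : x ∈ distLow p i) (hy : y ∈ distFil p j) :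
    x * y ∈ distLow p (i + j) := by
  cases i with
  | zero => rw [(Submodule.mem_bot _).1 hx, zero_mul]; exact zero_mem _
  | succ i => rw [Nat.succ_add]; exact distFil_mul_mem hx hy

omit [Fact p.Prime] in
theorem mem_distLow_of_lt {i n : ℕ} (h : i < n) {x : Dist p} (hx : x ∈ distFil p i) :
    x ∈ distLow p n := by
  obtain ⟨n, rfl⟩ : ∃ n', n = n' + 1 := ⟨n - 1, by omega⟩
  exact distFil_mono (by omega) hx

theorem comm_mul_mem {i j j' : ℕ} {x y y' : Dist p} (hy : y ∈ distFil p j)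
    (hy' : y' ∈ distFil p j') (h : x * y - y * x ∈ distLow p (i + j))
    (h' : x * y' - y' * x ∈ distLow p (i + j')) :
    x * (y * y') - y * y' * x ∈ distLow p (i + (j + j')) := by
  have e : x * (y * y') - y * y' * x = (x * y - y * x) * y' + y * (x * y' - y' * x) := by
    simp only [mul_sub, sub_mul, mul_assoc]
    abel
  rw [e]
  refine add_mem ?_ ?_
  · have := distLow_mul_mem h hy'
    rwa [add_assoc] at this
  · have := mul_distLow_mem hy h'
    rwa [add_left_comm] at this

theorem comm_symm {n : ℕ} {x y : Dist p} (h : x * y - y * x ∈ distLow p n) :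
    y * x - x * y ∈ distLow p n := by
  rw [← neg_sub]; exact neg_mem h

theorem distH_comm_distE (b a : ℕ) :
    distH p b * distE p a - distE p a * distH p b ∈ distLow p (b + a) := by
  rw [distH_mul_distE, Finset.sum_range_succ, Nat.sub_self, binomMod_zero, one_smul,
    add_sub_cancel_right]
  refine sum_mem fun t ht => Submodule.smul_mem _ _ ?_
  rw [Finset.mem_range] at ht
  exact mem_distLow_of_lt (by omega) (distFil_mul_mem (distE_mem a) (distH_mem t))

theorem distH_comm_distF (b c : ℕ) :
    distH p b * distF p c - distF p c * distH p b ∈ distLow p (b + c) := by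
  rw [distH_mul_distF, Finset.sum_range_succ, Nat.sub_self, binomMod_zero, one_smul,
    add_sub_cancel_right]
  refine sum_mem fun t ht => Submodule.smul_mem _ _ ?_
  rw [Finset.mem_range] at ht
  exact mem_distLow_of_lt (by omega) (distFil_mul_mem (distF_mem c) (distH_mem t))

theorem distF_comm_distE (n a : ℕ) :
    distF p n * distE p a - distE p a * distF p n ∈ distLow p (n + a) := by
  have h := distF_mul_pbw (p := p) n a 0 1
  simp only [map_one, distF_zero, mul_one] at h
  rw [h, Finset.sum_range_succ']
  simp only [Nat.zero_le, if_true, Nat.sub_zero, add_zero, Nat.choose_self, Nat.cast_one, one_smul]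
  have e : distP p (affineInt (-1) (n - a + 2 * ((0 : ℕ) : ℤ)) (binomInt 0)) = 1 := by
    rw [← map_one (distP p)]
    refine distP_congr fun x => ?_
    rw [modVal_affineInt, modVal_binomInt, binomMod_zero, map_one]
  rw [e, mul_one, add_sub_cancel_right]
  refine sum_mem fun k hk => ?_
  rw [Finset.mem_range] at hk
  split_ifs
  · exact mem_distLow_of_lt (i := n + a - (k + 1)) (n := n + a) (by omega)
      (pbw_mem_distFil (d := k + 1) (by omega) _ (natDegree_affineInt_binomInt_le _ _ _))
  · exact zero_mem _

/-- A commutator is a derivation in each variable, so pairs of generators suffice. `reduce` passes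
from generators to arbitrary elements in the second variable and is used twice, with the variables
exchanged in between. -/
theorem distFil_comm {i j : ℕ} {x y : Dist p} (hx : x ∈ distFil p i) (hy : y ∈ distFil p j) :
    x * y - y * x ∈ distLow p (i + j) := by
  have zero_of : ∀ {n : ℕ} {x y : Dist p}, x * y = y * x → x * y - y * x ∈ distLow p n :=
    fun h => by rw [h, sub_self]; exact zero_mem _
  have hEE : ∀ a b, distE p a * distE p b = distE p b * distE p a := fun a b => by
    rw [distE_mul, distE_mul, add_comm b a, Nat.choose_symm_add]
  have hFF : ∀ a b, distF p a * distF p b = distF p b * distF p a := fun a b => by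
    rw [distF_mul, distF_mul, add_comm b a, Nat.choose_symm_add]
  have hHH : ∀ a b, distH p a * distH p b = distH p b * distH p a := fun a b => by
    rw [distH_eq, distH_eq, ← map_mul, ← map_mul, mul_comm]
  have reduce : ∀ {i : ℕ} {x : Dist p},
      (∀ a, x * distE p a - distE p a * x ∈ distLow p (i + a)) →
      (∀ a, x * distF p a - distF p a * x ∈ distLow p (i + a)) →
      (∀ a, x * distH p a - distH p a * x ∈ distLow p (i + a)) →
      ∀ {j : ℕ} {y : Dist p}, y ∈ distFil p j → x * y - y * x ∈ distLow p (i + j) := by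
    intro i x hE hF hH j y hy
    refine distFil_induction (C := fun y => x * y - y * x ∈ distLow p (i + j)) (fun a c b h => ?_)
      (by simp) (fun y z hy hz => ?_) (fun z y hy => ?_) hy
    · rw [← distH_eq]
      exact distLow_mono (by omega) (comm_mul_mem (distFil_mul_mem (distE_mem a) (distF_mem c))
        (distH_mem b) (comm_mul_mem (distE_mem a) (distF_mem c) (hE a) (hF c)) (hH b))
    · rw [mul_add, add_mul, add_sub_add_comm]; exact add_mem hy hz
    · rw [mul_smul_comm, smul_mul_assoc, ← smul_sub]; exact Submodule.smul_mem _ _ hy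
  have right : ∀ {j : ℕ} {y : Dist p}, y ∈ distFil p j →
      (∀ a, y * distE p a - distE p a * y ∈ distLow p (j + a)) ∧
      (∀ a, y * distF p a - distF p a * y ∈ distLow p (j + a)) ∧
      (∀ a, y * distH p a - distH p a * y ∈ distLow p (j + a)) := by
    intro j y hy
    refine ⟨fun a => ?_, fun a => ?_, fun a => ?_⟩ <;> apply comm_symm <;> rw [add_comm j a]
    · exact reduce (fun b => zero_of (hEE a b)) (fun b => by
        rw [add_comm]; exact comm_symm (distF_comm_distE b a)) (fun b => by
        rw [add_comm]; exact comm_symm (distH_comm_distE b a)) hy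
    · exact reduce (fun b => distF_comm_distE a b) (fun b => zero_of (hFF a b)) (fun b => by
        rw [add_comm]; exact comm_symm (distH_comm_distF b a)) hy
    · exact reduce (fun b => distH_comm_distE a b) (fun b => distH_comm_distF a b)
        (fun b => zero_of (hHH a b)) hy
  exact reduce (right hx).1 (right hx).2.1 (right hx).2.2 hy

theorem isAlmostCommFiltration_distFil : IsAlmostCommFiltration (distFil p) where
  mono := distFil_mono
  one_mem := by simpa using distE_mem (p := p) 0
  mul_mem := distFil_mul_mem
  comm_mem hx hy h := distLow_mono h (distFil_comm hx hy)

/-- Up to lower order, a product of two ordered monomials is an ordered monomial times three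
binomials. `exists_parts_of_lt` cuts a given monomial so that these binomials are units; the lower
terms are covered by induction on n. -/
theorem splitsAt_distFil (m : ℕ) : SplitsAt (distFil p) (p ^ m) := by
  have hq : 0 < p ^ m := pow_pos (Nat.Prime.pos Fact.out) m
  have hF := isAlmostCommFiltration_distFil (p := p)
  intro n hn hn'
  induction n using Nat.strong_induction_on with
  | _ n ih =>
  have lower : ∀ l < n, distFil p l ≤ distFil p (p ^ m) * distFil p (n - p ^ m) := by
    intro l hl
    rcases le_or_gt (p ^ m) l with h | h
    · exact (ih l hl h (by omega)).trans (mul_le_mul' le_rfl (distFil_mono (by omega)))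
    · intro x hx
      rw [← mul_one x]
      exact Submodule.mul_mem_mul (distFil_mono h.le hx) (distFil_mono (Nat.zero_le _) hF.one_mem)
  have low : distLow p n ≤ distFil p (p ^ m) * distFil p (n - p ^ m) := by
    obtain ⟨n, rfl⟩ : ∃ n', n = n' + 1 := ⟨n - 1, by omega⟩
    exact lower n (by omega)
  intro x hx
  refine distFil_induction (C := fun x => x ∈ distFil p (p ^ m) * distFil p (n - p ^ m))
    (fun a c b h => ?_) (zero_mem _) (fun _ _ => add_mem)
    (fun z _ => Submodule.smul_mem _ z) hx
  rcases h.lt_or_eq with h | h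
  · exact lower _ h (pbw_mem_distFil (d := b) le_rfl _ (natDegree_binomPoly_le b))
  obtain ⟨a', ha, c', hc, b', hb, hs, h1, h2, h3⟩ :=
    exists_parts_of_lt (p := p) (m := m) (a := a) (b := c) (c := b) (by omega) (by omega)
  obtain ⟨a'', rfl⟩ := Nat.exists_eq_add_of_le ha
  obtain ⟨b'', rfl⟩ := Nat.exists_eq_add_of_le hb
  obtain ⟨c'', rfl⟩ := Nat.exists_eq_add_of_le hc
  have hu : distE p a' * distF p c' * distH p b' ∈ distFil p (p ^ m) :=
    distFil_mono (by omega) (hF.mul_mem (hF.mul_mem (distE_mem a') (distF_mem c')) (distH_mem b'))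
  have hv : distE p a'' * distF p c'' * distH p b'' ∈ distFil p (n - p ^ m) :=
    distFil_mono (by omega)
      (hF.mul_mem (hF.mul_mem (distE_mem a'') (distF_mem c'')) (distH_mem b''))
  have hH : distH p b' * distH p b'' - ((b' + b'').choose b' : ZMod p) • distH p (b' + b'') ∈
      distLow p (b' + b'') := by
    rw [distH_mul, Finset.sum_range_succ, Nat.sub_self, binomMod_zero, one_mul,
      add_sub_cancel_right]
    refine sum_mem fun t ht => Submodule.smul_mem _ _ ?_
    rw [Finset.mem_range] at ht
    exact mem_distLow_of_lt (by omega) (distH_mem _)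
  have c1 := distFil_comm (hF.mul_mem (distF_mem c') (distH_mem b')) (distE_mem (p := p) a'')
  have c2 := distH_comm_distF (p := p) b' c''
  -- The corrections come from moving E^[a''] to the left, from moving F^[c''] across C(H, b'), and
  -- from the lower terms of C(H, b') C(H, b'').
  have e : ((a' + a'').choose a' * (c' + c'').choose c' * (b' + b'').choose b' : ZMod p) •
      (distE p (a' + a'') * distF p (c' + c'') * distH p (b' + b'')) =
      distE p a' * distF p c' * distH p b' * (distE p a'' * distF p c'' * distH p b'') -
      (distE p a' * (distF p c' * distH p b' * distE p a'' -
          distE p a'' * (distF p c' * distH p b')) * (distF p c'' * distH p b'') +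
        distE p a' * distE p a'' * distF p c' *
          (distH p b' * distF p c'' - distF p c'' * distH p b') * distH p b'' +
        distE p a' * distE p a'' * (distF p c' * distF p c'') * (distH p b' * distH p b'' -
          ((b' + b'').choose b' : ZMod p) • distH p (b' + b''))) := by
    have e1 : ((a' + a'').choose a' * (c' + c'').choose c' * (b' + b'').choose b' : ZMod p) •
        (distE p (a' + a'') * distF p (c' + c'') * distH p (b' + b'')) =
        distE p a' * distE p a'' * (distF p c' * distF p c'') *
          (((b' + b'').choose b' : ZMod p) • distH p (b' + b'')) := by
      rw [distE_mul, distF_mul, smul_mul_smul_comm, smul_mul_smul_comm]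
    rw [e1]
    generalize ((b' + b'').choose b' : ZMod p) • distH p (b' + b'') = z
    simp only [mul_sub, sub_mul, mul_assoc]
    abel
  have hne : ((a' + a'').choose a' * (c' + c'').choose c' * (b' + b'').choose b' : ZMod p) ≠ 0 :=
    mul_ne_zero (mul_ne_zero h1 h2) h3
  rw [← distH_eq, ← inv_smul_smul₀ hne (distE p _ * distF p _ * distH p _)]
  refine Submodule.smul_mem _ _ ?_
  rw [e]
  refine sub_mem (Submodule.mul_mem_mul hu hv) (low (add_mem (add_mem ?_ ?_) ?_))
  · exact distLow_mono (by omega) (distLow_mul_mem (mul_distLow_mem (distE_mem a') c1)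
      (hF.mul_mem (distF_mem c'') (distH_mem b'')))
  · exact distLow_mono (by omega) (distLow_mul_mem (mul_distLow_mem
      (hF.mul_mem (hF.mul_mem (distE_mem a') (distE_mem a'')) (distF_mem c')) c2) (distH_mem b''))
  · exact distLow_mono (by omega) (mul_distLow_mem (hF.mul_mem
      (hF.mul_mem (distE_mem a') (distE_mem a'')) (hF.mul_mem (distF_mem c') (distF_mem c''))) hH)

end DistFil
end
end SL2Frobenius

namespace SL2Frobenius

noncomputable section

/-! ### The Frobenius splitting of the distribution algebra -/

section DistSplitting

variable {p : ℕ} [Fact p.Prime]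

/-- Modulo `p`, the values of `r` are those of `q (x / p)` at the multiples of `p`, and zero
elsewhere. -/
structure IsFrobLift (p : ℕ) (q r : intPoly) : Prop where
  mul_prime : ∀ x, modVal p (x * p) r = modVal p x q
  eq_zero : ∀ x, ¬ (p : ℤ) ∣ x → modVal p x r = 0

/-- The polynomial in `H` defining `Δ_T`. -/
def normInt (p : ℕ) : intPoly := ∑ i ∈ Finset.range p, (-1) ^ i * binomInt i

theorem modVal_normInt (x : ℤ) : modVal p x (normInt p) = if (p : ℤ) ∣ x then 1 else 0 := by
  rw [normInt, map_sum, ← sum_binomMod]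
  exact Finset.sum_congr rfl fun i _ => by rw [map_mul, map_pow, map_neg, map_one, modVal_binomInt]

omit [Fact p.Prime] in
theorem normT_eq : normT p = distP p (normInt p) := by
  rw [normT, normInt, map_sum]
  exact Finset.sum_congr rfl fun i _ => by
    rw [map_mul, map_pow, map_neg, map_one, distH_eq]

theorem isFrobLift_one : IsFrobLift p 1 (normInt p) where
  mul_prime x := by rw [modVal_normInt, if_pos (dvd_mul_left _ _), map_one]
  eq_zero x h := by rw [modVal_normInt, if_neg h]

-- Only the values of r' at multiples of p matter, because r vanishes mod p elsewhere.
omit [Fact p.Prime] in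
theorem IsFrobLift.mul_left {q r q' r' : intPoly} (h : IsFrobLift p q r)
    (h' : ∀ x, modVal p (x * p) r' = modVal p x q') : IsFrobLift p (q' * q) (r' * r) where
  mul_prime x := by rw [map_mul, map_mul, h.mul_prime, h']
  eq_zero x hx := by rw [map_mul, h.eq_zero x hx, mul_zero]

theorem isFrobLift_binomInt (b : ℕ) :
    IsFrobLift p (binomInt b) (binomInt (b * p) * normInt p) := by
  have := (isFrobLift_one (p := p)).mul_left (q' := binomInt b) (r' := binomInt (b * p)) fun x => by
    rw [modVal_binomInt, modVal_binomInt, binomMod_mul_prime]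
  rwa [mul_one] at this

omit [Fact p.Prime] in
theorem IsFrobLift.add {q r q' r' : intPoly} (h : IsFrobLift p q r) (h' : IsFrobLift p q' r') :
    IsFrobLift p (q + q') (r + r') where
  mul_prime x := by rw [map_add, map_add, h.mul_prime, h'.mul_prime]
  eq_zero x hx := by rw [map_add, h.eq_zero x hx, h'.eq_zero x hx, add_zero]

omit [Fact p.Prime] in
theorem IsFrobLift.zsmul {q r : intPoly} (h : IsFrobLift p q r) (z : ℤ) :
    IsFrobLift p (z • q) (z • r) where
  mul_prime x := by rw [map_zsmul, map_zsmul, h.mul_prime]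
  eq_zero x hx := by rw [map_zsmul, h.eq_zero x hx, smul_zero]

omit [Fact p.Prime] in
theorem isFrobLift_zero : IsFrobLift p 0 0 := ⟨fun x => by simp, fun x _ => by simp⟩

omit [Fact p.Prime] in
/-- Frobenius lifts have determined values modulo `p`. -/
theorem IsFrobLift.modVal_eq {q r r' : intPoly} (h : IsFrobLift p q r) (h' : IsFrobLift p q r')
    (x : ℤ) : modVal p x r = modVal p x r' := by
  by_cases hx : (p : ℤ) ∣ x
  · obtain ⟨y, rfl⟩ := hx
    rw [mul_comm, h.mul_prime, h'.mul_prime]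
  · rw [h.eq_zero x hx, h'.eq_zero x hx]

/-- The endomorphism `E^[a] F^[c] binom(H, b) ↦ E^[ap] F^[cp] binom(H, bp) Δ_T`. -/
def frobDistLin (p : ℕ) [Fact p.Prime] : Dist p →ₗ[ZMod p] Dist p :=
  (distBasis p).constr (ZMod p) fun i =>
    distE p (i.1 * p) * distF p (i.2.1 * p) * distP p (binomInt (i.2.2 * p) * normInt p)

theorem frobDistLin_basis (a c b : ℕ) :
    frobDistLin p (distE p a * distF p c * distP p (binomInt b)) =
      distE p (a * p) * distF p (c * p) * distP p (binomInt (b * p) * normInt p) := by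
  rw [← distBasis_apply (a, c, b), frobDistLin, Module.Basis.constr_basis]

/-- By linearity some lift of q satisfies the formula, and any two lifts have the same values mod p,
so every lift may be used. -/
theorem frobDistLin_pbw (a c : ℕ) {q r : intPoly} (h : IsFrobLift p q r) :
    frobDistLin p (distE p a * distF p c * distP p q) =
      distE p (a * p) * distF p (c * p) * distP p r := by
  obtain ⟨r', hr', e⟩ : ∃ r', IsFrobLift p q r' ∧
      frobDistLin p (distE p a * distF p c * distP p q) =
        distE p (a * p) * distF p (c * p) * distP p r' := by
    refine intPoly_induction (d := q.1.natDegree) (C := fun q => ∃ r', IsFrobLift p q r' ∧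
      frobDistLin p (distE p a * distF p c * distP p q) =
        distE p (a * p) * distF p (c * p) * distP p r')
      ⟨0, isFrobLift_zero, by simp⟩ (fun b _ => ⟨_, isFrobLift_binomInt b, frobDistLin_basis a c b⟩)
      ?_ ?_ q le_rfl
    · rintro q q' ⟨r, h, e⟩ ⟨r', h', e'⟩
      exact ⟨_, h.add h', by rw [map_add, mul_add, map_add, e, e', map_add, mul_add]⟩
    · rintro z q ⟨r, h, e⟩
      exact ⟨_, h.zsmul z, by
        rw [distP_zsmul, mul_smul_comm, map_smul, e, distP_zsmul, mul_smul_comm]⟩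
  rw [e, distP_congr (hr'.modVal_eq h)]

/-- Two linear maps agree if they do on ordered monomials. -/
theorem dist_linearMap_ext {f g : Dist p →ₗ[ZMod p] Dist p}
    (h : ∀ a c b, f (distE p a * distF p c * distP p (binomInt b)) =
      g (distE p a * distF p c * distP p (binomInt b))) : f = g :=
  (distBasis p).ext fun i => by rw [distBasis_apply]; exact h _ _ _

/-- Multiplicativity of Frobenius is checked for left multiplication by E^[n], by polynomials in H
and by F^[n]. For E^[n] it amounts to C((n + a)p, np) = C(n + a, n) mod p. -/
theorem frobDistLin_distE_mul (n : ℕ) (y : Dist p) :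
    frobDistLin p (distE p n * y) = distE p (n * p) * frobDistLin p y := by
  have hp : 0 < p := Nat.Prime.pos Fact.out
  suffices frobDistLin p ∘ₗ LinearMap.mulLeft _ (distE p n) =
      LinearMap.mulLeft _ (distE p (n * p)) ∘ₗ frobDistLin p from LinearMap.congr_fun this y
  refine dist_linearMap_ext fun a c b => ?_
  simp only [LinearMap.comp_apply, LinearMap.mulLeft_apply]
  rw [distE_mul_pbw, map_smul, frobDistLin_basis, frobDistLin_basis, distE_mul_pbw, ← add_mul]
  congr 1
  simpa using (lucas_digits (p := p) (n + a) n hp hp).symm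

theorem frobDistLin_distP_mul {q' r' : intPoly} (h : ∀ x, modVal p (x * p) r' = modVal p x q')
    (y : Dist p) : frobDistLin p (distP p q' * y) = distP p r' * frobDistLin p y := by
  suffices frobDistLin p ∘ₗ LinearMap.mulLeft _ (distP p q') =
      LinearMap.mulLeft _ (distP p r') ∘ₗ frobDistLin p from LinearMap.congr_fun this y
  refine dist_linearMap_ext fun a c b => ?_
  simp only [LinearMap.comp_apply, LinearMap.mulLeft_apply]
  rw [distP_mul_pbw, frobDistLin_basis, distP_mul_pbw]
  refine frobDistLin_pbw a c ((isFrobLift_binomInt b).mul_left fun x => ?_)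
  rw [modVal_affineInt, modVal_affineInt, ← h]
  congr 2
  push_cast
  ring

theorem sum_range_mul_add_one {M : Type*} [AddCommMonoid M] {q : ℕ} (hq : 0 < q) (n : ℕ)
    (f : ℕ → M) (hf : ∀ k, ¬ q ∣ k → f k = 0) :
    ∑ k ∈ Finset.range (n * q + 1), f k = ∑ k ∈ Finset.range (n + 1), f (k * q) := by
  rw [← Finset.sum_image (s := Finset.range (n + 1)) (g := fun k => k * q) (f := f)
    fun a _ b _ h => Nat.eq_of_mul_eq_mul_right hq h]
  symm
  refine Finset.sum_subset ?_ fun k hk hk' => hf k ?_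
  · intro k hk
    simp only [Finset.mem_image, Finset.mem_range] at hk ⊢
    obtain ⟨l, hl, rfl⟩ := hk
    exact Nat.lt_succ_of_le (Nat.mul_le_mul_right _ (by omega))
  · rintro ⟨l, rfl⟩
    refine hk' (Finset.mem_image.2 ⟨l, ?_, mul_comm _ _⟩)
    rw [Finset.mem_range] at hk ⊢
    have : q * l ≤ q * n := by rw [mul_comm q n]; omega
    exact Nat.lt_succ_of_le (Nat.le_of_mul_le_mul_left this hq)

/-- The factor Δ_T restricts polynomials in H to multiples of p, and there the binomial in the k-th
term of Kostant's formula for np, ap, cp vanishes unless p ∣ k. The terms with index kp match those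
of the formula for n, a, c by Lucas. -/
theorem frobDistLin_distF_mul (n : ℕ) (y : Dist p) :
    frobDistLin p (distF p n * y) = distF p (n * p) * frobDistLin p y := by
  have hp : 0 < p := Nat.Prime.pos Fact.out
  suffices frobDistLin p ∘ₗ LinearMap.mulLeft _ (distF p n) =
      LinearMap.mulLeft _ (distF p (n * p)) ∘ₗ frobDistLin p from LinearMap.congr_fun this y
  refine dist_linearMap_ext fun a c b => ?_
  simp only [LinearMap.comp_apply, LinearMap.mulLeft_apply]
  have key : ∀ k : ℕ, ∀ x : ℤ, modVal p (x * p)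
      (affineInt (-1) ((n * p : ℕ) - (a * p : ℕ) + 2 * (c * p : ℕ)) (binomInt k)) =
        binomMod p ((-1 * x + (n - a + 2 * c)) * p) k := by
    intro k x
    rw [modVal_affineInt, modVal_binomInt]
    congr 1
    push_cast
    ring
  rw [distF_mul_pbw, frobDistLin_basis, distF_mul_pbw, sum_range_mul_add_one hp, map_sum]
  · refine Finset.sum_congr rfl fun k hk => ?_
    rw [Finset.mem_range] at hk
    by_cases hka : k ≤ a
    · rw [if_pos hka, if_pos (Nat.mul_le_mul_right _ hka), map_smul]
      rw [frobDistLin_pbw _ _ ((isFrobLift_binomInt b).mul_left fun x => ?_), ← Nat.sub_mul,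
        ← Nat.sub_mul, ← add_mul]
      · congr 1
        simpa using (lucas_digits (p := p) (n - k + c) (n - k) hp hp).symm
      · rw [key, binomMod_mul_prime, modVal_affineInt, modVal_binomInt]
    · rw [if_neg hka, if_neg (fun h => hka (Nat.le_of_mul_le_mul_right h hp)), map_zero]
  · intro k hk
    split_ifs
    · rw [distP_eq_zero, mul_zero, smul_zero]
      intro x
      by_cases hx : (p : ℤ) ∣ x
      · obtain ⟨x, rfl⟩ := hx
        rw [mul_comm (p : ℤ) x, map_mul, key, binomMod_mul_prime_eq_zero _ hk, zero_mul]
      · rw [map_mul, (isFrobLift_binomInt b).eq_zero x hx, mul_zero]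
    · rfl

/-- The non-unital endomorphism `E^[i] ↦ E^[ip] Δ_T`, `F^[i] ↦ F^[ip] Δ_T`,
`binom(H, i) ↦ binom(H, ip) Δ_T` of the distribution algebra. -/
def frobDist (p : ℕ) [Fact p.Prime] : Dist p →ₙₐ[ZMod p] Dist p where
  toFun := frobDistLin p
  map_smul' c x := map_smul _ c x
  map_zero' := map_zero _
  map_add' := map_add _
  map_mul' x y := by
    suffices frobDistLin p ∘ₗ LinearMap.mulRight _ y =
        LinearMap.mulRight _ (frobDistLin p y) ∘ₗ frobDistLin p from LinearMap.congr_fun this x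
    refine dist_linearMap_ext fun a c b => ?_
    simp only [LinearMap.comp_apply, LinearMap.mulRight_apply]
    rw [mul_assoc, mul_assoc, frobDistLin_distE_mul, frobDistLin_distF_mul,
      frobDistLin_distP_mul (isFrobLift_binomInt b).mul_prime, frobDistLin_basis, mul_assoc,
      mul_assoc]

theorem frobDist_pbw (a c : ℕ) {q r : intPoly} (h : IsFrobLift p q r) :
    frobDist p (distE p a * distF p c * distP p q) =
      distE p (a * p) * distF p (c * p) * distP p r := frobDistLin_pbw a c h

theorem isSplitting_frobDist : IsSplitting p (frobDist p) where
  map_E i := by simpa [normT_eq] using frobDist_pbw i 0 (isFrobLift_one (p := p))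
  map_F i := by simpa [normT_eq] using frobDist_pbw 0 i (isFrobLift_one (p := p))
  map_H i := by simpa [normT_eq, distH_eq] using frobDist_pbw 0 0 (isFrobLift_binomInt (p := p) i)

theorem IsSplitting.eq_on {φ φ' : Dist p →ₙₐ[ZMod p] Dist p} (h : IsSplitting p φ)
    (h' : IsSplitting p φ') (x : Dist p) : φ x = φ' x := by
  suffices (φ : Dist p →ₗ[ZMod p] Dist p) = (φ' : Dist p →ₗ[ZMod p] Dist p) from
    LinearMap.congr_fun this x
  refine dist_linearMap_ext fun a c b => ?_
  change φ _ = φ' _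
  rw [← distH_eq]
  simp only [map_mul, h.map_E, h.map_F, h.map_H, h'.map_E, h'.map_F, h'.map_H]

theorem frobDist_one : frobDist p 1 = normT p := by
  simpa using (isSplitting_frobDist (p := p)).map_E 0

/-- E^[ap] and F^[cp] shift H by multiples of p, which does not affect the divisibility detected by
Δ_T. -/
theorem normT_comm_pbw (a c : ℕ) (q : intPoly) :
    normT p * (distE p (a * p) * distF p (c * p) * distP p q) =
      distE p (a * p) * distF p (c * p) * distP p q * normT p := by
  rw [normT_eq, distP_mul_pbw, mul_assoc _ (distP p q), ← map_mul]
  congr 1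
  refine distP_congr fun x => ?_
  rw [map_mul, map_mul, modVal_affineInt, modVal_normInt, modVal_normInt, mul_comm]
  congr 2
  have : (1 * x + (2 * ((a * p : ℕ) : ℤ) - 2 * ((c * p : ℕ) : ℤ))) = x + p * (2 * a - 2 * c) := by
    push_cast; ring
  rw [this, eq_iff_iff]
  exact (dvd_add_left (dvd_mul_right _ _))

theorem binomInt_mul_normT_eq_zero {b : ℕ} (hb : ¬ p ∣ b) :
    distP p (binomInt b) * normT p = 0 := by
  rw [normT_eq, ← map_mul]
  refine distP_eq_zero fun x => ?_
  rw [map_mul, modVal_normInt, modVal_binomInt]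
  split_ifs with h
  · obtain ⟨y, rfl⟩ := h
    rw [mul_comm (p : ℤ), binomMod_mul_prime_eq_zero _ hb, zero_mul]
  · rw [mul_zero]

theorem distP_binomInt_mul_prime_add (b : ℕ) {r : ℕ} (hr : r < p) :
    distP p (binomInt (b * p + r)) = distP p (binomInt (b * p)) * distP p (binomInt r) := by
  rw [← map_mul]
  refine distP_congr fun x => ?_
  rw [map_mul, modVal_binomInt, modVal_binomInt, modVal_binomInt, binomMod_mul_add x b hr]

theorem neg_one_pow_mul_eq_smul (i : ℕ) (x : Dist p) : (-1) ^ i * x = (-1 : ZMod p) ^ i • x := by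
  have h : (-1 : Dist p) ^ i = distP p (((-1) ^ i : ℤ) • 1) := by
    rw [zsmul_one, Int.cast_pow, map_pow, Int.cast_neg, Int.cast_one, map_neg, map_one]
  rw [h, distP_zsmul, map_one, smul_one_mul]
  push_cast
  rfl

/-- The coefficients of `binom(H, b)` with `p ∣ b` survive multiplication by `Δ_T`. -/
theorem repr_mul_normT (w : Dist p) (a c b : ℕ) :
    (distBasis p).repr (w * normT p) (a, c, b * p) = (distBasis p).repr w (a, c, b * p) := by
  have hp : 0 < p := Nat.Prime.pos Fact.out
  suffices Finsupp.lapply (a, c, b * p) ∘ₗ (distBasis p).repr.toLinearMap ∘ₗ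
      LinearMap.mulRight (ZMod p) (normT p) =
      Finsupp.lapply (a, c, b * p) ∘ₗ (distBasis p).repr.toLinearMap from
    LinearMap.congr_fun this w
  refine (distBasis p).ext fun i => ?_
  obtain ⟨a', c', b'⟩ := i
  simp only [LinearMap.comp_apply, LinearMap.mulRight_apply, LinearEquiv.coe_coe,
    Finsupp.lapply_apply, Module.Basis.repr_self]
  -- For p ∣ b', multiplication by Δ_T gives a signed sum of basis elements with last index b' + i,
  -- i < p, and only i = 0 yields a multiple of p. For p ∤ b' the product is zero.
  by_cases hb : p ∣ b'
  · obtain ⟨b', rfl⟩ := hb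
    rw [mul_comm p b']
    have e : distBasis p (a', c', b' * p) * normT p =
        ∑ i ∈ Finset.range p, (-1 : ZMod p) ^ i • distBasis p (a', c', b' * p + i) := by
      rw [distBasis_apply, normT, Finset.mul_sum]
      refine Finset.sum_congr rfl fun i hi => ?_
      rw [Finset.mem_range] at hi
      rw [distBasis_apply, distP_binomInt_mul_prime_add b' hi, distH_eq]
      rw [neg_one_pow_mul_eq_smul, mul_smul_comm, mul_assoc]
    rw [e, map_sum, Finsupp.finsetSum_apply, Finset.sum_eq_single 0]
    · simp
    · intro i hi hi0
      rw [Finset.mem_range] at hi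
      rw [map_smul, Module.Basis.repr_self, Finsupp.smul_apply, Finsupp.single_eq_of_ne, smul_zero]
      intro h
      simp only [Prod.mk.injEq] at h
      have := congrArg (· % p) h.2.2
      simp [Nat.mod_eq_of_lt hi] at this
      omega
    · simp [hp.ne']
  · rw [distBasis_apply, mul_assoc, binomInt_mul_normT_eq_zero hb, mul_zero, map_zero,
      Finsupp.single_eq_of_ne]
    · rfl
    · intro h
      simp only [Prod.mk.injEq] at h
      exact hb (h.2.2 ▸ dvd_mul_left _ _)

theorem normT_mem : normT p ∈ distFil p (p - 1) := by
  refine sum_mem fun i hi => ?_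
  rw [Finset.mem_range] at hi
  rw [neg_one_pow_mul_eq_smul]
  exact Submodule.smul_mem _ _ (distFil_mono (by omega) (distH_mem i))

/-- By `repr_mul_normT`, an element annihilated by Δ_T on the right only involves C(H, b) with p ∤
b. For b = qp + r this is C(H, qp) C(H, r), and C(H, r) Δ_T = 0 because 0 < r < p. -/
theorem isFrobeniusSplitting_frobDist (m : ℕ) :
    IsFrobeniusSplitting (distFil p) p m (frobDist p) where
  one_mem := by rw [frobDist_one]; exact normT_mem
  exists_lift n x hx := by
    rw [frobDist_one]
    refine distFil_induction (C := fun x => ∃ y ∈ distFil p (n * p), y * normT p = frobDist p x ∧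
      normT p * y = frobDist p x) ?_ ⟨0, zero_mem _, by simp, by simp⟩ ?_ ?_ hx
    · intro a c b h
      have e : distE p (a * p) * distF p (c * p) * distP p (binomInt (b * p)) * normT p =
          frobDist p (distE p a * distF p c * distP p (binomInt b)) := by
        rw [frobDist_pbw a c (isFrobLift_binomInt b), map_mul, mul_assoc _ _ (normT p), normT_eq]
      refine ⟨_, pbw_mem_distFil (d := b * p) ?_ (binomInt (b * p)) (natDegree_binomPoly_le _),
        e, ?_⟩
      · rw [← add_mul, ← add_mul]; exact Nat.mul_le_mul_right _ h
      · rw [normT_comm_pbw, e]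
    · rintro x x' ⟨y, hy, h, h'⟩ ⟨z, hz, k, k'⟩
      exact ⟨y + z, add_mem hy hz, by rw [add_mul, map_add, h, k], by rw [mul_add, map_add, h', k']⟩
    · rintro c x ⟨y, hy, h, h'⟩
      exact ⟨c • y, Submodule.smul_mem _ _ hy, by rw [smul_mul_assoc, map_smul, h],
        by rw [mul_smul_comm, map_smul, h']⟩
  mem_of_mul_eq_zero n _ w hw h := by
    have hp : 0 < p := Nat.Prime.pos Fact.out
    rw [frobDist_one] at h ⊢
    rw [distFil_eq, Module.Basis.mem_span_image] at hw
    rw [← (distBasis p).linearCombination_repr w, Finsupp.linearCombination_apply]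
    refine sum_mem fun i hi => Submodule.smul_mem _ _ (Submodule.subset_span ?_)
    obtain ⟨a, c, b⟩ := i
    have hle : a + c + b ≤ n := hw hi
    have hb : ¬ p ∣ b := by
      rintro ⟨b, rfl⟩
      rw [Finsupp.mem_support_iff, mul_comm p b, ← repr_mul_normT, h] at hi
      simp at hi
    have hr := Nat.mod_lt b hp
    have hr0 : b % p ≤ b := Nat.mod_le _ _
    have e := Nat.div_add_mod' b p
    refine ⟨b % p, by omega, by omega, distE p a * distF p c * distP p (binomInt (b / p * p)),
      pbw_mem_distFil (d := b / p * p) (by omega) _ (natDegree_binomPoly_le _),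
      distP p (binomInt (b % p)), distP_mem (natDegree_binomPoly_le _),
      binomInt_mul_normT_eq_zero ?_, ?_⟩
    · rwa [Nat.dvd_mod_iff dvd_rfl]
    · rw [distBasis_apply, mul_assoc _ (distP p _), ← distP_binomInt_mul_prime_add _ hr, e]

theorem exists_isPhi (m : ℕ) : ∃ φ : U p m →ₙₐ[ZMod p] U p (m + 1), IsPhi p m φ := by
  obtain ⟨g, hg⟩ := (isFrobeniusSplitting_frobDist (p := p) (m + 1)).exists_level
    isAlmostCommFiltration_distFil (splitsAt_distFil (m + 1)) (Nat.Prime.pos Fact.out)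
  exact ⟨g, frobDist p, isSplitting_frobDist, fun x => ⟨_, hg x⟩⟩

end DistSplitting
end
end SL2Frobenius

namespace SL2Frobenius

noncomputable section

/-! ### The infinitesimal action on functions -/

section Action

open Polynomial LaurentPolynomial

/-- The operator `t ^ j ↦ c j t ^ (j + s)` on rational Laurent polynomials. -/
def ratShift (c : ℤ → ℚ) (s : ℤ) : Module.End ℚ (ℤ →₀ ℚ) :=
  Finsupp.linearCombination ℚ fun j => c j • Finsupp.single (j + s) 1

theorem ratShift_single (c : ℤ → ℚ) (s j : ℤ) :
    ratShift c s (Finsupp.single j 1) = c j • Finsupp.single (j + s) 1 := by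
  simp [ratShift]

theorem ratEnd_ext {P Q : Module.End ℚ (ℤ →₀ ℚ)}
    (h : ∀ j, P (Finsupp.single j 1) = Q (Finsupp.single j 1)) : P = Q :=
  Finsupp.lhom_ext' fun j => LinearMap.ext_ring (h j)

/-- The triple is ∂_T, ∂_S = -T² ∂_T and 2S ∂_S = -2T ∂_T. -/
theorem exists_ratAction : ∃ Θ : Env →ₐ[ℚ] Module.End ℚ (ℤ →₀ ℚ),
    Θ envE = ratShift (fun j => j) (-1) ∧ Θ envF = ratShift (fun j => -j) 1 ∧
      Θ envH = ratShift (fun j => -2 * j) 0 := by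
  apply exists_envHom <;> refine ratEnd_ext fun j => ?_ <;>
    simp only [LinearMap.sub_apply, LinearMap.neg_apply, LinearMap.smul_apply,
      Module.End.mul_apply, ratShift_single, map_smul, smul_smul] <;>
    simp only [← sub_eq_add_neg, add_sub_cancel_right, sub_add_cancel, add_zero, ← sub_smul,
      ← neg_smul, ← Nat.cast_smul_eq_nsmul ℚ, smul_smul] <;> congr 1 <;> push_cast <;> ring

/-- The action of `sl₂` on rational Laurent polynomials. -/
def ratAction : Env →ₐ[ℚ] Module.End ℚ (ℤ →₀ ℚ) := exists_ratAction.choose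

theorem ratAction_pow (ε : ℤˣ) {x : Env}
    (hx : ratAction x = ratShift (fun j => (ε : ℤ) * j) (-ε)) (n : ℕ) (j : ℤ) :
    ratAction (divPow x n) (Finsupp.single j 1) =
      ((Ring.choose (ε * j : ℤ) n : ℤ) : ℚ) • Finsupp.single (j - ε * n) 1 := by
  have h : ratAction (x ^ n) (Finsupp.single j 1) =
      (descPochhammer ℚ n).eval (ε * j : ℚ) • Finsupp.single (j - ε * n) 1 := by
    induction n with
    | zero => simp
    | succ n ih =>
      rw [pow_succ', map_mul, Module.End.mul_apply, ih, map_smul, hx, ratShift_single, smul_smul,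
        descPochhammer_succ_eval]
      have e : (ε : ℤ) * ε = 1 := by rw [← Units.val_mul, Int.units_mul_self]; rfl
      congr 2
      · push_cast
        have e' : (ε : ℚ) * ε = 1 := by exact_mod_cast e
        linear_combination (-n : ℚ) * e'
      · push_cast; ring
  have h2 := eval_binomPoly n (ε * j)
  rw [binomPoly, eval_smul, smul_eq_mul] at h2
  push_cast at h2
  rw [divPow, map_smul, LinearMap.smul_apply, h, smul_smul, h2]

theorem ratAction_binom (n : ℕ) (j : ℤ) :
    ratAction (binom envH n) (Finsupp.single j 1) =
      ((Ring.choose (-2 * j : ℤ) n : ℤ) : ℚ) • Finsupp.single j 1 := by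
  rw [binom_eq_aeval, ← aeval_algHom_apply, ratAction, exists_ratAction.choose_spec.2.2,
    Module.End.aeval_apply_of_mem_apply_eq_smul (μ := ((-2 * j : ℤ) : ℚ)), eval_binomPoly]
  rw [ratShift_single, add_zero]
  push_cast
  rfl

variable {p : ℕ}

/-- Integral elements inside rational Laurent polynomials. -/
def intIncl : (ℤ →₀ ℤ) →+ (ℤ →₀ ℚ) := Finsupp.mapRange.addMonoidHom (Int.castAddHom ℚ)

theorem intIncl_single (j z : ℤ) : intIncl (Finsupp.single j z) = (z : ℚ) • Finsupp.single j 1 := by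
  simp [intIncl]

theorem intIncl_injective : Function.Injective intIncl :=
  Finsupp.mapRange_injective _ (map_zero _) Int.cast_injective

/-- Reduction modulo `p` of integral Laurent polynomials. -/
def intRed (p : ℕ) : (ℤ →₀ ℤ) →+ L p :=
  (Finsupp.linearCombination ℤ fun j => (T j : L p)).toAddMonoidHom

theorem intRed_single (j z : ℤ) : intRed p (Finsupp.single j z) = (z : ZMod p) • T j := by
  simp [intRed, Int.cast_smul_eq_zsmul]

theorem intRed_surjective : Function.Surjective (intRed p) := by
  intro f
  induction f using LaurentPolynomial.induction_on' with
  | add f g hf hg =>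
    obtain ⟨f, rfl⟩ := hf
    obtain ⟨g, rfl⟩ := hg
    exact ⟨f + g, map_add _ _ _⟩
  | C_mul_T n a =>
    obtain ⟨z, rfl⟩ := ZMod.intCast_surjective a
    exact ⟨Finsupp.single n z, by rw [intRed_single, ← LaurentPolynomial.smul_eq_C_mul]⟩

/-- The element `u` preserves integral Laurent polynomials and reduces to `Q` modulo `p`. -/
def ReducesTo (u : Env) (Q : Module.End (ZMod p) (L p)) : Prop :=
  ∀ f : ℤ →₀ ℤ, ∃ g : ℤ →₀ ℤ, ratAction u (intIncl f) = intIncl g ∧ Q (intRed p f) = intRed p g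

/-- Integral Laurent polynomials embed in the rational ones and surject onto those mod p. Because
the reduction is unique, choosing one for each element of Kostant's form gives an algebra morphism.
-/
theorem ReducesTo.unique {u : Env} {Q Q' : Module.End (ZMod p) (L p)} (h : ReducesTo u Q)
    (h' : ReducesTo u Q') : Q = Q' := by
  refine LinearMap.ext fun f => ?_
  obtain ⟨f, rfl⟩ := intRed_surjective f
  obtain ⟨g, h1, h2⟩ := h f
  obtain ⟨g', h1', h2'⟩ := h' f
  rw [h2, h2', intIncl_injective (h1.symm.trans h1')]

theorem ReducesTo.mul {u v : Env} {P Q : Module.End (ZMod p) (L p)} (h : ReducesTo u P)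
    (h' : ReducesTo v Q) : ReducesTo (u * v) (P * Q) := by
  intro f
  obtain ⟨g, h1, h2⟩ := h' f
  obtain ⟨g', h1', h2'⟩ := h g
  exact ⟨g', by rw [map_mul, Module.End.mul_apply, h1, h1'],
    by rw [Module.End.mul_apply, h2, h2']⟩

theorem ReducesTo.add {u v : Env} {P Q : Module.End (ZMod p) (L p)} (h : ReducesTo u P)
    (h' : ReducesTo v Q) : ReducesTo (u + v) (P + Q) := by
  intro f
  obtain ⟨g, h1, h2⟩ := h f
  obtain ⟨g', h1', h2'⟩ := h' f
  exact ⟨g + g', by rw [map_add, LinearMap.add_apply, h1, h1', map_add],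
    by rw [LinearMap.add_apply, h2, h2', map_add]⟩

theorem reducesTo_intCast (z : ℤ) : ReducesTo (z : Env) (z : Module.End (ZMod p) (L p)) := by
  intro f
  refine ⟨z • f, ?_, ?_⟩
  · rw [map_intCast, map_zsmul]; rfl
  · rw [map_zsmul]; rfl

/-- It is enough to check reductions on monomials. -/
theorem reducesTo_of_single {u : Env} {Q : Module.End (ZMod p) (L p)} {c : ℤ → ℤ} {s : ℤ → ℤ}
    (h : ∀ j, ratAction u (Finsupp.single j 1) = (c j : ℚ) • Finsupp.single (s j) 1)
    (h' : ∀ j, Q (T j) = (c j : ZMod p) • T (s j)) : ReducesTo u Q := by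
  intro f
  induction f using Finsupp.induction_linear with
  | zero => exact ⟨0, by simp, by simp⟩
  | add f f' hf hf' =>
    obtain ⟨g, h1, h2⟩ := hf
    obtain ⟨g', h1', h2'⟩ := hf'
    exact ⟨g + g', by rw [map_add, map_add, h1, h1', map_add],
      by rw [map_add, map_add, h2, h2', map_add]⟩
  | single j z =>
    refine ⟨Finsupp.single (s j) (z * c j), ?_, ?_⟩
    · rw [intIncl_single, map_smul, h, smul_smul, intIncl_single, Int.cast_mul]
    · rw [intRed_single, map_smul, h', smul_smul, intRed_single, Int.cast_mul]

theorem reducesTo_divPow_envE (n : ℕ) : ReducesTo (divPow envE n) (hasse p 1 n) :=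
  reducesTo_of_single (ratAction_pow 1 (by
    rw [ratAction, exists_ratAction.choose_spec.1]; simp) n) (onMonomials_T _)

theorem reducesTo_divPow_envF (n : ℕ) : ReducesTo (divPow envF n) (hasse p (-1) n) :=
  reducesTo_of_single (ratAction_pow (-1) (by
    rw [ratAction, exists_ratAction.choose_spec.2.1]; simp) n) (onMonomials_T _)

theorem reducesTo_binom_envH (n : ℕ) : ReducesTo (binom envH n) (binomEuler p n) :=
  reducesTo_of_single (ratAction_binom n) (onMonomials_T _)

theorem exists_reducesTo (u : kostant) : ∃ Q : Module.End (ZMod p) (L p), ReducesTo u.1 Q := by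
  obtain ⟨u, hu⟩ := u
  induction hu using Algebra.adjoin_induction with
  | mem x hx =>
    rcases hx with (⟨n, rfl⟩ | ⟨n, rfl⟩) | ⟨n, rfl⟩
    · exact ⟨_, reducesTo_divPow_envE n⟩
    · exact ⟨_, reducesTo_divPow_envF n⟩
    · exact ⟨_, reducesTo_binom_envH n⟩
  | algebraMap z => exact ⟨_, by simpa using reducesTo_intCast z⟩
  | add x y _ _ hx hy => exact ⟨_, hx.choose_spec.add hy.choose_spec⟩
  | mul x y _ _ hx hy => exact ⟨_, hx.choose_spec.mul hy.choose_spec⟩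

/-- The action of Kostant's form on Laurent polynomials modulo `p`. -/
def kostantAction (p : ℕ) : kostant →ₐ[ℤ] Module.End (ZMod p) (L p) where
  toFun u := (exists_reducesTo u).choose
  map_one' := (exists_reducesTo _).choose_spec.unique (by simpa using reducesTo_intCast 1)
  map_mul' u v := (exists_reducesTo _).choose_spec.unique
    ((exists_reducesTo u).choose_spec.mul (exists_reducesTo v).choose_spec)
  map_zero' := (exists_reducesTo _).choose_spec.unique (by simpa using reducesTo_intCast 0)
  map_add' u v := (exists_reducesTo _).choose_spec.unique
    ((exists_reducesTo u).choose_spec.add (exists_reducesTo v).choose_spec)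
  commutes' z := (exists_reducesTo _).choose_spec.unique (by simpa using reducesTo_intCast z)

theorem kostantAction_eq {u : kostant} {Q : Module.End (ZMod p) (L p)} (h : ReducesTo u.1 Q) :
    kostantAction p u = Q := (exists_reducesTo u).choose_spec.unique h

/-- The infinitesimal action of `SL₂` on functions. -/
def distAction (p : ℕ) : Dist p →ₐ[ZMod p] Module.End (ZMod p) (L p) :=
  Algebra.TensorProduct.lift (Algebra.ofId (ZMod p) _) (kostantAction p)
    fun x _ => by rw [Algebra.ofId_apply]; exact Algebra.commute_algebraMap_left x _

theorem distAction_ofKostant {u : kostant} {Q : Module.End (ZMod p) (L p)}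
    (h : ReducesTo u.1 Q) : distAction p (1 ⊗ₜ[ℤ] u) = Q := by
  refine (Algebra.TensorProduct.lift_tmul _ _ _ _ _).trans ?_
  rw [map_one, one_mul, kostantAction_eq h]

theorem isCanonicalAction_distAction : IsCanonicalAction p (distAction p) where
  map_E n := distAction_ofKostant (reducesTo_divPow_envE n)
  map_F n := distAction_ofKostant (reducesTo_divPow_envF n)
  map_H n := distAction_ofKostant (reducesTo_binom_envH n)

variable [Fact p.Prime]

/-- The diagonal operator `T ^ j ↦ q j T ^ j`. -/
def diagOp (p : ℕ) (q : intPoly) : Module.End (ZMod p) (L p) :=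
  onMonomials fun j => modVal p j q • T j

theorem diagOp_T (q : intPoly) (j : ℤ) : diagOp p q (T j) = modVal p j q • T j :=
  onMonomials_T _ _

theorem diagOp_mem_fn (V : Chart) (q : intPoly) {f : L p} (hf : f ∈ V.fn p) :
    diagOp p q f ∈ V.fn p := by
  rcases V.fn_cases (p := p) with h | ⟨ε, h⟩
  · rw [h]; exact Algebra.mem_top
  rw [h] at hf ⊢
  refine (Subalgebra.mem_toSubmodule _).1 (adjoin_T_induction (fun i => ?_) f hf)
  rw [diagOp_T]
  exact Submodule.smul_mem _ _ ((Subalgebra.mem_toSubmodule _).2 (T_mem_adjoin ε i rfl))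

/-- For q = C(X, b) the operator is T^b ∂_T^[b]; Newton's expansion gives the general case. -/
theorem diagOp_mem_diffOp {d : ℕ} (q : intPoly) (hq : q.1.natDegree ≤ d) :
    diagOp p q ∈ diffOp (ZMod p) (L p) d := by
  refine intPoly_induction (C := fun q => diagOp p q ∈ diffOp (ZMod p) (L p) d)
    ?_ (fun b hb => ?_) (fun q r hq hr => ?_) (fun z q hq => ?_) q hq
  · have : diagOp p 0 = 0 := linearMap_ext_T fun j => by rw [diagOp_T]; simp
    rw [this]; exact zero_mem _
  · have : diagOp p (binomInt b) = LinearMap.mulLeft (ZMod p) (T b) * hasse p 1 b :=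
      linearMap_ext_T fun j => by
        rw [diagOp_T, Module.End.mul_apply, hasse_T, map_smul, LinearMap.mulLeft_apply,
          ← LaurentPolynomial.T_add, modVal_binomInt]
        simp
    rw [this]
    exact diffOp_mono (by omega) (diffOp_mul_mem (mulLeft_mem_diffOp _ _ 0) (hasse_mem_diffOp 1 b))
  · have : diagOp p (q + r) = diagOp p q + diagOp p r := linearMap_ext_T fun j => by
      rw [LinearMap.add_apply, diagOp_T, diagOp_T, diagOp_T, map_add, add_smul]
    rw [this]; exact add_mem hq hr
  · have : diagOp p (z • q) = (z : ZMod p) • diagOp p q := linearMap_ext_T fun j => by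
      rw [LinearMap.smul_apply, diagOp_T, diagOp_T, map_zsmul, smul_smul, zsmul_eq_mul]
    rw [this]; exact Submodule.smul_mem _ _ hq

theorem binomEuler_mem_sheafDiff (V : Chart) (n : ℕ) : binomEuler p n ∈ sheafDiff p V n := by
  have : binomEuler p n = diagOp p (affineInt (-2) 0 (binomInt n)) := linearMap_ext_T fun j => by
    rw [binomEuler_T, diagOp_T, modVal_affineInt, modVal_binomInt, add_zero]
  rw [this]
  exact ⟨diagOp_mem_diffOp _ (natDegree_affineInt_binomInt_le _ _ _),
    fun _ hf => diagOp_mem_fn V _ hf⟩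

theorem IsCanonicalAction.mem_sheafDiff {ρ : Dist p →ₐ[ZMod p] Module.End (ZMod p) (L p)}
    (h : IsCanonicalAction p ρ) (V : Chart) {n : ℕ} {x : Dist p} (hx : x ∈ distFil p n) :
    ρ x ∈ sheafDiff p V n := by
  have hF := isAlmostCommFiltration_sheafDiff (p := p) V
  refine distFil_induction (C := fun x => ρ x ∈ sheafDiff p V n) (fun a c b hn => ?_)
    (by simp) (fun x y hx hy => by rw [map_add]; exact add_mem hx hy)
    (fun z x hx => by rw [map_smul]; exact Submodule.smul_mem _ _ hx) hx
  rw [← distH_eq, map_mul, map_mul, h.map_E, h.map_F, h.map_H]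
  exact hF.mono hn (hF.mul_mem (hF.mul_mem (hasse_mem_sheafDiff V 1 a)
    (hasse_mem_sheafDiff V (-1) c)) (binomEuler_mem_sheafDiff V b))

theorem IsCanonicalAction.eq_on {ρ ρ' : Dist p →ₐ[ZMod p] Module.End (ZMod p) (L p)}
    (h : IsCanonicalAction p ρ) (h' : IsCanonicalAction p ρ') (x : Dist p) : ρ x = ρ' x := by
  suffices ρ.toLinearMap = ρ'.toLinearMap from LinearMap.congr_fun this x
  refine (distBasis p).ext fun i => ?_
  rw [distBasis_apply, ← distH_eq]
  simp only [AlgHom.toLinearMap_apply, map_mul, h.map_E, h.map_F, h.map_H, h'.map_E, h'.map_F,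
    h'.map_H]

theorem one_mem_distFil (n : ℕ) : (1 : Dist p) ∈ distFil p n :=
  distFil_mono (Nat.zero_le n) isAlmostCommFiltration_distFil.one_mem

theorem exists_isRho (m : ℕ) : ∃ ρ : U p m →ₐ[ZMod p] H0 p m, IsRho p m ρ := by
  have hc := isCanonicalAction_distAction (p := p)
  have ex : ∀ V : Chart, ∃ g : U p m →ₐ[ZMod p] D p m V, ∀ x : distFil p (genOrder p m),
      g (lev (ZMod p) (distFil p) p m x) = dlev p m V ⟨distAction p x, hc.mem_sheafDiff V x.2⟩ :=
    fun V => Level.exists_map (distAction p) fun _ _ hx => hc.mem_sheafDiff V hx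
  choose g hg using ex
  have hres : ∀ V u, res p m V (g V u) = g .overlap u := by
    intro V u
    refine Level.induction (P := fun u => res p m V (g V u) = g .overlap u) (one_mem_distFil _)
      (fun x => ?_) (fun a b ha hb => by simp only [map_add, ha, hb])
      (fun a b ha hb => by simp only [map_mul, ha, hb]) u
    rw [hg, hg, res, levelMap_lev]
  refine ⟨((g .zero).prod (g .infty)).codRestrict (H0 p m) fun u => ?_, distAction p, hc,
    fun x => ⟨hc.mem_sheafDiff _ x.2, hc.mem_sheafDiff _ x.2, ?_⟩⟩
  · change res p m .zero (g .zero u) = res p m .infty (g .infty u)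
    rw [hres, hres]
  · exact Prod.ext (hg .zero x) (hg .infty x)

end Action
end
end SL2Frobenius

namespace SL2Frobenius

noncomputable section

/-! ### Uniqueness and compatibility at level `m` -/

section Final

open LaurentPolynomial

variable {p : ℕ} [Fact p.Prime] {m : ℕ}

theorem U_induction {P : U p m → Prop} (lev_mem : ∀ x, P (lev (ZMod p) (distFil p) p m x))
    (add : ∀ a b, P a → P b → P (a + b)) (mul : ∀ a b, P a → P b → P (a * b)) (u : U p m) :
    P u :=
  Level.induction (Fil := distFil p) (one_mem_distFil (genOrder p m)) lev_mem add mul u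

theorem frobDist_mem {x : Dist p} (hx : x ∈ distFil p (genOrder p m)) :
    frobDist p x ∈ distFil p (genOrder p (m + 1)) :=
  (isFrobeniusSplitting_frobDist (m + 1)).map_mem isAlmostCommFiltration_distFil
    (Nat.Prime.pos Fact.out) _ le_rfl x hx

theorem IsPhi.map_lev {φ : U p m →ₙₐ[ZMod p] U p (m + 1)} (h : IsPhi p m φ)
    (x : distFil p (genOrder p m)) : φ (lev (ZMod p) (distFil p) p m x) =
      lev (ZMod p) (distFil p) p (m + 1) ⟨frobDist p x, frobDist_mem x.2⟩ :=
  h.elim fun _ hf => (hf.2 x).choose_spec.trans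
    (congrArg (lev (ZMod p) (distFil p) p (m + 1))
      (Subtype.ext (hf.1.eq_on isSplitting_frobDist x)))

theorem IsPhi.unique {φ φ' : U p m →ₙₐ[ZMod p] U p (m + 1)} (h : IsPhi p m φ)
    (h' : IsPhi p m φ') : φ = φ' :=
  NonUnitalAlgHom.ext <| U_induction (P := fun u => φ u = φ' u)
    (fun x => (h.map_lev x).trans (h'.map_lev x).symm)
    (fun a b ha hb => (map_add φ a b).trans
      ((congrArg₂ (· + ·) ha hb).trans (map_add φ' a b).symm))
    (fun a b ha hb => (map_mul φ a b).trans
      ((congrArg₂ (· * ·) ha hb).trans (map_mul φ' a b).symm))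

theorem distAction_mem (V : Chart) {n : ℕ} {x : Dist p} (hx : x ∈ distFil p n) :
    distAction p x ∈ sheafDiff p V n :=
  isCanonicalAction_distAction.mem_sheafDiff V hx

theorem IsRho.map_lev {ρ : U p m →ₐ[ZMod p] H0 p m} (h : IsRho p m ρ)
    (x : distFil p (genOrder p m)) :
    (ρ (lev (ZMod p) (distFil p) p m x) : D p m .zero × D p m .infty) =
      (dlev p m .zero ⟨distAction p x, distAction_mem _ x.2⟩,
        dlev p m .infty ⟨distAction p x, distAction_mem _ x.2⟩) := by
  obtain ⟨f, hf, h⟩ := h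
  have e := hf.eq_on isCanonicalAction_distAction x
  exact (h x).choose_spec.choose_spec.trans (congrArg₂ Prod.mk
    (congrArg (dlev p m .zero) (Subtype.ext e)) (congrArg (dlev p m .infty) (Subtype.ext e)))

theorem IsRho.unique {ρ ρ' : U p m →ₐ[ZMod p] H0 p m} (h : IsRho p m ρ) (h' : IsRho p m ρ') :
    ρ = ρ' :=
  AlgHom.ext <| U_induction (P := fun u => ρ u = ρ' u)
    (fun x => Subtype.ext ((h.map_lev x).trans (h'.map_lev x).symm))
    (fun a b ha hb => (map_add ρ a b).trans
      ((congrArg₂ (· + ·) ha hb).trans (map_add ρ' a b).symm))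
    (fun a b ha hb => (map_mul ρ a b).trans
      ((congrArg₂ (· * ·) ha hb).trans (map_mul ρ' a b).symm))

omit [Fact p.Prime] in
theorem sub_one_le_genOrder : p - 1 ≤ genOrder p (m + 1) := by
  have h : p ≤ p ^ (m + 1) := Nat.le_self_pow (by omega) p
  rw [genOrder]
  omega

theorem garnier_mem {V : Chart} {P : Module.End (ZMod p) (L p)}
    (hP : P ∈ sheafDiff p V (genOrder p m)) :
    garnier p P ∈ sheafDiff p V (genOrder p (m + 1)) :=
  (isFrobeniusSplitting_garnier V (m + 1)).map_mem (isAlmostCommFiltration_sheafDiff V)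
    (Nat.Prime.pos Fact.out) _ le_rfl P hP

theorem one_mem_sheafDiff (V : Chart) (n : ℕ) :
    (1 : Module.End (ZMod p) (L p)) ∈ sheafDiff p V n :=
  (isAlmostCommFiltration_sheafDiff V).mono (Nat.zero_le n)
    (isAlmostCommFiltration_sheafDiff V).one_mem

theorem dlev_one (V : Chart) : dlev p m V ⟨1, one_mem_sheafDiff V _⟩ = 1 := by
  rw [lev_scalar 1 _ (map_one _).symm, map_one]

theorem dlev_mul {V : Chart} {i j : ℕ} (hij : i + j ≤ genOrder p m)
    (x y z : sheafDiff p V (genOrder p m)) (hx : x.1 ∈ sheafDiff p V i)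
    (hy : y.1 ∈ sheafDiff p V j) (hz : z.1 = x.1 * y.1) :
    dlev p m V x * dlev p m V y = dlev p m V z :=
  lev_mul (isAlmostCommFiltration_sheafDiff V) (splitsAt_sheafDiff V m) (Nat.Prime.pos Fact.out)
    hij x y z hx hy hz

theorem IsGarnier.map_dlev {γ : ∀ V : Chart, D p m V →ₙₐ[ZMod p] D p (m + 1) V}
    (hγ : IsGarnier p m γ) (V : Chart) (P : sheafDiff p V (genOrder p m)) :
    γ V (dlev p m V P) = dlev p (m + 1) V ⟨garnier p P, garnier_mem P.2⟩ := by
  obtain ⟨P', h, e⟩ := hγ.gen V P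
  rw [e]
  congr 1
  exact Subtype.ext (isGarnierTransform_iff.1 h)

theorem IsGarnier.unique {γ γ' : ∀ V : Chart, D p m V →ₙₐ[ZMod p] D p (m + 1) V}
    (hγ : IsGarnier p m γ) (hγ' : IsGarnier p m γ') : γ = γ' := by
  funext V
  ext P
  refine Level.induction (P := fun P => γ V P = γ' V P) (one_mem_sheafDiff V _) (fun P => ?_)
    (fun a b ha hb => by rw [map_add, map_add, ha, hb])
    (fun a b ha hb => by rw [map_mul, map_mul, ha, hb]) P
  exact (hγ.map_dlev V P).trans (hγ'.map_dlev V P).symm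

theorem exists_isGarnier (p : ℕ) [Fact p.Prime] (m : ℕ) :
    ∃ γ : ∀ V : Chart, D p m V →ₙₐ[ZMod p] D p (m + 1) V, IsGarnier p m γ := by
  have ex : ∀ V : Chart, ∃ g : D p m V →ₙₐ[ZMod p] D p (m + 1) V,
      ∀ P, g (dlev p m V P) = dlev p (m + 1) V ⟨garnier p P, garnier_mem P.2⟩ := fun V =>
    (isFrobeniusSplitting_garnier V (m + 1)).exists_level (isAlmostCommFiltration_sheafDiff V)
      (splitsAt_sheafDiff V (m + 1)) (Nat.Prime.pos Fact.out)
  choose γ hγ using ex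
  refine ⟨γ, fun V P => ⟨_, isGarnierTransform_iff.2 rfl, hγ V P⟩, fun V P => ?_, fun V a P => ?_⟩
  · refine Level.induction
      (P := fun P => res p (m + 1) V (γ V P) = γ .overlap (res p m V P)) (one_mem_sheafDiff V _)
      (fun P => ?_) (fun a b ha hb => by simp only [map_add, ha, hb])
      (fun a b ha hb => by simp only [map_mul, ha, hb]) P
    rw [hγ, res, res, levelMap_lev, levelMap_lev, hγ]
  -- The image of 1 is the class of ℋ rather than 1, so a function a goes to a^p ℋ; the extra ℋ is
  -- absorbed by γ(P) = γ(1) γ(P).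
  · have h1 : γ V P = dlev p (m + 1) V ⟨garnier p 1, garnier_mem (one_mem_sheafDiff V _)⟩ *
        γ V P := by
      rw [← hγ V ⟨1, one_mem_sheafDiff V _⟩, ← map_mul, dlev_one, one_mul]
    have h2 : γ V (ofFun p m V a) = ofFun p (m + 1) V (a ^ p) *
        dlev p (m + 1) V ⟨garnier p 1, garnier_mem (one_mem_sheafDiff V _)⟩ := by
      rw [ofFun, ofFun, hγ]
      refine (dlev_mul (i := 0) (j := p - 1) (by rw [zero_add]; exact sub_one_le_genOrder) _ _ _
        (mulLeft_mem_sheafDiff (a ^ p).2 0) ?_ ?_).symm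
      · change garnier p 1 ∈ _
        rw [garnier_one]
        exact dwork_mem_sheafDiff V
      · change garnier p _ = LinearMap.mulLeft _ _ * garnier p 1
        rw [garnier_one, garnier_mulLeft]
        rfl
    rw [map_mul, h2, mul_assoc, ← h1]

/-- Taking p-th powers is additive and both actions turn products into compositions, so generators
suffice. -/
theorem IsGarnier.dact_pow {γ : ∀ V : Chart, D p m V →ₙₐ[ZMod p] D p (m + 1) V}
    (hγ : IsGarnier p m γ) (V : Chart) (P : D p m V) (f : L p) :
    dact p (m + 1) V (γ V P) (f ^ p) = (dact p m V P f) ^ p := by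
  revert f
  refine Level.induction
    (P := fun P => ∀ f, dact p (m + 1) V (γ V P) (f ^ p) = (dact p m V P f) ^ p)
    (one_mem_sheafDiff V _) (fun P f => ?_) (fun a b ha hb f => ?_) (fun a b ha hb f => ?_) P
  · rw [hγ.map_dlev, dact, dact, act_lev, act_lev]
    exact (isGarnierTransform_iff.2 rfl).frob f
  · rw [map_add, map_add, map_add, LinearMap.add_apply, LinearMap.add_apply, ha, hb,
      ← frobMap_apply, ← frobMap_apply, ← frobMap_apply, map_add]
  · rw [map_mul, map_mul, map_mul, Module.End.mul_apply, Module.End.mul_apply, hb, ha]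

theorem garnier_binomEuler (n : ℕ) :
    garnier p (binomEuler p n) = binomEuler p (n * p) * dwork p := by
  refine linearMap_ext_T fun j => ?_
  rw [garnier_apply, contr_T, Module.End.mul_apply, dwork_T]
  by_cases h : (p : ℤ) ∣ j
  · rw [if_pos h, if_pos h]
    obtain ⟨i, rfl⟩ := h
    have hp : (p : ℤ) ≠ 0 := by exact_mod_cast (Nat.Prime.pos (Fact.out : p.Prime)).ne'
    rw [Int.mul_ediv_cancel_left _ hp, binomEuler_T, map_smul, frobMap_T, binomEuler_T,
      ← binomMod_mul_prime, mul_comm i]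
    congr 2
    ring
  · rw [if_neg h, if_neg h, map_zero, map_zero, map_zero]

/-- As H multiplies T^j by -2j, the image of Δ_T keeps T^j exactly when p ∣ 2j, and p odd turns this
into p ∣ j. -/
theorem IsCanonicalAction.map_normT (hp : p ≠ 2)
    {ρ : Dist p →ₐ[ZMod p] Module.End (ZMod p) (L p)} (h : IsCanonicalAction p ρ) :
    ρ (normT p) = dwork p := by
  refine linearMap_ext_T fun j => ?_
  have e : ∀ i ∈ Finset.range p, ρ ((-1) ^ i * distH p i) (T j) =
      ((-1) ^ i * binomMod p (-2 * j) i) • T j := by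
    intro i _
    rw [neg_one_pow_mul_eq_smul, map_smul, h.map_H, LinearMap.smul_apply, binomEuler_T, smul_smul]
  have hdvd : (p : ℤ) ∣ -2 * j ↔ (p : ℤ) ∣ j := by
    have h2 : IsCoprime (p : ℤ) (-2) := by
      rw [IsCoprime.neg_right_iff]
      exact Nat.isCoprime_iff_coprime.2
        ((Nat.coprime_primes Fact.out Nat.prime_two).2 hp)
    exact ⟨h2.dvd_of_dvd_mul_left, fun h => h.mul_left _⟩
  rw [normT, map_sum, LinearMap.sum_apply, Finset.sum_congr rfl e, ← Finset.sum_smul, sum_binomMod,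
    dwork_T]
  simp only [hdvd]
  split_ifs <;> simp

/-- Both composites are multiplicative, so only the generators matter; there Δ_T becomes ℋ, and the
images are those given by `garnier_hasse` and `garnier_binomEuler`. -/
theorem IsSplitting.action_comm (hp : p ≠ 2) {φ : Dist p →ₙₐ[ZMod p] Dist p}
    (hφ : IsSplitting p φ) {ρ : Dist p →ₐ[ZMod p] Module.End (ZMod p) (L p)}
    (hρ : IsCanonicalAction p ρ) (x : Dist p) : ρ (φ x) = garnier p (ρ x) := by
  suffices ρ.toLinearMap ∘ₗ (φ : Dist p →ₗ[ZMod p] Dist p) =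
      (garnier p : Module.End (ZMod p) (L p) →ₗ[ZMod p] Module.End (ZMod p) (L p)) ∘ₗ
        ρ.toLinearMap from LinearMap.congr_fun this x
  refine (distBasis p).ext fun i => ?_
  change ρ (φ _) = garnier p (ρ _)
  rw [distBasis_apply, ← distH_eq]
  simp only [map_mul, hφ.map_E, hφ.map_F, hφ.map_H, hρ.map_normT hp, hρ.map_E, hρ.map_F, hρ.map_H,
    garnier_hasse, garnier_binomEuler]

theorem square_comm (hp : p ≠ 2) {φ : U p m →ₙₐ[ZMod p] U p (m + 1)}
    {ρ : U p m →ₐ[ZMod p] H0 p m} {ρ' : U p (m + 1) →ₐ[ZMod p] H0 p (m + 1)}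
    {γ : ∀ V : Chart, D p m V →ₙₐ[ZMod p] D p (m + 1) V} (hγ : IsGarnier p m γ)
    (hφ : IsPhi p m φ) (hρ : IsRho p m ρ) (hρ' : IsRho p (m + 1) ρ') (u : U p m) :
    ρ' (φ u) = globalMap γ hγ (ρ u) := by
  suffices (ρ' (φ u)).1 = (γ .zero (ρ u).1.1, γ .infty (ρ u).1.2) from Subtype.ext this
  refine U_induction
    (P := fun u => (ρ' (φ u)).1 = (γ .zero (ρ u).1.1, γ .infty (ρ u).1.2))
    (fun x => ?_) (fun a b ha hb => ?_) (fun a b ha hb => ?_) u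
  · have key : distAction p (frobDist p x) = garnier p (distAction p x) :=
      isSplitting_frobDist.action_comm hp isCanonicalAction_distAction x
    have e : ∀ V, γ V (dlev p m V ⟨distAction p x, distAction_mem _ x.2⟩) =
        dlev p (m + 1) V ⟨distAction p (frobDist p x), distAction_mem _ (frobDist_mem x.2)⟩ :=
      fun V => (hγ.map_dlev V _).trans (congrArg (dlev p (m + 1) V) (Subtype.ext key.symm))
    have e' := hρ.map_lev x
    refine (congrArg (fun y => (ρ' y).1) (hφ.map_lev x)).trans ((hρ'.map_lev _).trans ?_)
    exact congrArg₂ Prod.mk ((congrArg (fun y => γ .zero y.1) e').trans (e .zero)).symm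
      ((congrArg (fun y => γ .infty y.2) e').trans (e .infty)).symm
  · have h1 : (ρ' (φ (a + b))).1 = (ρ' (φ a)).1 + (ρ' (φ b)).1 :=
      congrArg Subtype.val ((congrArg ρ' (map_add φ a b)).trans (map_add ρ' _ _))
    have h2 : (ρ (a + b)).1 = (ρ a).1 + (ρ b).1 := congrArg Subtype.val (map_add ρ a b)
    refine (h1.trans (congrArg₂ (· + ·) ha hb)).trans ?_
    refine congrArg₂ Prod.mk ?_ ?_
    · exact (map_add (γ .zero) _ _).symm.trans (congrArg (fun y => γ .zero y.1) h2.symm)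
    · exact (map_add (γ .infty) _ _).symm.trans (congrArg (fun y => γ .infty y.2) h2.symm)
  · have h1 : (ρ' (φ (a * b))).1 = (ρ' (φ a)).1 * (ρ' (φ b)).1 :=
      congrArg Subtype.val ((congrArg ρ' (map_mul φ a b)).trans (map_mul ρ' _ _))
    have h2 : (ρ (a * b)).1 = (ρ a).1 * (ρ b).1 := congrArg Subtype.val (map_mul ρ a b)
    refine (h1.trans (congrArg₂ (· * ·) ha hb)).trans ?_
    refine congrArg₂ Prod.mk ?_ ?_
    · exact (map_mul (γ .zero) _ _).symm.trans (congrArg (fun y => γ .zero y.1) h2.symm)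
    · exact (map_mul (γ .infty) _ _).symm.trans (congrArg (fun y => γ .infty y.2) h2.symm)

/-- The orders np of ∂^[np] and p - 1 of ℋ together stay within level m + 1, so `dlev_mul` computes
the product of their classes. -/
theorem mul_prime_add_le_genOrder {n : ℕ} (hn : n ≤ genOrder p m) :
    n * p + (p - 1) ≤ genOrder p (m + 1) := by
  have hp : 0 < p := Nat.Prime.pos Fact.out
  have hq : 0 < p ^ m := pow_pos hp m
  have h1 : (n + 1) * p ≤ 2 * p ^ m * p := Nat.mul_le_mul_right _ (by rw [genOrder] at hn; omega)
  have h2 : 2 * p ^ m * p = 2 * p ^ (m + 1) := by rw [pow_succ, mul_assoc]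
  rw [add_mul] at h1
  rw [genOrder]
  omega

theorem garnier_hasse_eq_garnierSum (ε : ℤˣ) (n : ℕ) :
    garnier p (hasse p ε n) = garnierSum p ε n := by
  rw [garnier_hasse, garnierSum_eq]

theorem IsGarnier.map_hasse {γ : ∀ V : Chart, D p m V →ₙₐ[ZMod p] D p (m + 1) V}
    (hγ : IsGarnier p m γ) (V : Chart) (ε : ℤˣ) {n : ℕ} (hn : n ≤ genOrder p m) :
    ∃ (h₁ : hasse p ε n ∈ sheafDiff p V (genOrder p m))
      (h₂ : garnierSum p ε n ∈ sheafDiff p V (genOrder p (m + 1)))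
      (h₃ : hasse p ε (n * p) ∈ sheafDiff p V (genOrder p (m + 1)))
      (h₄ : dwork p ∈ sheafDiff p V (genOrder p (m + 1))),
      γ V (dlev p m V ⟨hasse p ε n, h₁⟩) = dlev p (m + 1) V ⟨garnierSum p ε n, h₂⟩ ∧
      dlev p (m + 1) V ⟨garnierSum p ε n, h₂⟩ =
        dlev p (m + 1) V ⟨hasse p ε (n * p), h₃⟩ * dlev p (m + 1) V ⟨dwork p, h₄⟩ := by
  have hF := isAlmostCommFiltration_sheafDiff (p := p) V
  have hle := mul_prime_add_le_genOrder hn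
  have h₁ := hF.mono hn (hasse_mem_sheafDiff V ε n)
  refine ⟨h₁, garnier_hasse_eq_garnierSum (p := p) ε n ▸ garnier_mem h₁,
    hF.mono (by omega) (hasse_mem_sheafDiff V ε (n * p)),
    hF.mono (by omega) (dwork_mem_sheafDiff V), ?_, ?_⟩
  · rw [hγ.map_dlev]
    congr 1
    exact Subtype.ext (garnier_hasse_eq_garnierSum ε n)
  · exact (dlev_mul (p := p) (m := m + 1) hle _ _ _ (hasse_mem_sheafDiff V ε (n * p))
      (dwork_mem_sheafDiff V) (garnierSum_eq ε n)).symm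

theorem existsUnique_isRho (p : ℕ) [Fact p.Prime] (m : ℕ) :
    ∃! ρ : U p m →ₐ[ZMod p] H0 p m, IsRho p m ρ :=
  (exists_isRho m).elim fun ρ h => ⟨ρ, h, fun _ h' => h'.unique h⟩

end Final
end
end SL2Frobenius

theorem proposition3p2p2 (p : ℕ) [Fact p.Prime] (hp : p ≠ 2) (m : ℕ) :
    -- the four maps exist and are unique
    (∃! φ : U p m →ₙₐ[ZMod p] U p (m + 1), IsPhi p m φ) ∧
    (∃! ρ : U p m →ₐ[ZMod p] H0 p m, IsRho p m ρ) ∧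
    (∃! ρ' : U p (m + 1) →ₐ[ZMod p] H0 p (m + 1), IsRho p (m + 1) ρ') ∧
    (∃! γ : ∀ V : Chart, D p m V →ₙₐ[ZMod p] D p (m + 1) V, IsGarnier p m γ) ∧
    -- the square commutes
    (∀ (φ : U p m →ₙₐ[ZMod p] U p (m + 1)) (ρ : U p m →ₐ[ZMod p] H0 p m)
      (ρ' : U p (m + 1) →ₐ[ZMod p] H0 p (m + 1))
      (γ : ∀ V : Chart, D p m V →ₙₐ[ZMod p] D p (m + 1) V) (hγ : IsGarnier p m γ),
      IsPhi p m φ → IsRho p m ρ → IsRho p (m + 1) ρ' →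
      ∀ u : U p m, ρ' (φ u) = globalMap γ hγ (ρ u)) ∧
    (∀ γ : ∀ V : Chart, D p m V →ₙₐ[ZMod p] D p (m + 1) V, IsGarnier p m γ →
      -- compatibility with the Frobenius pullback of functions
      (∀ (V : Chart) (P : D p m V) (f : L p),
        dact p (m + 1) V (γ V P) (f ^ p) = (dact p m V P f) ^ p) ∧
      -- the local formulas at level `m`
      (∀ (V : Chart) (ε : ℤˣ), (V = .zero → ε = 1) → (V = .infty → ε = -1) →
        ∀ n ≤ genOrder p m,
        ∃ (h₁ : hasse p ε n ∈ sheafDiff p V (genOrder p m))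
          (h₂ : garnierSum p ε n ∈ sheafDiff p V (genOrder p (m + 1)))
          (h₃ : hasse p ε (n * p) ∈ sheafDiff p V (genOrder p (m + 1)))
          (h₄ : dwork p ∈ sheafDiff p V (genOrder p (m + 1))),
          γ V (dlev p m V ⟨hasse p ε n, h₁⟩) = dlev p (m + 1) V ⟨garnierSum p ε n, h₂⟩ ∧
          dlev p (m + 1) V ⟨garnierSum p ε n, h₂⟩ =
            dlev p (m + 1) V ⟨hasse p ε (n * p), h₃⟩ * dlev p (m + 1) V ⟨dwork p, h₄⟩)) ∧
    -- the local formulas for usual differential operators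
    (∀ (ε : ℤˣ) (n : ℕ), IsGarnierTransform p (hasse p ε n) (garnierSum p ε n) ∧
      garnierSum p ε n = hasse p ε (n * p) * dwork p) :=
  ⟨(exists_isPhi m).elim fun φ h => ⟨φ, h, fun _ h' => h'.unique h⟩,
    existsUnique_isRho p m, existsUnique_isRho p (m + 1),
    (exists_isGarnier p m).elim fun γ h => ⟨γ, h, fun _ h' => h'.unique h⟩,
    fun _ _ _ _ hγ hφ hρ hρ' u => square_comm hp hγ hφ hρ hρ' u,
    fun _ hγ => ⟨hγ.dact_pow, fun V ε _ _ _ hn => hγ.map_hasse V ε hn⟩,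
    fun ε n => ⟨isGarnierTransform_iff.2 (garnier_hasse_eq_garnierSum ε n).symm,
      garnierSum_eq ε n⟩⟩
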